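/- Conventions. All manifolds are smooth, finite-dimensional, without boundary, Hausdorff and second countable. A \emph{smooth groupoid} $G$ consists of manifolds $G_0$ (objects) and $G_1$ (arrows) with smooth source and target maps $s,t\colon G_1\to G_0$, $s$ a submersion, a smooth composition $(g,h)\mapsto gh$ defined on $\{(g,h)\in G_1\times G_1 : s(g)=t(h)\}$, smooth units $x\mapsto 1_x$ and smooth inverses, satisfying the groupoid axioms (with $s(gh)=s(h)$, $t(gh)=t(g)$). It is an \emph{orbifold groupoid} if $s$ is a local diffeomorphism and $(s,t)\colon G_1\to G_0\times G_0$ is proper. It is \emph{connected} if the quotient space $G_0/G$, in which two objects are identified when there is an arrow between them, is connected. In an orbifold groupoid each arrow $g\colon x\to y$ induces the germ at $x$ of the local diffeomorphism $t\circ(s|_U)^{-1}$ of $G_0$, where $U$ is a small neighbourhood of $g$ in $G_1$; the \emph{ineffective stabilizer group} $S^0_x$ at $x\in G_0$ is the group of arrows $g\colon x\to x$ whose germ is the germ of the identity. For a right action of a Lie group $K$ on a manifold $P$, the \emph{translation groupoid} $P\rtimes K$ has objects $P$, arrows $P\times K$, $t(x,k)=x$, $s(x,k)=xk$ and $(x,k)(xk,l)=(x,kl)$.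 Two smooth groupoids $G$ and $H$ are \emph{equivalent} (in the sense of Hilsum and Skandalis) if there is a manifold $Q$ with maps $s_Q\colon Q\to G_0$, $t_Q\colon Q\to H_0$ and commuting smooth actions of $G$ on the left along $s_Q$ and of $H$ on the right along $t_Q$, such that $s_Q$ is a principal right $H$-bundle and $t_Q$ is a principal left $G$-bundle; here $s_Q$ is principal if it is an $H$-invariant surjective submersion and $(q,h)\mapsto(q,qh)$ is a diffeomorphism from $\{(q,h)\in Q\times H_1 : t_Q(q)=t(h)\}$ onto $Q\times_{G_0}Q$, and similarly for $t_Q$. Theorem. Let $G$ be a connected orbifold groupoid such that for every $x\in G_0$ the ineffective stabilizer group $S^0_x$ has trivial center. Then there are a compact Lie group $K$, a manifold $P$ and a smooth right action of $K$ on $P$ such that $G$ is equivalent to the translation groupoid $P\rtimes K$. -/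

import Mathlib

open scoped Manifold ContDiff Topology

universe u

noncomputable section

namespace OrbifoldPresentation

set_option linter.unusedSectionVars false

section SmoothMaps

variable {E E' : Type*} [NormedAddCommGroup E] [NormedSpace ℝ E]
  [NormedAddCommGroup E'] [NormedSpace ℝ E']
  {H H' : Type*} [TopologicalSpace H] [TopologicalSpace H']
  (I : ModelWithCorners ℝ E H) (J : ModelWithCorners ℝ E' H')
  {M N : Type*} [TopologicalSpace M] [ChartedSpace H M] [TopologicalSpace N] [ChartedSpace H' N]

/-- A map defined on a subset `S` of a manifold is smooth if it is locally the restriction of a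
smooth map defined on an open subset of the ambient manifold. When `S` is an embedded submanifold,
such as a fibre product along a submersion, this is smoothness for the submanifold structure. -/
def SmoothOnSubset {S : Set M} (f : S → N) : Prop :=
  ∀ x : S, ∃ U : Set M, IsOpen U ∧ (x : M) ∈ U ∧
    ∃ F : M → N, ContMDiffOn I J ∞ F U ∧ ∀ y : S, (y : M) ∈ U → F y = f y

/-- A diffeomorphism between subsets (embedded submanifolds in all our uses) of two manifolds. -/
def IsDiffeoOfSubsets {S : Set M} {T : Set N} (f : S → T) : Prop :=
  SmoothOnSubset I J (fun x => (f x : N)) ∧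
    ∃ f' : T → S, Function.LeftInverse f' f ∧ Function.RightInverse f' f ∧
      SmoothOnSubset J I (fun y => (f' y : M))

end SmoothMaps

section Groupoids

variable {E₀ E₁ : Type*} [NormedAddCommGroup E₀] [NormedSpace ℝ E₀] [FiniteDimensional ℝ E₀]
  [NormedAddCommGroup E₁] [NormedSpace ℝ E₁] [FiniteDimensional ℝ E₁]
  {H₀ H₁ : Type*} [TopologicalSpace H₀] [TopologicalSpace H₁]
  (I₀ : ModelWithCorners ℝ E₀ H₀) [I₀.Boundaryless]
  (I₁ : ModelWithCorners ℝ E₁ H₁) [I₁.Boundaryless]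
  (G₀ G₁ : Type*)
  [TopologicalSpace G₀] [ChartedSpace H₀ G₀] [IsManifold I₀ ∞ G₀] [T2Space G₀]
  [SecondCountableTopology G₀]
  [TopologicalSpace G₁] [ChartedSpace H₁ G₁] [IsManifold I₁ ∞ G₁] [T2Space G₁]
  [SecondCountableTopology G₁]

/-- A smooth groupoid with manifold of objects `G₀` and manifold of arrows `G₁`. An arrow `g` goes
from `s g` to `t g`, and `comp g h _` is the composite `gh`, defined when `s g = t h`. -/
structure SmoothGroupoid where
  s : G₁ → G₀
  t : G₁ → G₀
  unit : G₀ → G₁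
  inv : G₁ → G₁
  comp : ∀ g h : G₁, s g = t h → G₁
  smooth_s : ContMDiff I₁ I₀ ∞ s
  smooth_t : ContMDiff I₁ I₀ ∞ t
  smooth_unit : ContMDiff I₀ I₁ ∞ unit
  smooth_inv : ContMDiff I₁ I₁ ∞ inv
  smooth_comp : SmoothOnSubset (I₁.prod I₁) I₁
    (fun p : {p : G₁ × G₁ | s p.1 = t p.2} => comp p.1.1 p.1.2 p.2)
  s_unit : ∀ x, s (unit x) = x
  t_unit : ∀ x, t (unit x) = x
  s_inv : ∀ g, s (inv g) = t g
  t_inv : ∀ g, t (inv g) = s g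
  s_comp : ∀ g h (e : s g = t h), s (comp g h e) = s h
  t_comp : ∀ g h (e : s g = t h), t (comp g h e) = t g
  assoc : ∀ g h k (e : s g = t h) (e' : s h = t k),
    comp g (comp h k e') (e.trans (t_comp h k e').symm) =
      comp (comp g h e) k ((s_comp g h e).trans e')
  comp_unit : ∀ g, comp g (unit (s g)) (t_unit (s g)).symm = g
  unit_comp : ∀ g, comp (unit (t g)) g (s_unit (t g)) = g
  inv_comp : ∀ g, comp (inv g) g (s_inv g) = unit (s g)
  comp_inv : ∀ g, comp g (inv g) (t_inv g).symm = unit (t g)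
  submersion_s : Manifold.IsSubmersion I₁ I₀ ∞ s

/-- An orbifold groupoid is a proper étale smooth groupoid. -/
structure OrbifoldGroupoid extends SmoothGroupoid I₀ I₁ G₀ G₁ where
  etale : IsLocalDiffeomorph I₁ I₀ ∞ s
  proper : IsProperMap (fun g => (s g, t g))

variable {I₀ I₁ G₀ G₁}

namespace SmoothGroupoid

variable (G : SmoothGroupoid I₀ I₁ G₀ G₁)

/-- Two objects are equivalent if there is an arrow between them. -/
def orbitSetoid : Setoid G₀ where
  r x y := ∃ g, G.s g = x ∧ G.t g = y
  iseqv :=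
    { refl := fun x => ⟨G.unit x, G.s_unit x, G.t_unit x⟩
      symm := fun ⟨g, hs, ht⟩ => ⟨G.inv g, (G.s_inv g).trans ht, (G.t_inv g).trans hs⟩
      trans := fun ⟨g, hs, ht⟩ ⟨h, hs', ht'⟩ =>
        ⟨G.comp h g (hs'.trans ht.symm), (G.s_comp _ _ _).trans hs, (G.t_comp _ _ _).trans ht'⟩ }

/-- The topological (coarse) quotient of a groupoid, with the quotient topology. -/
abbrev TopQuotient : Type _ := Quotient G.orbitSetoid

/-- A groupoid is connected if its topological quotient is connected. -/
def IsConnected : Prop := ConnectedSpace G.TopQuotient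

/-- The stabilizer of an object `x`: all arrows from `x` to `x`. -/
def Stabilizer (x : G₀) : Type _ := {g : G₁ // G.s g = x ∧ G.t g = x}

instance (x : G₀) : Group (G.Stabilizer x) where
  mul g h := ⟨G.comp g.1 h.1 (g.2.1.trans h.2.2.symm),
    (G.s_comp _ _ _).trans h.2.1, (G.t_comp _ _ _).trans g.2.2⟩
  one := ⟨G.unit x, G.s_unit x, G.t_unit x⟩
  inv g := ⟨G.inv g.1, (G.s_inv _).trans g.2.2, (G.t_inv _).trans g.2.1⟩
  mul_assoc g h k := Subtype.ext (G.assoc g.1 h.1 k.1 _ _).symm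
  one_mul := by
    rintro ⟨g, rfl, ht⟩
    refine Subtype.ext ?_
    have := G.unit_comp g
    simp only [ht] at this
    exact this
  mul_one := by
    rintro ⟨g, rfl, ht⟩
    exact Subtype.ext (G.comp_unit g)
  inv_mul_cancel := by
    rintro ⟨g, rfl, ht⟩
    exact Subtype.ext (G.inv_comp g)

/-- In an étale groupoid an arrow `g : x → y` induces the germ at `x` of the diffeomorphism
`t ∘ (s|_U)⁻¹`, where `U` is a neighbourhood of `g` on which `s` is a diffeomorphism onto an open
set; the germ does not depend on `U`. -/
def arrowGerm (hG : IsLocalDiffeomorph I₁ I₀ ∞ G.s) (g : G₁) : (𝓝 (G.s g)).Germ G₀ :=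
  ((G.t ∘ (hG g).localInverse : G₀ → G₀) : (𝓝 (G.s g)).Germ G₀)

/-- The germ of an arrow can be computed with any continuous local section of `s` through it. -/
theorem arrowGerm_eq (hG : IsLocalDiffeomorph I₁ I₀ ∞ G.s) (g : G₁) (σ : G₀ → G₁)
    (hσ : ContinuousAt σ (G.s g)) (hg : σ (G.s g) = g)
    (hs : ∀ᶠ y in 𝓝 (G.s g), G.s (σ y) = y) :
    G.arrowGerm hG g = ((G.t ∘ σ : G₀ → G₀) : (𝓝 (G.s g)).Germ G₀) := by
  refine Filter.Germ.coe_eq.2 ?_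
  have h1 : ∀ᶠ z in 𝓝 (σ (G.s g)), (hG g).localInverse (G.s z) = z := by
    rw [hg]
    exact (hG g).localInverse_eventuallyEq_left
  filter_upwards [hσ.eventually h1, hs] with y hy hsy
  simp only [Function.comp_apply]
  rw [hsy] at hy
  rw [hy]

end SmoothGroupoid

namespace OrbifoldGroupoid

variable (G : OrbifoldGroupoid I₀ I₁ G₀ G₁)

/-- An arrow is an ineffective stabilizer if it has equal source and target and induces the germ of
the identity map. -/
def IsIneffective (g : G₁) : Prop :=
  G.s g = G.t g ∧
    G.toSmoothGroupoid.arrowGerm G.etale g = ((id : G₀ → G₀) : (𝓝 (G.s g)).Germ G₀)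

/-- An ineffective stabilizer has a local section of both `s` and `t` through it. -/
theorem IsIneffective.exists_section {G : OrbifoldGroupoid I₀ I₁ G₀ G₁} {g : G₁}
    (h : G.IsIneffective g) : ∃ σ : G₀ → G₁, ContinuousAt σ (G.s g) ∧ σ (G.s g) = g ∧
      ∀ᶠ y in 𝓝 (G.s g), G.s (σ y) = y ∧ G.t (σ y) = y := by
  refine ⟨(G.etale g).localInverse, (G.etale g).localInverse_contMDiffAt.continuousAt,
    (G.etale g).localInverse_left_inv (G.etale g).localInverse_mem_target, ?_⟩
  filter_upwards [(G.etale g).localInverse_eventuallyEq_right, Filter.Germ.coe_eq.1 h.2]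
    with y h1 h2 using ⟨h1, h2⟩

theorem isIneffective_of_section {g : G₁} (σ : G₀ → G₁) (hσ : ContinuousAt σ (G.s g))
    (hg : σ (G.s g) = g) (h : ∀ᶠ y in 𝓝 (G.s g), G.s (σ y) = y ∧ G.t (σ y) = y) :
    G.IsIneffective g := by
  refine ⟨?_, ?_⟩
  · have := h.self_of_nhds.2
    rw [hg] at this
    exact this.symm
  · rw [G.toSmoothGroupoid.arrowGerm_eq G.etale g σ hσ hg (h.mono fun _ h => h.1)]
    exact Filter.Germ.coe_eq.2 (h.mono fun _ h => h.2)

theorem isIneffective_unit (x : G₀) : G.IsIneffective (G.unit x) :=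
  G.isIneffective_of_section G.unit G.smooth_unit.continuous.continuousAt
    (by rw [G.s_unit]) (Filter.Eventually.of_forall fun y => ⟨G.s_unit y, G.t_unit y⟩)

theorem IsIneffective.inv {G : OrbifoldGroupoid I₀ I₁ G₀ G₁} {g : G₁} (h : G.IsIneffective g) :
    G.IsIneffective (G.inv g) := by
  obtain ⟨σ, hσ, hg, hst⟩ := h.exists_section
  have e : G.s (G.inv g) = G.s g := (G.s_inv g).trans h.1.symm
  refine G.isIneffective_of_section (fun y => G.inv (σ y)) ?_ ?_ ?_
  · rw [e]
    exact G.smooth_inv.continuous.continuousAt.comp hσ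
  · rw [e, hg]
  · rw [e]
    filter_upwards [hst] with y hy using ⟨(G.s_inv _).trans hy.2, (G.t_inv _).trans hy.1⟩

theorem IsIneffective.comp {G : OrbifoldGroupoid I₀ I₁ G₀ G₁} {g h : G₁}
    (hg : G.IsIneffective g) (hh : G.IsIneffective h) (e : G.s g = G.t h) :
    G.IsIneffective (G.comp g h e) := by
  obtain ⟨a, ha, hag, hast⟩ := hg.exists_section
  obtain ⟨b, hb, hbh, hbst⟩ := hh.exists_section
  have ex : G.s h = G.s g := hh.1.trans e.symm
  have ec : G.s (G.comp g h e) = G.s g := (G.s_comp g h e).trans ex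
  rw [ex] at hb hbh hbst
  obtain ⟨U, hU, hxU, F, hF, hFeq⟩ := G.smooth_comp ⟨(g, h), e⟩
  have hab : ContinuousAt (fun y => (a y, b y)) (G.s g) := ha.prodMk hb
  have hab' : (a (G.s g), b (G.s g)) = (g, h) := by rw [hag, hbh]
  have hmem : U ∈ 𝓝 (a (G.s g), b (G.s g)) := by
    rw [hab']
    exact hU.mem_nhds hxU
  refine G.isIneffective_of_section (fun y => F (a y, b y)) ?_ ?_ ?_
  · rw [ec]
    exact ContinuousAt.comp (f := fun y => (a y, b y)) (g := F)
      (hF.continuousOn.continuousAt hmem) hab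
  · rw [ec, hab']
    exact hFeq ⟨(g, h), e⟩ hxU
  · rw [ec]
    filter_upwards [hast, hbst, hab.preimage_mem_nhds hmem] with y h1 h2 h3
    have e' : G.s (a y) = G.t (b y) := h1.1.trans h2.2.symm
    have := hFeq ⟨(a y, b y), e'⟩ h3
    simp only at this
    rw [this]
    exact ⟨(G.s_comp _ _ _).trans h2.1, (G.t_comp _ _ _).trans h1.2⟩

/-- The group of ineffective stabilizers at `x`. -/
def ineffectiveStabilizer (x : G₀) : Subgroup (G.toSmoothGroupoid.Stabilizer x) where
  carrier := {g | G.IsIneffective g.1}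
  mul_mem' {g h} hg hh := IsIneffective.comp hg hh (g.2.1.trans h.2.2.symm)
  one_mem' := G.isIneffective_unit x
  inv_mem' hg := IsIneffective.inv hg

end OrbifoldGroupoid

section Actions

variable (G : SmoothGroupoid I₀ I₁ G₀ G₁)
  {E : Type*} [NormedAddCommGroup E] [NormedSpace ℝ E] [FiniteDimensional ℝ E]
  {H : Type*} [TopologicalSpace H] (J : ModelWithCorners ℝ E H) [J.Boundaryless]
  {Q : Type*} [TopologicalSpace Q] [ChartedSpace H Q] [IsManifold J ∞ Q] [T2Space Q]
  [SecondCountableTopology Q]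

/-- A smooth left action of a groupoid on a manifold `Q` with base map `π`. -/
structure LeftAction (π : Q → G₀) where
  smooth_base : ContMDiff J I₀ ∞ π
  act : ∀ (g : G₁) (q : Q), G.s g = π q → Q
  smooth_act : SmoothOnSubset (I₁.prod J) J
    (fun a : {a : G₁ × Q | G.s a.1 = π a.2} => act a.1.1 a.1.2 a.2)
  base_act : ∀ g q e, π (act g q e) = G.t g
  unit_act : ∀ q, act (G.unit (π q)) q (G.s_unit _) = q
  comp_act : ∀ g h q (e : G.s g = G.t h) (e' : G.s h = π q),
    act g (act h q e') (e.trans (base_act h q e').symm) =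
      act (G.comp g h e) q ((G.s_comp g h e).trans e')

/-- A smooth right action of a groupoid on a manifold `Q` with base map `π`. -/
structure RightAction (π : Q → G₀) where
  smooth_base : ContMDiff J I₀ ∞ π
  act : ∀ (q : Q) (g : G₁), π q = G.t g → Q
  smooth_act : SmoothOnSubset (J.prod I₁) J
    (fun a : {a : Q × G₁ | π a.1 = G.t a.2} => act a.1.1 a.1.2 a.2)
  base_act : ∀ q g e, π (act q g e) = G.s g
  act_unit : ∀ q, act q (G.unit (π q)) (G.t_unit _).symm = q
  act_comp : ∀ q g h (e : π q = G.t g) (e' : G.s g = G.t h),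
    act (act q g e) h ((base_act q g e).trans e') =
      act q (G.comp g h e') (e.trans (G.t_comp g h e').symm)

variable {G J} {E' : Type*} [NormedAddCommGroup E'] [NormedSpace ℝ E'] [FiniteDimensional ℝ E']
  {H' : Type*} [TopologicalSpace H'] (I' : ModelWithCorners ℝ E' H') [I'.Boundaryless]
  {B : Type*} [TopologicalSpace B] [ChartedSpace H' B] [IsManifold I' ∞ B] [T2Space B]
  [SecondCountableTopology B]

/-- `p : Q → B` is a principal bundle for the given left action of the groupoid on `Q`. -/
structure LeftAction.IsPrincipal {π : Q → G₀} (a : LeftAction G J π) (p : Q → B) : Prop where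
  invariant : ∀ g q e, p (a.act g q e) = p q
  surjective : Function.Surjective p
  submersion : Manifold.IsSubmersion J I' ∞ p
  diffeo : IsDiffeoOfSubsets (I₁.prod J) (J.prod J)
    (fun b : {b : G₁ × Q | G.s b.1 = π b.2} =>
      (⟨(a.act b.1.1 b.1.2 b.2, b.1.2), invariant _ _ b.2⟩ : {c : Q × Q | p c.1 = p c.2}))

/-- `p : Q → B` is a principal bundle for the given right action of the groupoid on `Q`. -/
structure RightAction.IsPrincipal {π : Q → G₀} (a : RightAction G J π) (p : Q → B) : Prop where
  invariant : ∀ q g e, p (a.act q g e) = p q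
  surjective : Function.Surjective p
  submersion : Manifold.IsSubmersion J I' ∞ p
  diffeo : IsDiffeoOfSubsets (J.prod I₁) (J.prod J)
    (fun b : {b : Q × G₁ | π b.1 = G.t b.2} =>
      (⟨(b.1.1, a.act b.1.1 b.1.2 b.2), (invariant _ _ b.2).symm⟩ :
        {c : Q × Q | p c.1 = p c.2}))

end Actions

end Groupoids

section Equivalence

variable {E₀ E₁ F₀ F₁ : Type*}
  [NormedAddCommGroup E₀] [NormedSpace ℝ E₀] [FiniteDimensional ℝ E₀]
  [NormedAddCommGroup E₁] [NormedSpace ℝ E₁] [FiniteDimensional ℝ E₁]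
  [NormedAddCommGroup F₀] [NormedSpace ℝ F₀] [FiniteDimensional ℝ F₀]
  [NormedAddCommGroup F₁] [NormedSpace ℝ F₁] [FiniteDimensional ℝ F₁]
  {M₀ M₁ N₀ N₁ : Type*} [TopologicalSpace M₀] [TopologicalSpace M₁]
  [TopologicalSpace N₀] [TopologicalSpace N₁]
  {I₀ : ModelWithCorners ℝ E₀ M₀} [I₀.Boundaryless]
  {I₁ : ModelWithCorners ℝ E₁ M₁} [I₁.Boundaryless]
  {J₀ : ModelWithCorners ℝ F₀ N₀} [J₀.Boundaryless]
  {J₁ : ModelWithCorners ℝ F₁ N₁} [J₁.Boundaryless]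
  {G₀ G₁ H₀ H₁ : Type u}
  [TopologicalSpace G₀] [ChartedSpace M₀ G₀] [IsManifold I₀ ∞ G₀] [T2Space G₀]
  [SecondCountableTopology G₀]
  [TopologicalSpace G₁] [ChartedSpace M₁ G₁] [IsManifold I₁ ∞ G₁] [T2Space G₁]
  [SecondCountableTopology G₁]
  [TopologicalSpace H₀] [ChartedSpace N₀ H₀] [IsManifold J₀ ∞ H₀] [T2Space H₀]
  [SecondCountableTopology H₀]
  [TopologicalSpace H₁] [ChartedSpace N₁ H₁] [IsManifold J₁ ∞ H₁] [T2Space H₁]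
  [SecondCountableTopology H₁]
  (G : SmoothGroupoid I₀ I₁ G₀ G₁) (H : SmoothGroupoid J₀ J₁ H₀ H₁)

/-- A Hilsum–Skandalis morphism from `G` to `H`, carried by the manifold `Q`. -/
structure HSMorphism (q : ℕ) (Q : Type u) [TopologicalSpace Q]
    [ChartedSpace (EuclideanSpace ℝ (Fin q)) Q] [IsManifold (𝓡 q) ∞ Q] [T2Space Q]
    [SecondCountableTopology Q] where
  sQ : Q → G₀
  tQ : Q → H₀
  left : LeftAction G (𝓡 q) sQ
  right : RightAction H (𝓡 q) tQ
  sQ_right : ∀ x h e, sQ (right.act x h e) = sQ x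
  tQ_left : ∀ g x e, tQ (left.act g x e) = tQ x
  compatible : ∀ g x h (e : G.s g = sQ x) (e' : tQ x = H.t h),
    right.act (left.act g x e) h ((tQ_left g x e).trans e') =
      left.act g (right.act x h e') (e.trans (sQ_right x h e').symm)
  right_principal : right.IsPrincipal I₀ sQ

/-- Two smooth groupoids are equivalent if there is a Hilsum–Skandalis morphism between them for
which both maps to the object manifolds are principal bundles. -/
def HSEquivalent : Prop :=
  ∃ (q : ℕ) (Q : Type u) (_ : TopologicalSpace Q)
    (_ : ChartedSpace (EuclideanSpace ℝ (Fin q)) Q) (_ : IsManifold (𝓡 q) ∞ Q) (_ : T2Space Q)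
    (_ : SecondCountableTopology Q) (φ : HSMorphism G H q Q),
    φ.left.IsPrincipal J₀ φ.tQ

end Equivalence

section Translation

variable {E E' : Type*} [NormedAddCommGroup E] [NormedSpace ℝ E] [FiniteDimensional ℝ E]
  [NormedAddCommGroup E'] [NormedSpace ℝ E'] [FiniteDimensional ℝ E']
  {H H' : Type*} [TopologicalSpace H] [TopologicalSpace H']
  (I : ModelWithCorners ℝ E H) [I.Boundaryless]
  (J : ModelWithCorners ℝ E' H') [J.Boundaryless]
  (P K : Type*)
  [TopologicalSpace P] [ChartedSpace H P] [IsManifold I ∞ P] [T2Space P]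
  [SecondCountableTopology P]
  [Group K] [TopologicalSpace K] [ChartedSpace H' K] [LieGroup J ∞ K] [T2Space K]
  [SecondCountableTopology K]

/-- A smooth right action of a Lie group `K` on a manifold `P`. -/
structure LieRightAction where
  act : P → K → P
  smooth_act : ContMDiff (I.prod J) I ∞ (fun a : P × K => act a.1 a.2)
  act_one : ∀ x, act x 1 = x
  act_mul : ∀ x k l, act x (k * l) = act (act x k) l

variable {I J P K}

namespace LieRightAction

variable (α : LieRightAction I J P K)

/-- The diffeomorphism `(x, k) ↦ (xk, k)` of `P × K`. -/
def shear : (P × K) ≃ₘ^∞⟮I.prod J, I.prod J⟯ (P × K) where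
  toFun a := (α.act a.1 a.2, a.2)
  invFun a := (α.act a.1 a.2⁻¹, a.2)
  left_inv a := by simp [← α.act_mul, α.act_one]
  right_inv a := by simp [← α.act_mul, α.act_one]
  contMDiff_toFun := α.smooth_act.prodMk contMDiff_snd
  contMDiff_invFun := by
    have h : ContMDiff (I.prod J) (I.prod J) ∞ (fun a : P × K => (a.1, a.2⁻¹)) :=
      contMDiff_fst.prodMk contMDiff_snd.inv
    exact (α.smooth_act.comp h).prodMk contMDiff_snd

theorem isSubmersion_act :
    Manifold.IsSubmersion (I.prod J) I ∞ (fun a : P × K => α.act a.1 a.2) := by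
  have : IsManifold J ∞ K := (inferInstance : ContMDiffMul J ∞ K).toIsManifold
  refine Manifold.IsSubmersionOfComplement.isSubmersion (F := E') fun a => ?_
  set c : OpenPartialHomeomorph (P × K) (ModelProd H H') := chartAt (ModelProd H H') (α.shear a)
    with hc
  have hcm : c ∈ IsManifold.maximalAtlas (I.prod J) ∞ (P × K) := IsManifold.chart_mem_maximalAtlas _
  set φ : OpenPartialHomeomorph (P × K) (ModelProd H H') :=
    α.shear.toHomeomorph.toOpenPartialHomeomorph.trans c with hφ
  refine Manifold.IsSubmersionAtOfComplement.mk_of_charts (ContinuousLinearEquiv.refl ℝ (E × E'))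
    φ (chartAt H (α.act a.1 a.2)) ?_ (mem_chart_source H _) ?_
    (IsManifold.chart_mem_maximalAtlas _) ?_ ?_
  · simp only [hφ, OpenPartialHomeomorph.trans_source, Set.mem_inter_iff]
    exact ⟨trivial, mem_chart_source (ModelProd H H') (α.shear a)⟩
  · refine OpenPartialHomeomorph.mem_maximalAtlas_of_contMDiffOn _ ?_ ?_
    · exact (contMDiffOn_of_mem_maximalAtlas hcm).comp α.shear.contMDiff.contMDiffOn
        (fun x hx => hx.2)
    · exact α.shear.symm.contMDiff.comp_contMDiffOn
        ((contMDiffOn_symm_of_mem_maximalAtlas hcm).mono fun x hx => hx.1)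
  · intro b hb
    exact hb.2.1
  · rintro ⟨v, w⟩ hvw
    have h1 : (c.extend (I.prod J)) (α.shear ((φ.extend (I.prod J)).symm (v, w))) = (v, w) :=
      (φ.extend (I.prod J)).right_inv hvw
    exact congrArg Prod.fst h1

/-- The translation groupoid `P ⋊ K`: an arrow `(x, k)` has source `xk` and target `x`. -/
def translationGroupoid : SmoothGroupoid I (I.prod J) P (P × K) where
  s a := α.act a.1 a.2
  t a := a.1
  unit x := (x, 1)
  inv a := (α.act a.1 a.2, a.2⁻¹)
  comp a b _ := (a.1, a.2 * b.2)
  smooth_s := α.smooth_act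
  smooth_t := contMDiff_fst
  smooth_unit := contMDiff_id.prodMk contMDiff_const
  smooth_inv := α.smooth_act.prodMk contMDiff_snd.inv
  smooth_comp := fun _ => ⟨Set.univ, isOpen_univ, trivial,
    fun p => (p.1.1, p.1.2 * p.2.2),
    ((contMDiff_fst.comp contMDiff_fst).prodMk
      ((contMDiff_snd.comp contMDiff_fst).mul (contMDiff_snd.comp contMDiff_snd))).contMDiffOn,
    fun _ _ => rfl⟩
  s_unit := α.act_one
  t_unit _ := rfl
  s_inv a := by simp [← α.act_mul, α.act_one]
  t_inv _ := rfl
  s_comp a b e := by rw [α.act_mul, e]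
  t_comp _ _ _ := rfl
  assoc a b c _ _ := by simp [mul_assoc]
  comp_unit a := by simp
  unit_comp a := by simp
  inv_comp a := by simp
  comp_inv a := by simp
  submersion_s := α.isSubmersion_act

end LieRightAction

end Translation

end OrbifoldPresentation

end

/-! It suffices to represent `G` faithfully on a vector bundle by orthogonal maps. If every arrow
acts linearly and isometrically between the fibres of a metric vector bundle over `G₀`, and only
units act trivially among loops, then `G` acts freely on the bundle of orthonormal frames. The
action is proper because `G` is. Since `G` is étale, the quotient of the frame bundle by `G` is a
Hausdorff manifold `P`, the structure group `K` acts on it from the right, and the frame bundle is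
principal on both sides, over `G₀` for `K` and over `P` for `G`.

The faithful representation is a sum of two. The first is the tangent bundle, on which arrows act by
their derivatives. Stabilizers are finite, and a germ of finite order with identity derivative is
trivial, so the loops acting trivially are exactly the ineffective ones. An invariant metric makes
the action orthogonal; it is an average over arrows of cut-off chart metrics. The second is the
bundle of functions on the ineffective stabilizers, on which arrows act by conjugation. Ineffective
arrows form a finite covering of `G₀`, and connectedness makes its degree a constant `N`, so this
action is by permutations of `Fin N`. An ineffective loop acting trivially on both summands is
central in the ineffective stabilizer, hence a unit.

Bundles are encoded by cocycles. A `FaithfulCocycle` assigns to an arrow, and to charts around its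
source and target, an element of `K`. Here `K` is the unitary group of a product of two real
operator algebras, a product of orthogonal groups. The carrying results are
`FaithfulCocycle.hsEquivalent` (a faithful cocycle gives a presentation),
`isIneffective_of_jac_eq_one`, `exists_frames`, `exists_permCocycle`, `eq_unit_of_conj_eq` and
`exists_faithfulCocycle`. -/

noncomputable section

namespace OrbifoldPresentation

set_option linter.unusedSectionVars false

/-! ### Manifold structures defined by local homeomorphisms to a manifold. -/

section Glued

variable {E F : Type*} [NormedAddCommGroup E] [NormedSpace ℝ E]
  [NormedAddCommGroup F] [NormedSpace ℝ F]
  {H : Type*} [TopologicalSpace H] {I : ModelWithCorners ℝ E H}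
  {X N : Type*} [TopologicalSpace X] [TopologicalSpace N] [ChartedSpace H N]

variable (I X N) in
/-- A family of local homeomorphisms from a space `X` to a manifold `N`, with smooth transitions. -/
structure SmoothCover (ι : Type*) where
  e : ι → OpenPartialHomeomorph X N
  idx : X → ι
  mem : ∀ x, x ∈ (e (idx x)).source
  compat : ∀ a b, ContMDiffOn I I ∞ (fun y => e b ((e a).symm y))
    ((e a).target ∩ (e a).symm ⁻¹' (e b).source)

namespace SmoothCover

variable {ι : Type*} (c : SmoothCover I X N ι) [I.Boundaryless] (L : E ≃L[ℝ] F)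

/-- A chart of `N`, read in the vector space `F`. -/
def modelChart (_ : SmoothCover I X N ι) (φ : OpenPartialHomeomorph N H) :
    OpenPartialHomeomorph N F :=
  φ.trans (I.toHomeomorph.trans L.toHomeomorph).toOpenPartialHomeomorph

theorem modelChart_source (φ : OpenPartialHomeomorph N H) :
    (c.modelChart L φ).source = φ.source := by
  simp [modelChart]

theorem contMDiffOn_modelChart [IsManifold I ∞ N] {φ : OpenPartialHomeomorph N H}
    (hφ : φ ∈ IsManifold.maximalAtlas I ∞ N) :
    ContMDiffOn I 𝓘(ℝ, F) ∞ (c.modelChart L φ) (c.modelChart L φ).source := by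
  rw [modelChart_source]
  have h1 := contMDiffOn_of_mem_maximalAtlas hφ
  have h2 : ContMDiff I 𝓘(ℝ, E) ∞ I := I.contMDiff
  exact L.contDiff.contMDiff.comp_contMDiffOn (h2.comp_contMDiffOn h1)

theorem contMDiffOn_modelChart_symm [IsManifold I ∞ N] {φ : OpenPartialHomeomorph N H}
    (hφ : φ ∈ IsManifold.maximalAtlas I ∞ N) :
    ContMDiffOn 𝓘(ℝ, F) I ∞ (c.modelChart L φ).symm (c.modelChart L φ).target := by
  have h1 := contMDiffOn_symm_of_mem_maximalAtlas hφ
  have h2 : ContMDiffOn 𝓘(ℝ, E) I ∞ I.symm Set.univ := by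
    have := I.contMDiffOn_symm (n := ∞)
    rwa [I.range_eq_univ] at this
  refine h1.comp ((contMDiffOn_univ.1 h2).comp L.symm.contDiff.contMDiff).contMDiffOn ?_
  intro x hx
  simpa [modelChart, ModelWithCorners.toHomeomorph] using hx

/-- The charted space structure on a space covered by local homeomorphisms to `N`. -/
@[reducible] def chartedSpace : ChartedSpace F X where
  atlas := {f | ∃ a, ∃ φ ∈ atlas H N, f = (c.e a).trans (c.modelChart L φ)}
  chartAt x := (c.e (c.idx x)).trans (c.modelChart L (chartAt H (c.e (c.idx x) x)))
  mem_chart_source x := by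
    rw [OpenPartialHomeomorph.trans_source, modelChart_source]
    exact ⟨c.mem x, mem_chart_source H _⟩
  chart_mem_atlas x := ⟨_, _, chart_mem_atlas H _, rfl⟩

/-- A change of charts is a transition `compat` between two model charts of `N`. The same
construction serves the unitary group, the total space of the principal bundle and its quotient; the
linear isomorphism `L` puts the model space in Euclidean form. -/
theorem isManifold [IsManifold I ∞ N] :
    letI := c.chartedSpace L
    IsManifold 𝓘(ℝ, F) ∞ X := by
  let := c.chartedSpace L
  refine isManifold_of_contDiffOn _ _ _ ?_
  rintro _ _ ⟨a, φ, hφ, rfl⟩ ⟨b, ψ, hψ, rfl⟩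
  rw [← contMDiffOn_iff_contDiffOn]
  have h1 := c.contMDiffOn_modelChart_symm L (IsManifold.subset_maximalAtlas (I := I) (n := ∞) hφ)
  have h2 := c.contMDiffOn_modelChart L (IsManifold.subset_maximalAtlas (I := I) (n := ∞) hψ)
  refine (h2.comp ((c.compat a b).comp (h1.mono ?_) ?_) ?_).congr ?_
  all_goals intro x hx
  all_goals simp only [OpenPartialHomeomorph.trans_source, OpenPartialHomeomorph.symm_source,
      OpenPartialHomeomorph.trans_symm_eq_symm_trans_symm,
      OpenPartialHomeomorph.coe_trans, modelWithCornersSelf_coe_symm, modelWithCornersSelf_coe,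
      Set.mem_inter_iff, Set.mem_preimage, Function.comp_apply, id, Set.range_id, Set.preimage_id,
      Set.inter_univ] at hx ⊢
  all_goals tauto

/-- Together with `contMDiffOn_e_symm` this makes every member of the cover a diffeomorphism onto
its image, so smoothness on `X` can be checked in `N`. -/
theorem contMDiffOn_e [IsManifold I ∞ N] (a : ι) :
    letI := c.chartedSpace L
    ContMDiffOn 𝓘(ℝ, F) I ∞ (c.e a) (c.e a).source := by
  let := c.chartedSpace L
  have := c.isManifold L
  intro x hx
  set φ := chartAt H (c.e (c.idx x) x) with hφ
  have h0 : ContMDiffAt 𝓘(ℝ, F) 𝓘(ℝ, F) ∞ (chartAt F x) x :=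
    contMDiffOn_chart.contMDiffAt ((chartAt F x).open_source.mem_nhds (mem_chart_source F x))
  have e0 : chartAt F x = (c.e (c.idx x)).trans (c.modelChart L φ) := rfl
  have hx1 : c.e (c.idx x) x ∈ (c.modelChart L φ).source := by
    rw [modelChart_source]; exact mem_chart_source H _
  have h1 : ContMDiffAt 𝓘(ℝ, F) I ∞ (c.modelChart L φ).symm (chartAt F x x) :=
    (c.contMDiffOn_modelChart_symm L (IsManifold.chart_mem_maximalAtlas _)).contMDiffAt
      ((c.modelChart L φ).open_target.mem_nhds ((c.modelChart L φ).map_source hx1))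
  have e1 : (c.modelChart L φ).symm (chartAt F x x) = c.e (c.idx x) x :=
    (c.modelChart L φ).left_inv hx1
  have hS := (c.e (c.idx x)).isOpen_inter_preimage_symm (c.e a).open_source
  have h2 : ContMDiffAt I I ∞ (fun y => c.e a ((c.e (c.idx x)).symm y)) (c.e (c.idx x) x) :=
    (c.compat _ a).contMDiffAt (hS.mem_nhds ⟨(c.e _).map_source (c.mem x), by
      simpa [(c.e _).left_inv (c.mem x)] using hx⟩)
  rw [← e1] at h2
  have h3 := (h2.comp (chartAt F x x) h1).comp x h0
  refine (h3.congr_of_eventuallyEq ?_).contMDiffWithinAt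
  filter_upwards [(chartAt F x).open_source.mem_nhds (mem_chart_source F x)] with y hy
  rw [e0, OpenPartialHomeomorph.trans_source] at hy
  simp only [Function.comp_apply, e0, OpenPartialHomeomorph.coe_trans]
  rw [(c.modelChart L φ).left_inv hy.2, (c.e _).left_inv hy.1]

theorem contMDiffOn_e_symm [IsManifold I ∞ N] (a : ι) :
    letI := c.chartedSpace L
    ContMDiffOn I 𝓘(ℝ, F) ∞ (c.e a).symm (c.e a).target := by
  let := c.chartedSpace L
  have := c.isManifold L
  intro z hz
  set x := (c.e a).symm z with hxz
  have hx : x ∈ (c.e a).source := (c.e a).map_target hz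
  set φ := chartAt H (c.e (c.idx x) x) with hφ
  have e0 : chartAt F x = (c.e (c.idx x)).trans (c.modelChart L φ) := rfl
  have hx1 : c.e (c.idx x) x ∈ (c.modelChart L φ).source := by
    rw [modelChart_source]; exact mem_chart_source H _
  have hS := (c.e a).isOpen_inter_preimage_symm (c.e (c.idx x)).open_source
  have h0 : ContMDiffAt I I ∞ (fun y => c.e (c.idx x) ((c.e a).symm y)) z :=
    (c.compat a _).contMDiffAt (hS.mem_nhds ⟨hz, c.mem x⟩)
  have h1 : ContMDiffAt I 𝓘(ℝ, F) ∞ (c.modelChart L φ) (c.e (c.idx x) x) :=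
    (c.contMDiffOn_modelChart L (IsManifold.chart_mem_maximalAtlas _)).contMDiffAt
      ((c.modelChart L φ).open_source.mem_nhds hx1)
  have h2 : ContMDiffAt 𝓘(ℝ, F) 𝓘(ℝ, F) ∞ (chartAt F x).symm (chartAt F x x) :=
    contMDiffOn_chart_symm.contMDiffAt
      ((chartAt F x).open_target.mem_nhds (mem_chart_target F x))
  have h3 := h2.comp z (h1.comp z h0)
  refine (h3.congr_of_eventuallyEq ?_).contMDiffWithinAt
  have hc : ContinuousAt (c.e a).symm z := (c.e a).continuousAt_symm hz
  filter_upwards [hc.preimage_mem_nhds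
    ((chartAt F x).open_source.mem_nhds (mem_chart_source F x))] with y hy
  exact ((chartAt F x).left_inv hy).symm

end SmoothCover

end Glued

/-! ### The unitary group of a finite-dimensional real star algebra as a compact Lie group. -/

section Cayley

variable {A : Type*} [NormedRing A] [NormedAlgebra ℝ A] [StarRing A] [CStarRing A]
  [StarModule ℝ A] [FiniteDimensional ℝ A]

/-- The Cayley transform `(1 - a) / (1 + a)`. -/
def cayley (a : A) : A := (1 - a) * Ring.inverse (1 + a)

theorem cayley_mul {a : A} (h : IsUnit (1 + a)) : cayley a * (1 + a) = 1 - a := by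
  rw [cayley, mul_assoc, Ring.inverse_mul_cancel _ h, mul_one]

theorem mul_cayley {a : A} (h : IsUnit (1 + a)) : (1 + a) * cayley a = 1 - a := by
  obtain ⟨v, hv⟩ := h
  have hc : (1 - a) * (1 + a) = (1 + a) * (1 - a) := by noncomm_ring
  rw [cayley, ← hv] at *
  rw [Ring.inverse_unit, ← mul_assoc, ← hc, mul_assoc, Units.mul_inv, mul_one]

theorem one_add_cayley_mul {a : A} (h : IsUnit (1 + a)) : (1 + cayley a) * (1 + a) = 2 := by
  rw [add_mul, cayley_mul h, ← one_add_one_eq_two]; noncomm_ring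

theorem isUnit_two_of_realAlgebra : IsUnit (2 : A) := by
  have h : IsUnit (algebraMap ℝ A 2) := (IsUnit.mk0 (2 : ℝ) two_ne_zero).map _
  rwa [map_ofNat] at h

theorem isUnit_one_add_cayley {a : A} (h : IsUnit (1 + a)) : IsUnit (1 + cayley a) :=
  (IsUnit.mul_right_iff h).1 (by rw [one_add_cayley_mul h]; exact isUnit_two_of_realAlgebra)

theorem cayley_cayley {a : A} (h : IsUnit (1 + a)) : cayley (cayley a) = a := by
  have h' := isUnit_one_add_cayley h
  refine h'.mul_right_cancel ((cayley_mul h').trans ?_)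
  have := mul_cayley h
  rw [mul_add, mul_one]
  rw [add_mul, one_mul] at this
  rw [sub_eq_iff_eq_add, add_assoc, add_comm (a * _), this]
  noncomm_ring

/-- Multiplying by the units `1 + w` on the right and `1 + star w` on the left clears denominators
and leaves a consequence of `star w * w = 1`. With `cayley_mem_unitary` and `cayley_cayley`, the
Cayley transform exchanges unitary and skew-adjoint elements and is its own inverse, which gives
rational charts. -/
theorem star_cayley_unitary {w : A} (hw : w ∈ unitary A) (h : IsUnit (1 + w)) :
    star (cayley w) = -cayley w := by
  have h1 : star w * w = 1 := hw.1
  have h2 : w * star w = 1 := hw.2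
  refine h.mul_right_cancel ?_
  rw [neg_mul, cayley_mul h]
  have h3 : (1 + star w) * star (cayley w) = 1 - star w := by
    have := congrArg star (cayley_mul h)
    simpa using this
  have h4 : IsUnit (1 + star w) := by simpa using h.star
  refine h4.mul_left_cancel ?_
  rw [← mul_assoc, h3]
  linear_combination (norm := noncomm_ring) (-2 : ℤ) • h1

theorem cayley_mem_unitary {a : A} (ha : star a = -a) (h : IsUnit (1 + a)) :
    cayley a ∈ unitary A := by
  have h' : IsUnit (1 - a) := by simpa [ha, sub_eq_add_neg] using h.star
  have h1 : (1 - a) * star (cayley a) = 1 + a := by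
    have := congrArg star (cayley_mul h)
    simpa [ha, sub_eq_add_neg] using this
  have h2 := cayley_mul h
  constructor
  · refine h'.mul_left_cancel (h.mul_right_cancel ?_)
    rw [← mul_assoc, h1, mul_assoc, h2]; noncomm_ring
  · have h3 : star (cayley a) * (1 - a) = 1 + a := by
      have := congrArg star (mul_cayley h)
      simpa [ha, sub_eq_add_neg] using this
    refine h.mul_left_cancel (h'.mul_right_cancel ?_)
    rw [← mul_assoc, mul_cayley h, mul_assoc, h3]; noncomm_ring

theorem contDiffAt_cayley {a : A} (h : IsUnit (1 + a)) : ContDiffAt ℝ ∞ (cayley : A → A) a := by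
  have : CompleteSpace A := FiniteDimensional.complete ℝ A
  obtain ⟨v, hv⟩ := h
  have h1 : ContDiffAt ℝ ∞ (Ring.inverse : A → A) (1 + a) := by
    rw [← hv]; exact contDiffAt_ringInverse ℝ v
  exact (contDiffAt_const.sub contDiffAt_id).mul
    (h1.comp a (contDiffAt_const.add contDiffAt_id))

variable (A) in
/-- The Lie algebra of the unitary group. -/
abbrev Skew : Type _ := skewAdjoint.submodule ℝ A

/-- Projection to the skew-adjoint part. -/
def skewProj : A →L[ℝ] Skew A :=
  LinearMap.toContinuousLinearMap (skewAdjointPart ℝ : A →ₗ[ℝ] skewAdjoint A)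

theorem coe_skewProj {a : A} (ha : star a = -a) : (skewProj a : A) = a := by
  have : skewAdjointPart ℝ a = ⟨a, ha⟩ := by
    ext
    simp [skewAdjointPart, ha, ← two_smul ℝ a, smul_smul]
  change ((skewAdjointPart ℝ a : skewAdjoint A) : A) = a
  rw [this]

theorem isOpen_isUnit : IsOpen {a : A | IsUnit a} := by
  have : CompleteSpace A := FiniteDimensional.complete ℝ A
  exact Units.isOpen

open Classical in
/-- The Cayley chart of the unitary group centred at `u`. -/
def cayleyChart (u : unitary A) : OpenPartialHomeomorph (unitary A) (Skew A) where
  toFun v := skewProj (cayley (star (u : A) * v))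
  -- The value `1` is a default that never occurs on the target, by `cayley_mem_unitary`.
  invFun a := if h : cayley (a : A) ∈ unitary A then u * ⟨cayley (a : A), h⟩ else 1
  source := {v | IsUnit (1 + star (u : A) * v)}
  target := {a | IsUnit (1 + (a : A))}
  map_source' v hv := by
    have hw : star (u : A) * v ∈ unitary A := mul_mem (Unitary.star_mem u.2) v.2
    change IsUnit (1 + (skewProj (cayley (star (u : A) * v)) : A))
    rw [coe_skewProj (star_cayley_unitary hw hv)]
    exact isUnit_one_add_cayley hv
  map_target' a ha := by
    have h : cayley (a : A) ∈ unitary A := cayley_mem_unitary a.2 ha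
    rw [dif_pos h]
    change IsUnit (1 + star (u : A) * (u * cayley (a : A)))
    rw [← mul_assoc, u.2.1, one_mul]
    exact isUnit_one_add_cayley ha
  left_inv' v hv := by
    have hw : star (u : A) * v ∈ unitary A := mul_mem (Unitary.star_mem u.2) v.2
    have e := coe_skewProj (star_cayley_unitary hw hv)
    have e2 : cayley (skewProj (cayley (star (u : A) * v)) : A) = star (u : A) * v := by
      rw [e, cayley_cayley hv]
    rw [dif_pos (by rw [e2]; exact hw)]
    ext
    change (u : A) * cayley (skewProj (cayley (star (u : A) * v)) : A) = v
    rw [e2, ← mul_assoc, u.2.2, one_mul]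
  right_inv' a ha := by
    have h : cayley (a : A) ∈ unitary A := cayley_mem_unitary a.2 ha
    rw [dif_pos h]
    ext
    change (skewProj (cayley (star (u : A) * (u * cayley (a : A)))) : A) = a
    rw [← mul_assoc, u.2.1, one_mul, cayley_cayley ha, coe_skewProj a.2]
  open_source := isOpen_isUnit.preimage
    (continuous_const.add (continuous_const.mul continuous_subtype_val))
  open_target := isOpen_isUnit.preimage (continuous_const.add continuous_subtype_val)
  continuousOn_toFun v hv := by
    refine (skewProj.continuous.continuousAt.comp (ContinuousAt.comp
      (f := fun v : unitary A => star (u : A) * v) (contDiffAt_cayley hv).continuousAt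
      (by fun_prop))).continuousWithinAt
  continuousOn_invFun := by
    refine continuousOn_iff_continuous_domRestrict.2 ?_
    have : ∀ a : {a : Skew A | IsUnit (1 + (a : A))}, cayley (a : A) ∈ unitary A :=
      fun a => cayley_mem_unitary a.1.2 a.2
    have e : Set.domRestrict {a : Skew A | IsUnit (1 + (a : A))}
        (fun a => if h : cayley (a : A) ∈ unitary A then u * ⟨cayley (a : A), h⟩ else 1) =
        fun a => u * ⟨cayley (a.1 : A), this a⟩ := by
      funext a
      exact dif_pos (this a)
    rw [e]
    refine continuous_const.mul (Continuous.subtype_mk ?_ _)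
    refine continuous_iff_continuousAt.2 fun a => ?_
    exact ContinuousAt.comp (f := fun a : {a : Skew A | IsUnit (1 + (a : A))} => (a : A))
      (contDiffAt_cayley a.2).continuousAt (by fun_prop)

theorem mem_cayleyChart_source {u v : unitary A} :
    v ∈ (cayleyChart u).source ↔ IsUnit (1 + star (u : A) * v) := Iff.rfl

theorem cayleyChart_apply (u v : unitary A) :
    cayleyChart u v = skewProj (cayley (star (u : A) * v)) := rfl

open Classical in
theorem coe_cayleyChart_symm (u : unitary A) {a : Skew A} (ha : a ∈ (cayleyChart u).target) :
    ((cayleyChart u).symm a : A) = u * cayley (a : A) := by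
  have h : cayley (a : A) ∈ unitary A := cayley_mem_unitary a.2 ha
  change (((if h : cayley (a : A) ∈ unitary A then u * ⟨cayley (a : A), h⟩ else 1 :
    unitary A)) : A) = _
  rw [dif_pos h]
  rfl

theorem self_mem_cayleyChart_source (u : unitary A) : u ∈ (cayleyChart u).source := by
  rw [mem_cayleyChart_source, u.2.1, one_add_one_eq_two]
  exact isUnit_two_of_realAlgebra

variable (A) in
/-- The Cayley atlas of the unitary group. -/
def cayleyCover : SmoothCover 𝓘(ℝ, Skew A) (unitary A) (Skew A) (unitary A) where
  e := cayleyChart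
  idx := id
  mem := self_mem_cayleyChart_source
  compat u v := by
    rintro a ⟨ha, ha'⟩
    have h1 : ContDiffAt ℝ ∞ (fun b : Skew A => star (v : A) * (u * cayley (b : A))) a :=
      contDiffAt_const.mul (contDiffAt_const.mul
        ((contDiffAt_cayley ha).comp a (skewAdjoint.submodule ℝ A).subtypeL.contDiff.contDiffAt))
    have ha2 : IsUnit (1 + star (v : A) * (u * cayley (a : A))) := by
      have : IsUnit (1 + star (v : A) * ((cayleyChart u).symm a : A)) := ha'
      rwa [coe_cayleyChart_symm u ha] at this
    have h2 := skewProj.contDiff.contDiffAt.comp a ((contDiffAt_cayley ha2).comp a h1)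
    refine h2.contMDiffAt.contMDiffWithinAt.congr_of_mem ?_ ⟨ha, ha'⟩
    rintro b ⟨hb, -⟩
    simp only [cayleyChart_apply, coe_cayleyChart_symm u hb, Function.comp_apply]

variable (A) in
/-- A linear coordinate system on the Lie algebra of the unitary group. -/
def skewCoord : Skew A ≃L[ℝ] EuclideanSpace ℝ (Fin (Module.finrank ℝ (Skew A))) :=
  toEuclidean

instance : ChartedSpace (EuclideanSpace ℝ (Fin (Module.finrank ℝ (Skew A)))) (unitary A) :=
  (cayleyCover A).chartedSpace (skewCoord A)

instance : IsManifold (𝓡 (Module.finrank ℝ (Skew A))) ∞ (unitary A) :=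
  (cayleyCover A).isManifold (skewCoord A)

theorem contMDiff_unitary_coe :
    ContMDiff (𝓡 (Module.finrank ℝ (Skew A))) 𝓘(ℝ, A) ∞ (fun u : unitary A => (u : A)) := by
  intro u
  have h1 : ContMDiffAt (𝓡 (Module.finrank ℝ (Skew A))) 𝓘(ℝ, Skew A) ∞ (cayleyChart u) u :=
    ((cayleyCover A).contMDiffOn_e (skewCoord A) u).contMDiffAt
      ((cayleyChart u).open_source.mem_nhds (self_mem_cayleyChart_source u))
  have ht := (cayleyChart u).map_source (self_mem_cayleyChart_source u)
  have h2 : ContDiffAt ℝ ∞ (fun b : Skew A => (u : A) * cayley (b : A)) (cayleyChart u u) :=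
    contDiffAt_const.mul
        ((contDiffAt_cayley ht).comp _ (skewAdjoint.submodule ℝ A).subtypeL.contDiff.contDiffAt)
  refine (h2.contMDiffAt.comp u h1).congr_of_eventuallyEq ?_
  filter_upwards [(cayleyChart u).open_source.mem_nhds (self_mem_cayleyChart_source u)] with v hv
  simp only [Function.comp_apply]
  rw [← coe_cayleyChart_symm u ((cayleyChart u).map_source hv), (cayleyChart u).left_inv hv]

section

variable {E' : Type*} [NormedAddCommGroup E'] [NormedSpace ℝ E']
  {H' : Type*} [TopologicalSpace H'] {I' : ModelWithCorners ℝ E' H'}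
  {M : Type*} [TopologicalSpace M] [ChartedSpace H' M]

/-- In the Cayley chart at `f x`, the map `f` is a smooth function of its values in `A`. Smoothness
into the unitary group may thus be tested in the ambient algebra, where multiplication and `star`
are smooth. -/
theorem contMDiffWithinAt_unitary {f : M → unitary A} {s : Set M} {x : M}
    (hf : ContMDiffWithinAt I' 𝓘(ℝ, A) ∞ (fun y => (f y : A)) s x) :
    ContMDiffWithinAt I' (𝓡 (Module.finrank ℝ (Skew A))) ∞ f s x := by
  have hs := self_mem_cayleyChart_source (f x)
  have h1 : ContMDiffAt 𝓘(ℝ, Skew A) (𝓡 (Module.finrank ℝ (Skew A))) ∞ (cayleyChart (f x)).symm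
      (cayleyChart (f x) (f x)) :=
    ((cayleyCover A).contMDiffOn_e_symm (skewCoord A) (f x)).contMDiffAt
      ((cayleyChart (f x)).open_target.mem_nhds ((cayleyChart (f x)).map_source hs))
  have h2 : ContDiffAt ℝ ∞ (fun a : A => skewProj (cayley (star (f x : A) * a))) (f x : A) :=
    (skewProj (A := A)).contDiff.contDiffAt.comp _ (ContDiffAt.comp (f := fun a : A => star (f x : A) * a) _
      (contDiffAt_cayley hs) (contDiffAt_const.mul contDiffAt_id))
  have h3 := h1.comp_contMDiffWithinAt x
    (ContMDiffAt.comp_contMDiffWithinAt (f := fun y => (f y : A)) x h2.contMDiffAt hf)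
  have hc : ContinuousWithinAt f s x := Topology.IsInducing.subtypeVal.continuousWithinAt_iff.2 hf.continuousWithinAt
  refine h3.congr_of_eventuallyEq ?_ ?_
  · filter_upwards [hc.preimage_mem_nhdsWithin
      ((cayleyChart (f x)).open_source.mem_nhds hs)] with y hy
    exact ((cayleyChart (f x)).left_inv hy).symm
  · exact ((cayleyChart (f x)).left_inv hs).symm

end

instance : LieGroup (𝓡 (Module.finrank ℝ (Skew A))) ∞ (unitary A) where
  contMDiff_mul p := by
    refine contMDiffWithinAt_univ.1 (contMDiffWithinAt_unitary ?_)
    have hm : ContDiff ℝ ∞ (fun q : A × A => q.1 * q.2) := contDiff_mul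
    exact (hm.contMDiff.comp ((contMDiff_unitary_coe.comp contMDiff_fst).prodMk_space
      (contMDiff_unitary_coe.comp contMDiff_snd))).contMDiffAt
  contMDiff_inv p := by
    refine contMDiffWithinAt_univ.1 (contMDiffWithinAt_unitary ?_)
    have hm : ContDiff ℝ ∞ (star : A → A) := (starL' ℝ : A ≃L[ℝ] A).contDiff
    exact (hm.contMDiff.comp contMDiff_unitary_coe).contMDiffAt

instance : CompactSpace (unitary A) := by
  have : ProperSpace A := FiniteDimensional.proper_real A
  refine isCompact_iff_compactSpace.1 (Metric.isCompact_of_isClosed_isBounded ?_ ?_)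
  · have : ((unitary A : Submonoid A) : Set A) = {a | star a * a = 1} ∩ {a | a * star a = 1} := by
      ext a; exact Unitary.mem_iff
    rw [this]
    exact (isClosed_eq (by fun_prop) continuous_const).inter
      (isClosed_eq (by fun_prop) continuous_const)
  · refine (Metric.isBounded_iff_subset_closedBall 0).2 ⟨1, fun a ha => ?_⟩
    rw [mem_closedBall_zero_iff]
    -- The norm of `1` is idempotent; it vanishes when `A` is the zero algebra, so only the bound by
    -- one is claimed.
    have h : ‖a‖ * ‖a‖ = ‖(1 : A)‖ := by
      rw [← CStarRing.norm_star_mul_self, ha.1]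
    have h1 : ‖(1 : A)‖ * ‖(1 : A)‖ = ‖(1 : A)‖ := by
      rw [← CStarRing.norm_star_mul_self]; simp
    have h2 : ‖(1 : A)‖ ≤ 1 := by nlinarith [norm_nonneg (1 : A), sq_nonneg (‖(1 : A)‖ - 1)]
    nlinarith [norm_nonneg a]

end Cayley

/-! ### Calculus of arrows and local sections of the source map. -/

section Basic

variable {n m : ℕ} {G₀ G₁ : Type u}
  [TopologicalSpace G₀] [ChartedSpace (EuclideanSpace ℝ (Fin n)) G₀] [IsManifold (𝓡 n) ∞ G₀]
  [T2Space G₀] [SecondCountableTopology G₀]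
  [TopologicalSpace G₁] [ChartedSpace (EuclideanSpace ℝ (Fin m)) G₁] [IsManifold (𝓡 m) ∞ G₁]
  [T2Space G₁] [SecondCountableTopology G₁]

namespace SmoothGroupoid

variable (G : SmoothGroupoid (𝓡 n) (𝓡 m) G₀ G₁)

open Classical in
/-- The composite of two arrows, with a junk value if they are not composable. -/
def mul (g h : G₁) : G₁ := if e : G.s g = G.t h then G.comp g h e else g

theorem mul_eq {g h : G₁} (e : G.s g = G.t h) : G.mul g h = G.comp g h e := dif_pos e

theorem s_mul {g h : G₁} (e : G.s g = G.t h) : G.s (G.mul g h) = G.s h := by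
  rw [G.mul_eq e, G.s_comp]

theorem t_mul {g h : G₁} (e : G.s g = G.t h) : G.t (G.mul g h) = G.t g := by
  rw [G.mul_eq e, G.t_comp]

theorem mul_assoc {g h k : G₁} (e : G.s g = G.t h) (e' : G.s h = G.t k) :
    G.mul (G.mul g h) k = G.mul g (G.mul h k) := by
  rw [G.mul_eq e, G.mul_eq e', G.mul_eq ((G.s_comp g h e).trans e'),
    G.mul_eq (e.trans (G.t_comp h k e').symm), G.assoc]

theorem mul_unit (g : G₁) : G.mul g (G.unit (G.s g)) = g := by
  rw [G.mul_eq (G.t_unit _).symm, G.comp_unit]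

theorem unit_mul (g : G₁) : G.mul (G.unit (G.t g)) g = g := by
  rw [G.mul_eq (G.s_unit _), G.unit_comp]

theorem inv_mul (g : G₁) : G.mul (G.inv g) g = G.unit (G.s g) := by
  rw [G.mul_eq (G.s_inv _), G.inv_comp]

theorem mul_inv (g : G₁) : G.mul g (G.inv g) = G.unit (G.t g) := by
  rw [G.mul_eq (G.t_inv _).symm, G.comp_inv]

theorem mul_inv_mul {g h : G₁} (e : G.s g = G.s h) : G.mul (G.mul g (G.inv h)) h = g := by
  rw [G.mul_assoc (e.trans (G.t_inv h).symm) (G.s_inv h), G.inv_mul, ← e, G.mul_unit]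

theorem mul_right_cancel {g g' h : G₁} (e : G.s g = G.t h) (e' : G.s g' = G.t h)
    (hh : G.mul g h = G.mul g' h) : g = g' := by
  have : G.mul (G.mul g h) (G.inv h) = G.mul (G.mul g' h) (G.inv h) := by rw [hh]
  rwa [G.mul_assoc e (G.t_inv h).symm, G.mul_assoc e' (G.t_inv h).symm, G.mul_inv, ← e, G.mul_unit,
    e, ← e', G.mul_unit] at this

/-- The total operation `mul` has junk values, so continuity is only asserted along eventually
composable families. -/
theorem tendsto_mul {ι : Type*} {l : Filter ι} {a b : ι → G₁} {g h : G₁}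
    (e : G.s g = G.t h) (ha : Filter.Tendsto a l (𝓝 g)) (hb : Filter.Tendsto b l (𝓝 h))
    (hab : ∀ᶠ i in l, G.s (a i) = G.t (b i)) :
    Filter.Tendsto (fun i => G.mul (a i) (b i)) l (𝓝 (G.mul g h)) := by
  obtain ⟨U, hU, hxU, F, hF, hFeq⟩ := G.smooth_comp ⟨(g, h), e⟩
  have h1 : Filter.Tendsto (fun i => (a i, b i)) l (𝓝 (g, h)) := ha.prodMk_nhds hb
  have h2 : ContinuousAt F (g, h) := hF.continuousOn.continuousAt (hU.mem_nhds hxU)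
  have h3 : G.mul g h = F (g, h) := by rw [G.mul_eq e]; exact (hFeq ⟨(g, h), e⟩ hxU).symm
  rw [h3]
  refine (h2.tendsto.comp h1).congr' ?_
  filter_upwards [hab, h1.eventually (hU.mem_nhds hxU)] with i hi hi'
  rw [G.mul_eq hi]
  exact hFeq ⟨(a i, b i), hi⟩ hi'

end SmoothGroupoid

namespace OrbifoldGroupoid

variable (G : OrbifoldGroupoid (𝓡 n) (𝓡 m) G₀ G₁)

/-- The local section of the source map through an arrow. -/
def sec (g : G₁) : G₀ → G₁ := (G.etale g).localInverse

theorem sec_self (g : G₁) : G.sec g (G.s g) = g :=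
  (G.etale g).localInverse_left_inv (G.etale g).localInverse_mem_target

theorem s_sec (g : G₁) : ∀ᶠ y in 𝓝 (G.s g), G.s (G.sec g y) = y :=
  (G.etale g).localInverse_eventuallyEq_right

theorem sec_s (g : G₁) : ∀ᶠ h in 𝓝 g, G.sec g (G.s h) = h :=
  (G.etale g).localInverse_eventuallyEq_left

theorem contMDiffAt_sec (g : G₁) : ContMDiffAt (𝓡 n) (𝓡 m) ∞ (G.sec g) (G.s g) :=
  (G.etale g).localInverse_contMDiffAt

theorem eventually_contMDiffAt_sec (g : G₁) :
    ∀ᶠ y in 𝓝 (G.s g), ContMDiffAt (𝓡 n) (𝓡 m) ∞ (G.sec g) y := by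
  filter_upwards [(G.etale g).localInverse_open_source.mem_nhds
    (G.etale g).localInverse_mem_source] with y hy
  exact (G.etale g).localInverse_contMDiffOn.contMDiffAt
    ((G.etale g).localInverse_open_source.mem_nhds hy)

theorem tendsto_sec (g : G₁) : Filter.Tendsto (G.sec g) (𝓝 (G.s g)) (𝓝 g) := by
  have := (G.contMDiffAt_sec g).continuousAt.tendsto
  rwa [G.sec_self] at this

/-- Two families of arrows with the same sources and the same limit agree eventually. -/
theorem eventually_eq_of_tendsto {ι : Type*} {l : Filter ι} {a b : ι → G₁} {g : G₁}
    (ha : Filter.Tendsto a l (𝓝 g)) (hb : Filter.Tendsto b l (𝓝 g))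
    (hab : ∀ᶠ i in l, G.s (a i) = G.s (b i)) : ∀ᶠ i in l, a i = b i := by
  filter_upwards [ha.eventually (G.sec_s g), hb.eventually (G.sec_s g), hab] with i h1 h2 h3
  rw [← h1, ← h2, h3]

theorem isOpenMap_s : IsOpenMap G.s := G.etale.isOpenMap

end OrbifoldGroupoid

end Basic

/-! ### The principal bundle of a faithful cocycle and the free, proper action of the groupoid on
it. -/

section Cocycle

variable {n m k : ℕ} {G₀ G₁ : Type u}
  [TopologicalSpace G₀] [ChartedSpace (EuclideanSpace ℝ (Fin n)) G₀] [IsManifold (𝓡 n) ∞ G₀]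
  [T2Space G₀] [SecondCountableTopology G₀]
  [TopologicalSpace G₁] [ChartedSpace (EuclideanSpace ℝ (Fin m)) G₁] [IsManifold (𝓡 m) ∞ G₁]
  [T2Space G₁] [SecondCountableTopology G₁]
  {K : Type} [Group K] [TopologicalSpace K] [ChartedSpace (EuclideanSpace ℝ (Fin k)) K]
  [LieGroup (𝓡 k) ∞ K] [T2Space K] [SecondCountableTopology K]

/-- A faithful smooth cocycle on an orbifold groupoid with values in a Lie group, relative to an
open cover of the objects indexed by the objects. -/
structure FaithfulCocycle (G : OrbifoldGroupoid (𝓡 n) (𝓡 m) G₀ G₁) (k : ℕ) (K : Type) [Group K]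
    [TopologicalSpace K] [ChartedSpace (EuclideanSpace ℝ (Fin k)) K] where
  U : G₀ → Set G₀
  isOpen_U : ∀ x, IsOpen (U x)
  mem_U : ∀ x, x ∈ U x
  -- The first index is the chart at the target and the second the chart at the source, so that
  -- values multiply like matrices.
  val : G₀ → G₀ → G₁ → K
  smooth : ∀ x y, ContMDiffOn (𝓡 m) (𝓡 k) ∞ (val y x) {g | G.s g ∈ U x ∧ G.t g ∈ U y}
  cocycle : ∀ x y z g h, G.s g = G.t h → G.s h ∈ U x → G.s g ∈ U y → G.t g ∈ U z →
    val z y g * val y x h = val z x (G.mul g h)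
  faithful : ∀ x g, G.s g = G.t g → G.s g ∈ U x → val x x g = 1 → g = G.unit (G.s g)

namespace FaithfulCocycle

variable {G : OrbifoldGroupoid (𝓡 n) (𝓡 m) G₀ G₁} (c : FaithfulCocycle G k K)

/-- The value is an idempotent of a group. -/
theorem val_unit {x y : G₀} (h : y ∈ c.U x) : c.val x x (G.unit y) = 1 := by
  have := c.cocycle x x x (G.unit y) (G.unit y) (by rw [G.s_unit, G.t_unit])
    (by rwa [G.s_unit]) (by rwa [G.s_unit]) (by rwa [G.t_unit])
  have e := G.mul_unit (G.unit y)
  rw [G.s_unit] at e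
  rw [e] at this
  exact mul_eq_left.1 this

theorem val_unit_mul {x y z : G₀} {g : G₁} (hx : G.s g ∈ c.U x) (hy : G.t g ∈ c.U y)
    (hz : G.t g ∈ c.U z) : c.val z y (G.unit (G.t g)) * c.val y x g = c.val z x g := by
  rw [c.cocycle x y z _ g (G.s_unit _) hx (by rwa [G.s_unit]) (by rwa [G.t_unit]), G.unit_mul]

theorem val_mul_unit {x y z : G₀} {g : G₁} (hx : G.s g ∈ c.U x) (hy : G.s g ∈ c.U y)
    (hz : G.t g ∈ c.U z) : c.val z y g * c.val y x (G.unit (G.s g)) = c.val z x g := by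
  rw [c.cocycle x y z g _ (G.t_unit _).symm (by rwa [G.s_unit]) hy hz, G.mul_unit]

theorem val_unit_unit {x y z w : G₀} (hx : w ∈ c.U x) (hy : w ∈ c.U y) (hz : w ∈ c.U z) :
    c.val z y (G.unit w) * c.val y x (G.unit w) = c.val z x (G.unit w) := by
  have := c.val_unit_mul (g := G.unit w) (x := x) (y := y) (z := z)
    (by rwa [G.s_unit]) (by rwa [G.t_unit]) (by rwa [G.t_unit])
  rwa [G.t_unit] at this

theorem contMDiffOn_val_unit (x y : G₀) :
    ContMDiffOn (𝓡 n) (𝓡 k) ∞ (fun w => c.val y x (G.unit w)) (c.U x ∩ c.U y) :=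
  (c.smooth x y).comp G.smooth_unit.contMDiffOn fun w hw => by
    have h1 : G.s (G.unit w) ∈ c.U x := by rw [G.s_unit]; exact hw.1
    have h2 : G.t (G.unit w) ∈ c.U y := by rw [G.t_unit]; exact hw.2
    exact ⟨h1, h2⟩

/-- The principal bundle of a cocycle, as a fibre bundle core. -/
def core : FiberBundleCore G₀ G₀ K where
  baseSet := c.U
  isOpen_baseSet := c.isOpen_U
  indexAt := id
  mem_baseSet_at := c.mem_U
  coordChange i j x v := c.val j i (G.unit x) * v
  coordChange_self i x hx v := by rw [c.val_unit hx, one_mul]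
  continuousOn_coordChange i j := by
    have : ContinuousMul K := continuousMul_of_contMDiffMul (𝓡 k) ∞
    exact ((c.contMDiffOn_val_unit i j).continuousOn.comp continuousOn_fst fun p hp => hp.1).mul
      continuousOn_snd
  coordChange_comp i j l x hx v := by
    rw [← mul_assoc, c.val_unit_unit hx.1.1 hx.1.2 hx.2]

/-- The total space of the principal bundle of a cocycle. -/
abbrev Total : Type u := c.core.TotalSpace

/-- The fibre coordinate of a point of the principal bundle. -/
def fib (q : c.Total) : K := q.snd

/-- The coordinate of a point of the principal bundle in the trivialization with index `i`. -/
def triv (i : G₀) (q : c.Total) : K := c.val i q.proj (G.unit q.proj) * c.fib q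

/-- The inverse of a local trivialization. -/
def ofTriv (i : G₀) (a : G₀ × K) : c.Total := ⟨a.1, c.val a.1 i (G.unit a.1) * a.2⟩

theorem localTriv_apply (i : G₀) (q : c.Total) :
    (c.core.localTriv i).toOpenPartialHomeomorph q = (q.proj, c.triv i q) := rfl

theorem localTriv_symm_apply (i : G₀) (a : G₀ × K) :
    (c.core.localTriv i).toOpenPartialHomeomorph.symm a = c.ofTriv i a := rfl

theorem mem_localTriv_target (i : G₀) (a : G₀ × K) :
    a ∈ (c.core.localTriv i).toOpenPartialHomeomorph.target ↔ a.1 ∈ c.U i :=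
  c.core.mem_localTriv_target i a

theorem triv_ofTriv {i j : G₀} {a : G₀ × K} (hi : a.1 ∈ c.U i) (hj : a.1 ∈ c.U j) :
    c.triv j (c.ofTriv i a) = c.val j i (G.unit a.1) * a.2 := by
  simp only [triv, ofTriv, fib]
  rw [← mul_assoc, c.val_unit_unit hi (c.mem_U _) hj]

theorem ofTriv_triv {i : G₀} {q : c.Total} (hi : q.proj ∈ c.U i) : c.ofTriv i (q.proj, c.triv i q) = q :=
  (c.core.localTriv i).toOpenPartialHomeomorph.left_inv hi

/-- The local trivializations of the principal bundle form an atlas. -/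
def totalCover : SmoothCover ((𝓡 n).prod (𝓡 k)) c.Total (G₀ × K) G₀ where
  e i := (c.core.localTriv i).toOpenPartialHomeomorph
  idx q := q.proj
  mem q := c.mem_U q.proj
  compat i j := by
    have h1 : ContMDiffOn ((𝓡 n).prod (𝓡 k)) ((𝓡 n).prod (𝓡 k)) ∞
        (fun a : G₀ × K => (a.1, c.val j i (G.unit a.1) * a.2)) (Prod.fst ⁻¹' (c.U i ∩ c.U j)) :=
      contMDiffOn_fst.prodMk (((c.contMDiffOn_val_unit i j).comp contMDiffOn_fst fun a ha => ha).mul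
        contMDiffOn_snd)
    refine (h1.mono ?_).congr ?_
    · rintro a ⟨h1, h2⟩
      exact ⟨(c.mem_localTriv_target i a).1 h1, h2⟩
    · rintro a ⟨h1, h2⟩
      rw [localTriv_symm_apply, localTriv_apply,
        c.triv_ofTriv ((c.mem_localTriv_target i a).1 h1) h2]
      rfl

/-- The dimension of the principal bundle. -/
def totalDim (_ : FaithfulCocycle G k K) : ℕ :=
  Module.finrank ℝ (EuclideanSpace ℝ (Fin n) × EuclideanSpace ℝ (Fin k))

/-- Linear coordinates on the model space of the principal bundle. -/
def totalCoord : (EuclideanSpace ℝ (Fin n) × EuclideanSpace ℝ (Fin k)) ≃L[ℝ]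
    EuclideanSpace ℝ (Fin c.totalDim) := toEuclidean

instance : ChartedSpace (EuclideanSpace ℝ (Fin c.totalDim)) c.Total :=
  c.totalCover.chartedSpace c.totalCoord

instance : IsManifold (𝓡 k) ∞ K := (inferInstance : ContMDiffMul (𝓡 k) ∞ K).toIsManifold

instance : IsManifold (𝓡 c.totalDim) ∞ c.Total :=
  c.totalCover.isManifold c.totalCoord

theorem contMDiffOn_localTriv (i : G₀) :
    ContMDiffOn (𝓡 c.totalDim) ((𝓡 n).prod (𝓡 k)) ∞ (fun q : c.Total => (q.proj, c.triv i q))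
      {q | q.proj ∈ c.U i} :=
  c.totalCover.contMDiffOn_e c.totalCoord i

theorem contMDiffOn_ofTriv (i : G₀) :
    ContMDiffOn ((𝓡 n).prod (𝓡 k)) (𝓡 c.totalDim) ∞ (c.ofTriv i) {a | a.1 ∈ c.U i} :=
  (c.totalCover.contMDiffOn_e_symm c.totalCoord i).mono fun a ha =>
    (c.mem_localTriv_target i a).2 ha

theorem contMDiff_proj : ContMDiff (𝓡 c.totalDim) (𝓡 n) ∞ (fun q : c.Total => q.proj) := fun q =>
  (contMDiff_fst.comp_contMDiffOn (c.contMDiffOn_localTriv q.proj)).contMDiffAt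
    (((c.isOpen_U _).preimage c.core.continuous_proj).mem_nhds (c.mem_U _))

theorem continuous_proj : Continuous (fun q : c.Total => q.proj) := c.contMDiff_proj.continuous

theorem contMDiffOn_triv (i : G₀) :
    ContMDiffOn (𝓡 c.totalDim) (𝓡 k) ∞ (c.triv i) {q | q.proj ∈ c.U i} :=
  contMDiff_snd.comp_contMDiffOn (c.contMDiffOn_localTriv i)

theorem isOpen_proj_mem (i : G₀) : IsOpen {q : c.Total | q.proj ∈ c.U i} :=
  (c.isOpen_U i).preimage c.continuous_proj

theorem contMDiffAt_triv {i : G₀} {q : c.Total} (h : q.proj ∈ c.U i) :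
    ContMDiffAt (𝓡 c.totalDim) (𝓡 k) ∞ (c.triv i) q :=
  (c.contMDiffOn_triv i).contMDiffAt ((c.isOpen_proj_mem i).mem_nhds h)

/-- Points over different objects are separated by the projection, and points of one fibre by a
trivialization. -/
instance : T2Space c.Total := by
  refine t2Space_iff_disjoint_nhds.2 fun q q' hne => ?_
  by_cases h : q.proj = q'.proj
  · have hq : q.proj ∈ c.U q.proj := c.mem_U _
    have hq' : q'.proj ∈ c.U q.proj := h ▸ hq
    have hne' : c.triv q.proj q ≠ c.triv q.proj q' := fun e => hne (by
      rw [← c.ofTriv_triv hq, ← c.ofTriv_triv hq', ← h, ← e])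
    exact _root_.Filter.disjoint_of_map (f := c.triv q.proj) ((disjoint_nhds_nhds.2 hne').mono
      (c.contMDiffAt_triv hq).continuousAt (c.contMDiffAt_triv hq').continuousAt)
  · exact _root_.Filter.disjoint_of_map (f := fun q : c.Total => q.proj) ((disjoint_nhds_nhds.2 h).mono
      c.continuous_proj.continuousAt c.continuous_proj.continuousAt)

instance : SecondCountableTopology c.Total := by
  obtain ⟨s, hs, hcov⟩ := TopologicalSpace.countable_cover_nhds
    (f := c.U) fun x => (c.isOpen_U x).mem_nhds (c.mem_U x)
  have : Countable s := hs
  have (i : s) : SecondCountableTopology {q : c.Total | q.proj ∈ c.U i} :=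
    (c.core.localTriv i).toOpenPartialHomeomorph.secondCountableTopology_source
  refine TopologicalSpace.secondCountableTopology_of_countable_cover
    (U := fun i : s => {q : c.Total | q.proj ∈ c.U i}) (fun i => c.isOpen_proj_mem i) ?_
  refine Set.eq_univ_of_forall fun q => ?_
  have : q.proj ∈ ⋃ x ∈ s, c.U x := hcov ▸ Set.mem_univ _
  simpa using this

/-- The left action of the groupoid on the principal bundle. -/
def actL (g : G₁) (q : c.Total) : c.Total := ⟨G.t g, c.val (G.t g) q.proj g * c.fib q⟩

/-- The right action of the group on the principal bundle. -/
def actR (q : c.Total) (l : K) : c.Total := ⟨q.proj, c.fib q * l⟩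

theorem triv_actR (i : G₀) (q : c.Total) (l : K) : c.triv i (c.actR q l) = c.triv i q * l :=
  (mul_assoc _ _ _).symm

/-- The action is defined in the preferred charts of the two end points, which jump from point to
point. The cocycle identity shows that the same formula holds in all charts, whence smoothness and
associativity. -/
theorem triv_actL {i j : G₀} {g : G₁} {q : c.Total} (e : G.s g = q.proj) (hi : q.proj ∈ c.U i)
    (hj : G.t g ∈ c.U j) : c.triv j (c.actL g q) = c.val j i g * c.triv i q := by
  change c.val j (G.t g) (G.unit (G.t g)) * (c.val (G.t g) q.proj g * c.fib q) =
    c.val j i g * (c.val i q.proj (G.unit q.proj) * c.fib q)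
  rw [← mul_assoc, ← mul_assoc, c.val_unit_mul (by rw [e]; exact c.mem_U _) (c.mem_U _) hj, ← e,
    c.val_mul_unit (by rw [e]; exact c.mem_U _) (by rwa [e]) hj]

theorem ext_triv {i : G₀} {q q' : c.Total} (h : q.proj = q'.proj) (hi : q.proj ∈ c.U i)
    (ht : c.triv i q = c.triv i q') : q = q' := by
  rw [← c.ofTriv_triv hi, ← c.ofTriv_triv (h ▸ hi : q'.proj ∈ c.U i), ht, h]

theorem actL_unit (q : c.Total) : c.actL (G.unit q.proj) q = q := by
  refine c.ext_triv (i := q.proj) (G.t_unit _) (by rw [actL, G.t_unit]; exact c.mem_U _) ?_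
  rw [c.triv_actL (G.s_unit _) (c.mem_U _) (by rw [G.t_unit]; exact c.mem_U _),
    c.val_unit (c.mem_U _), one_mul]

theorem actL_actL {g h : G₁} {q : c.Total} (e : G.s g = G.t h) (e' : G.s h = q.proj) :
    c.actL g (c.actL h q) = c.actL (G.mul g h) q := by
  refine c.ext_triv (i := G.t g) (G.t_mul e).symm (c.mem_U _) ?_
  have hU : (c.actL h q).proj ∈ c.U (G.t h) := c.mem_U _
  rw [c.triv_actL (i := G.t h) e (c.mem_U _) (c.mem_U _),
    c.triv_actL (i := q.proj) e' (c.mem_U _) (c.mem_U _),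
    c.triv_actL (i := q.proj) ((G.s_mul e).trans e') (c.mem_U _)
      (by rw [G.t_mul e]; exact c.mem_U _), ← mul_assoc,
    c.cocycle _ _ _ g h e (by rw [e']; exact c.mem_U _) (by rw [e]; exact c.mem_U _) (c.mem_U _)]

theorem actL_actR (g : G₁) (q : c.Total) (l : K) :
    c.actR (c.actL g q) l = c.actL g (c.actR q l) :=
  congrArg (Bundle.TotalSpace.mk (G.t g)) (mul_assoc (c.val (G.t g) q.proj g) (c.fib q) l)

theorem actR_one (q : c.Total) : c.actR q 1 = q :=
  congrArg (Bundle.TotalSpace.mk q.proj) (mul_one (c.fib q))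

theorem actR_mul (q : c.Total) (l l' : K) : c.actR q (l * l') = c.actR (c.actR q l) l' :=
  congrArg (Bundle.TotalSpace.mk q.proj) (mul_assoc (c.fib q) l l').symm

theorem actR_cancel {q : c.Total} {l l' : K} (h : c.actR q l = c.actR q l') : l = l' := by
  have := congrArg (c.triv q.proj) h
  rw [triv_actR, triv_actR] at this
  exact mul_left_cancel this

/-- The groupoid acts freely on the principal bundle. -/
theorem actL_free {g h : G₁} {q : c.Total} (eg : G.s g = q.proj) (eh : G.s h = q.proj)
    (e : c.actL g q = c.actL h q) : g = h := by
  have et : G.t g = G.t h := congrArg (fun q : c.Total => q.proj) e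
  have hU : G.t h ∈ c.U (G.t g) := by rw [← et]; exact c.mem_U _
  have e1 := congrArg (c.triv (G.t g)) e
  rw [c.triv_actL eg (c.mem_U _) (c.mem_U _), c.triv_actL eh (c.mem_U _) hU] at e1
  have e2 := mul_right_cancel e1
  have est : G.s h = G.s g := eh.trans eg.symm
  -- This quotient is a loop at `G.t g` with trivial value, because `g` and `h` have the same value;
  -- faithfulness makes it a unit.
  set a := G.mul g (G.inv h) with ha
  have ea : G.s g = G.t (G.inv h) := by rw [G.t_inv, est]
  have hsa : G.s a = G.t g := by rw [ha, G.s_mul ea, G.s_inv, et]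
  have hta : G.t a = G.t g := G.t_mul ea
  have key : a = G.unit (G.s a) := by
    refine c.faithful (G.t g) a (hsa.trans hta.symm) (by rw [hsa]; exact c.mem_U _) ?_
    have h1 := c.cocycle q.proj (G.t g) (G.t g) a h (by rw [hsa, et])
      (by rw [eh]; exact c.mem_U _) (by rw [hsa]; exact c.mem_U _) (by rw [hta]; exact c.mem_U _)
    rw [ha, G.mul_inv_mul est.symm, e2] at h1
    exact mul_eq_right.1 h1
  have h2 : G.mul a h = g := G.mul_inv_mul est.symm
  rw [← h2, key, hsa, et, G.unit_mul]

theorem contMDiff_actR : ContMDiff ((𝓡 c.totalDim).prod (𝓡 k)) (𝓡 c.totalDim) ∞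
    (fun a : c.Total × K => c.actR a.1 a.2) := by
  rintro ⟨q, l⟩
  have hU : IsOpen {a : c.Total × K | a.1.proj ∈ c.U q.proj} :=
    (c.isOpen_proj_mem q.proj).preimage continuous_fst
  have h1 : ContMDiffOn ((𝓡 c.totalDim).prod (𝓡 k)) (𝓡 c.totalDim) ∞
      (fun a : c.Total × K => c.ofTriv q.proj (a.1.proj, c.triv q.proj a.1 * a.2))
      {a : c.Total × K | a.1.proj ∈ c.U q.proj} :=
    (c.contMDiffOn_ofTriv q.proj).comp ((c.contMDiff_proj.comp contMDiff_fst).contMDiffOn.prodMk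
      (((c.contMDiffOn_triv q.proj).comp contMDiffOn_fst fun a ha => ha).mul contMDiffOn_snd))
      fun a ha => ha
  refine (h1.congr fun a ha => ?_).contMDiffAt (hU.mem_nhds (c.mem_U _))
  rw [← triv_actR]
  exact (c.ofTriv_triv (q := c.actR a.1 a.2) ha).symm

/-- A smooth local extension of the action map. -/
def actExt (i j : G₀) (a : G₁ × c.Total) : c.Total :=
  c.ofTriv j (G.t a.1, c.val j i a.1 * c.triv i a.2)

/-- The domain of the local extension of the action map. -/
def actDom (i j : G₀) : Set (G₁ × c.Total) :=
  {a | (G.s a.1 ∈ c.U i ∧ G.t a.1 ∈ c.U j) ∧ a.2.proj ∈ c.U i}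

theorem isOpen_actDom (i j : G₀) : IsOpen (c.actDom i j) :=
  (((c.isOpen_U i).preimage (G.smooth_s.continuous.comp continuous_fst)).inter
    ((c.isOpen_U j).preimage (G.smooth_t.continuous.comp continuous_fst))).inter
    ((c.isOpen_proj_mem i).preimage continuous_snd)

theorem contMDiffOn_actExt (i j : G₀) :
    ContMDiffOn ((𝓡 m).prod (𝓡 c.totalDim)) (𝓡 c.totalDim) ∞ (c.actExt i j) (c.actDom i j) :=
  (c.contMDiffOn_ofTriv j).comp ((G.smooth_t.comp contMDiff_fst).contMDiffOn.prodMk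
    (((c.smooth i j).comp contMDiffOn_fst fun _ ha => ha.1).mul
      ((c.contMDiffOn_triv i).comp contMDiffOn_snd fun _ ha => ha.2))) fun _ ha => ha.1.2

theorem actExt_eq {i j : G₀} {a : G₁ × c.Total} (ha : a ∈ c.actDom i j)
    (e : G.s a.1 = a.2.proj) : c.actExt i j a = c.actL a.1 a.2 := by
  rw [actExt, ← c.triv_actL e ha.2 ha.1.2]
  exact c.ofTriv_triv (q := c.actL a.1 a.2) ha.1.2

theorem mem_actDom {g : G₁} {q : c.Total} (e : G.s g = q.proj) :
    (g, q) ∈ c.actDom q.proj (G.t g) :=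
  ⟨⟨by rw [e]; exact c.mem_U _, c.mem_U _⟩, c.mem_U _⟩

theorem smooth_actL : SmoothOnSubset ((𝓡 m).prod (𝓡 c.totalDim)) (𝓡 c.totalDim)
    (fun a : {a : G₁ × c.Total | G.s a.1 = a.2.proj} => c.actL a.1.1 a.1.2) := fun a =>
  ⟨c.actDom a.1.2.proj (G.t a.1.1), c.isOpen_actDom _ _, c.mem_actDom a.2,
    c.actExt a.1.2.proj (G.t a.1.1), c.contMDiffOn_actExt _ _, fun b hb => c.actExt_eq hb b.2⟩

theorem tendsto_actL {ι : Type*} {l : Filter ι} {a : ι → G₁} {b : ι → c.Total} {g : G₁}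
    {q : c.Total} (e : G.s g = q.proj) (ha : Filter.Tendsto a l (𝓝 g))
    (hb : Filter.Tendsto b l (𝓝 q)) (hab : ∀ᶠ i in l, G.s (a i) = (b i).proj) :
    Filter.Tendsto (fun i => c.actL (a i) (b i)) l (𝓝 (c.actL g q)) := by
  have hd := (c.isOpen_actDom q.proj (G.t g)).mem_nhds (c.mem_actDom e)
  have h1 : Filter.Tendsto (fun i => (a i, b i)) l (𝓝 (g, q)) := ha.prodMk_nhds hb
  have h2 := ((c.contMDiffOn_actExt q.proj (G.t g)).continuousOn.continuousAt hd).tendsto.comp h1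
  rw [c.actExt_eq (c.mem_actDom e) e] at h2
  refine h2.congr' ?_
  filter_upwards [h1.eventually hd, hab] with i hi hj using c.actExt_eq hi hj

/-- The map `q ↦ σ(q) q`, where `σ` is the local section of `s` through `g`. -/
def secAct (g : G₁) (q : c.Total) : c.Total := c.actL (G.sec g q.proj) q

/-- Near `q` this is the action along a smooth family of arrows. Such maps are local deck
transformations of the quotient by `G`: they give openness of the quotient map and smoothness of its
transitions. -/
theorem contMDiffAt_secAct {g : G₁} {q : c.Total} (e : G.s g = q.proj) :
    ContMDiffAt (𝓡 c.totalDim) (𝓡 c.totalDim) ∞ (c.secAct g) q := by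
  have h0 : ContMDiffAt (𝓡 c.totalDim) (𝓡 m) ∞ (fun q : c.Total => G.sec g q.proj) q :=
    ContMDiffAt.comp (f := fun q : c.Total => q.proj) q (e ▸ G.contMDiffAt_sec g)
      c.contMDiff_proj.contMDiffAt
  have hg : G.sec g q.proj = g := by rw [← e, G.sec_self]
  have h1 : ContMDiffAt (𝓡 c.totalDim) ((𝓡 m).prod (𝓡 c.totalDim)) ∞
    (fun q : c.Total => (G.sec g q.proj, q)) q := h0.prodMk contMDiffAt_id
  have hd := (c.isOpen_actDom q.proj (G.t g)).mem_nhds (c.mem_actDom e)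
  have h2 : ContMDiffAt ((𝓡 m).prod (𝓡 c.totalDim)) (𝓡 c.totalDim) ∞
      (c.actExt q.proj (G.t g)) (G.sec g q.proj, q) := by
    rw [hg]
    exact (c.contMDiffOn_actExt q.proj (G.t g)).contMDiffAt hd
  refine (ContMDiffAt.comp (f := fun q : c.Total => (G.sec g q.proj, q)) q h2 h1).congr_of_eventuallyEq ?_
  have h3 : ∀ᶠ q' in 𝓝 q, (G.sec g q'.proj, q') ∈ c.actDom q.proj (G.t g) :=
    h1.continuousAt.eventually (by simp only [hg]; exact hd)
  filter_upwards [h3, c.continuous_proj.continuousAt.eventually (e ▸ G.s_sec g)] with q' h h'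
  exact (c.actExt_eq h h').symm

theorem secAct_self {g : G₁} {q : c.Total} (e : G.s g = q.proj) : c.secAct g q = c.actL g q := by
  rw [secAct, ← e, G.sec_self]

/-- The action is proper: moving by a closed set of arrows is a closed relation. -/
theorem isClosed_actL {Z : Set G₁} (hZ : IsClosed Z) :
    IsClosed {a : c.Total × c.Total | ∃ g ∈ Z, G.s g = a.2.proj ∧ c.actL g a.2 = a.1} := by
  refine isClosed_iff_ultrafilter.2 fun a 𝒰 h𝒰 hmem => ?_
  have : Nonempty G₁ := ⟨G.unit a.1.proj⟩
  have hsel : ∀ b : c.Total × c.Total, ∃ g, (∃ g ∈ Z, G.s g = b.2.proj ∧ c.actL g b.2 = b.1) →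
      g ∈ Z ∧ G.s g = b.2.proj ∧ c.actL g b.2 = b.1 := fun b => by
    by_cases h : ∃ g ∈ Z, G.s g = b.2.proj ∧ c.actL g b.2 = b.1
    · obtain ⟨g, hg⟩ := h
      exact ⟨g, fun _ => hg⟩
    · exact ⟨Classical.arbitrary _, fun h' => absurd h' h⟩
  choose φ hφ using hsel
  have h1 : ∀ᶠ b in (𝒰 : Filter (c.Total × c.Total)),
      φ b ∈ Z ∧ G.s (φ b) = b.2.proj ∧ c.actL (φ b) b.2 = b.1 :=
    Filter.mem_of_superset hmem fun b hb => hφ b hb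
  have ht1 : Filter.Tendsto (fun b : c.Total × c.Total => b.1) 𝒰 (𝓝 a.1) :=
    continuous_fst.continuousAt.tendsto.mono_left h𝒰
  have ht2 : Filter.Tendsto (fun b : c.Total × c.Total => b.2) 𝒰 (𝓝 a.2) :=
    continuous_snd.continuousAt.tendsto.mono_left h𝒰
  have h2 : Filter.Tendsto (fun g => (G.s g, G.t g)) (𝒰.map φ) (𝓝 (a.2.proj, a.1.proj)) := by
    refine Filter.Tendsto.congr' ?_ ((c.continuous_proj.continuousAt.tendsto.comp ht2).prodMk_nhds
      (c.continuous_proj.continuousAt.tendsto.comp ht1)) |> Filter.tendsto_map'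
    filter_upwards [h1] with b hb
    simp only [Function.comp_apply, hb.2.1]
    rw [← hb.2.2]
    rfl
  -- The sources and targets of the chosen arrows converge along the ultrafilter, so properness
  -- provides a limit arrow, which moves the limit point correctly by continuity of the action.
  obtain ⟨g, hg, hle⟩ := (isProperMap_iff_ultrafilter.1 G.proper).2 h2
  have hφg : Filter.Tendsto φ 𝒰 (𝓝 g) := hle
  have hs : G.s g = a.2.proj := congrArg Prod.fst hg
  refine ⟨g, hZ.mem_of_tendsto hφg (h1.mono fun b hb => hb.1), hs, ?_⟩
  refine tendsto_nhds_unique (c.tendsto_actL hs hφg ht2 (h1.mono fun b hb => hb.2.1))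
    (ht1.congr' ?_)
  filter_upwards [h1] with b hb using hb.2.2.symm

end FaithfulCocycle

end Cocycle

/-! ### Local diffeomorphisms are submersions, with zero-dimensional complement. -/

section Submersions

variable {E H : Type*} [NormedAddCommGroup E] [NormedSpace ℝ E] [TopologicalSpace H]
  {I : ModelWithCorners ℝ E H} {M N : Type*} [TopologicalSpace M] [ChartedSpace H M]
  [TopologicalSpace N] [ChartedSpace H N] [IsManifold I ∞ M] [IsManifold I ∞ N]

theorem isSubmersion_of_isLocalDiffeomorph {f : M → N} (hf : IsLocalDiffeomorph I I ∞ f) :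
    Manifold.IsSubmersion I I ∞ f := by
  refine Manifold.IsSubmersionOfComplement.isSubmersion (F := PUnit) fun x => ?_
  obtain ⟨Φ, hx, hΦ⟩ := hf x
  set ψ := chartAt H (f x) with hψ
  have hψm : ψ ∈ IsManifold.maximalAtlas I ∞ N := IsManifold.chart_mem_maximalAtlas _
  have hfx : f x ∈ ψ.source := mem_chart_source H _
  set φ : OpenPartialHomeomorph M H := Φ.toOpenPartialHomeomorph.trans ψ with hφ
  refine Manifold.IsSubmersionAtOfComplement.mk_of_charts
    (ContinuousLinearEquiv.prodUnique ℝ E PUnit).symm φ ψ ?_ hfx ?_ hψm ?_ ?_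
  · refine ⟨hx, ?_⟩
    change Φ x ∈ ψ.source
    rwa [← hΦ hx]
  · refine OpenPartialHomeomorph.mem_maximalAtlas_of_contMDiffOn _ ?_ ?_
    · exact (contMDiffOn_of_mem_maximalAtlas hψm).comp (Φ.contMDiffOn.mono fun y hy => hy.1)
        fun y hy => hy.2
    · exact Φ.symm.contMDiffOn.comp ((contMDiffOn_symm_of_mem_maximalAtlas hψm).mono
        fun y hy => hy.1) fun y hy => hy.2
  · intro y hy
    rw [Set.mem_preimage, hΦ hy.1]
    exact hy.2
  · intro v hv
    have h1 : (φ.extend I).symm v ∈ φ.source := by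
      have := (φ.extend I).map_target hv
      rwa [φ.extend_source] at this
    have h2 : (φ.extend I) ((φ.extend I).symm v) = v := (φ.extend I).right_inv hv
    have h3 : (ψ.extend I) (f ((φ.extend I).symm v)) = v := by
      rw [hΦ h1.1]
      exact h2
    simpa using h3

end Submersions

/-! ### The quotient manifold and the biprincipal bundle. -/

section Quotient

variable {n m k : ℕ} {G₀ G₁ : Type u}
  [TopologicalSpace G₀] [ChartedSpace (EuclideanSpace ℝ (Fin n)) G₀] [IsManifold (𝓡 n) ∞ G₀]
  [T2Space G₀] [SecondCountableTopology G₀]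
  [TopologicalSpace G₁] [ChartedSpace (EuclideanSpace ℝ (Fin m)) G₁] [IsManifold (𝓡 m) ∞ G₁]
  [T2Space G₁] [SecondCountableTopology G₁]
  {K : Type} [Group K] [TopologicalSpace K] [ChartedSpace (EuclideanSpace ℝ (Fin k)) K]
  [LieGroup (𝓡 k) ∞ K] [T2Space K] [SecondCountableTopology K]

namespace FaithfulCocycle

variable {G : OrbifoldGroupoid (𝓡 n) (𝓡 m) G₀ G₁} (c : FaithfulCocycle G k K)

/-- Two points of the principal bundle are equivalent if an arrow moves one to the other. -/
def actSetoid : Setoid c.Total where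
  r q q' := ∃ g, G.s g = q.proj ∧ c.actL g q = q'
  iseqv :=
    { refl := fun q => ⟨G.unit q.proj, G.s_unit _, c.actL_unit q⟩
      symm := by
        rintro q _ ⟨g, hg, rfl⟩
        refine ⟨G.inv g, G.s_inv g, ?_⟩
        rw [c.actL_actL (G.s_inv g) hg, G.inv_mul, hg, c.actL_unit]
      trans := by
        rintro q _ _ ⟨g, hg, rfl⟩ ⟨h, hh, rfl⟩
        exact ⟨G.mul h g, (G.s_mul hh).trans hg, (c.actL_actL hh hg).symm⟩ }

/-- The quotient of the principal bundle by the groupoid. -/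
def Quot : Type u := Quotient c.actSetoid

instance : TopologicalSpace c.Quot := inferInstanceAs (TopologicalSpace (Quotient c.actSetoid))

/-- The projection to the quotient. -/
def quot (q : c.Total) : c.Quot := Quotient.mk c.actSetoid q

theorem quot_eq_iff {q q' : c.Total} :
    c.quot q = c.quot q' ↔ ∃ g, G.s g = q.proj ∧ c.actL g q = q' := Quotient.eq

theorem quot_actL {g : G₁} {q : c.Total} (e : G.s g = q.proj) : c.quot (c.actL g q) = c.quot q :=
  (c.quot_eq_iff.2 ⟨g, e, rfl⟩).symm

theorem quot_surjective : Function.Surjective c.quot := Quotient.mk_surjective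

theorem continuous_quot : Continuous c.quot := continuous_quotient_mk'

theorem quot_secAct {g : G₁} {q : c.Total} (e : G.s g = q.proj) :
    ∀ᶠ q' in 𝓝 q, c.quot (c.secAct g q') = c.quot q' := by
  filter_upwards [c.continuous_proj.continuousAt.eventually (e ▸ G.s_sec g)] with q' h
  exact c.quot_actL h

/-- If `g` moves `q` into an open set, the section through `g` moves all points near `q` into it, so
the saturation of an open set is open. -/
theorem isOpenMap_quot : IsOpenMap c.quot := by
  intro W hW
  refine (isQuotientMap_quotient_mk' (s := c.actSetoid)).isOpen_preimage.1 ?_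
  refine isOpen_iff_mem_nhds.2 ?_
  rintro q ⟨q₀, hq₀, hq⟩
  obtain ⟨g, hg, rfl⟩ := c.quot_eq_iff.1 hq.symm
  have h1 := (c.contMDiffAt_secAct hg).continuousAt
  have h2 : ∀ᶠ q' in 𝓝 q, c.secAct g q' ∈ W :=
    h1.eventually (by rw [c.secAct_self hg]; exact hW.mem_nhds hq₀)
  filter_upwards [h2, c.quot_secAct hg] with q' h3 h4 using ⟨_, h3, h4⟩

theorem isOpenQuotientMap_quot : IsOpenQuotientMap c.quot :=
  ⟨c.quot_surjective, c.continuous_quot, c.isOpenMap_quot⟩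

instance : T2Space c.Quot := by
  rw [t2Space_iff_of_isOpenQuotientMap c.isOpenQuotientMap_quot]
  convert c.isClosed_actL isClosed_univ using 1
  ext ⟨q, q'⟩
  rw [Set.mem_ofPred, Set.mem_ofPred, eq_comm, c.quot_eq_iff]
  simp

instance : SecondCountableTopology c.Quot :=
  c.isOpenQuotientMap_quot.isQuotientMap.secondCountableTopology c.isOpenMap_quot

/-- Equivalent points near a given pair of equivalent points are related by nearby arrows. -/
theorem eventually_mem_of_actL {g : G₁} {q : c.Total} (e : G.s g = q.proj) {V : Set G₁}
    (hV : V ∈ 𝓝 g) : ∀ᶠ a in 𝓝 (c.actL g q, q), ∀ h, G.s h = a.2.proj → c.actL h a.2 = a.1 →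
      h ∈ V := by
  have h1 := (c.isClosed_actL (isOpen_interior (s := V)).isClosed_compl).isOpen_compl
  -- By freeness, `g` is the only arrow relating this pair, so the pair avoids the closed relation
  -- given by arrows outside the interior of `V`.
  have h2 : (c.actL g q, q) ∈ {a : c.Total × c.Total |
      ∃ g ∈ (interior V)ᶜ, G.s g = a.2.proj ∧ c.actL g a.2 = a.1}ᶜ := by
    rintro ⟨h, hh, hs, ha⟩
    rw [c.actL_free hs e ha] at hh
    exact hh (mem_interior_iff_mem_nhds.2 hV)
  filter_upwards [h1.mem_nhds h2] with a ha h hs hh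
  by_contra hn
  exact ha ⟨h, fun h' => hn (interior_subset h'), hs, hh⟩

theorem eventually_eq_sec_of_actL {g : G₁} {q : c.Total} (e : G.s g = q.proj) :
    ∀ᶠ a in 𝓝 (c.actL g q, q), ∀ h, G.s h = a.2.proj → c.actL h a.2 = a.1 →
      h = G.sec g a.2.proj := by
  filter_upwards [c.eventually_mem_of_actL e (G.sec_s g)] with a ha h hs hh
  have : G.sec g (G.s h) = h := ha h hs hh
  rw [← hs, this]

/-- An arrow relating two points near `q` lies on the local section through the unit at `q.proj`.
Near that object this section consists of units, so the two points are equal. -/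
theorem exists_injOn_quot (q : c.Total) : ∃ W : Set c.Total, IsOpen W ∧ q ∈ W ∧
    Set.InjOn c.quot W := by
  have h1 := c.eventually_eq_sec_of_actL (g := G.unit q.proj) (q := q) (G.s_unit _)
  have h2 : ∀ᶠ q' in 𝓝 q, G.sec (G.unit q.proj) q'.proj = G.unit q'.proj := by
    refine c.continuous_proj.continuousAt.eventually
      (p := fun y => G.sec (G.unit q.proj) y = G.unit y) ?_
    have h3 := G.tendsto_sec (G.unit q.proj)
    have h4 := G.s_sec (G.unit q.proj)
    rw [G.s_unit] at h3 h4
    refine G.eventually_eq_of_tendsto h3 G.smooth_unit.continuous.continuousAt ?_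
    filter_upwards [h4] with y hy
    rw [hy, G.s_unit]
  rw [c.actL_unit, nhds_prod_eq, Filter.eventually_prod_self_iff'] at h1
  obtain ⟨W, hW, hW'⟩ := h1
  obtain ⟨W₂, hW₂, ho, hm⟩ := mem_nhds_iff.1 (Filter.inter_mem hW h2)
  refine ⟨W₂, ho, hm, fun a ha b hb hab => ?_⟩
  obtain ⟨h, hs, hh⟩ := c.quot_eq_iff.1 hab
  have e1 := hW' b (hW₂ hb).1 a (hW₂ ha).1 h hs hh
  have e2 : G.sec (G.unit q.proj) a.proj = G.unit a.proj := (hW₂ ha).2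
  rw [← hh, e1, e2, c.actL_unit]

theorem isLocalHomeomorph_quot : IsLocalHomeomorph c.quot := by
  refine isLocalHomeomorph_iff_isOpenEmbedding_restrict.2 fun q => ?_
  obtain ⟨W, hW, hq, hinj⟩ := c.exists_injOn_quot q
  exact ⟨W, hW.mem_nhds hq, .of_continuous_injective_isOpenMap
    (c.continuous_quot.comp continuous_subtype_val) hinj.injective
    (c.isOpenMap_quot.comp hW.isOpenMap_subtype_val)⟩

/-- The restriction of the quotient map to a small neighbourhood. -/
def quotChart (q : c.Total) : OpenPartialHomeomorph c.Total c.Quot :=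
  (c.isLocalHomeomorph_quot q).choose

theorem mem_quotChart_source (q : c.Total) : q ∈ (c.quotChart q).source :=
  (c.isLocalHomeomorph_quot q).choose_spec.1

theorem quotChart_coe (q : c.Total) : ⇑(c.quotChart q) = c.quot :=
  (c.isLocalHomeomorph_quot q).choose_spec.2.symm

/-- The local inverses of the quotient map form an atlas. -/
def quotCover : SmoothCover (𝓡 c.totalDim) c.Quot c.Total c.Total where
  e q := (c.quotChart q).symm
  idx := Quotient.out
  mem p := by
    have h := (c.quotChart (Quotient.out p)).map_source (c.mem_quotChart_source _)
    rw [quotChart_coe] at h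
    have e : c.quot (Quotient.out p) = p := Quotient.out_eq p
    rwa [e] at h
  compat a b := by
    rintro q ⟨hq, hq'⟩
    simp only [OpenPartialHomeomorph.symm_source, OpenPartialHomeomorph.symm_symm,
      OpenPartialHomeomorph.symm_target, Set.mem_preimage, quotChart_coe] at hq hq' ⊢
    set z := (c.quotChart b).symm (c.quot q) with hz
    have hzs : z ∈ (c.quotChart b).source := (c.quotChart b).map_target hq'
    have hzq : c.quot z = c.quot q := by
      have := (c.quotChart b).right_inv hq'
      rwa [c.quotChart_coe b] at this
    -- Two local inverses of the quotient map differ by the local action of one section, the one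
    -- through the arrow from `q` to `z`.
    obtain ⟨g, hg, hgz⟩ := c.quot_eq_iff.1 hzq.symm
    have h1 := c.contMDiffAt_secAct hg
    refine (h1.congr_of_eventuallyEq ?_).contMDiffWithinAt
    have h2 : ∀ᶠ q' in 𝓝 q, c.secAct g q' ∈ (c.quotChart b).source :=
      h1.continuousAt.eventually
        (by rw [c.secAct_self hg, hgz]; exact (c.quotChart b).open_source.mem_nhds hzs)
    filter_upwards [h2, c.quot_secAct hg] with q' h3 h4
    rw [← h4, ← c.quotChart_coe b, (c.quotChart b).left_inv h3]

instance : ChartedSpace (EuclideanSpace ℝ (Fin c.totalDim)) c.Quot :=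
  c.quotCover.chartedSpace (ContinuousLinearEquiv.refl ℝ _)

instance : IsManifold (𝓡 c.totalDim) ∞ c.Quot :=
  c.quotCover.isManifold (ContinuousLinearEquiv.refl ℝ _)

theorem contMDiffOn_quotChart_symm (q : c.Total) :
    ContMDiffOn (𝓡 c.totalDim) (𝓡 c.totalDim) ∞ (c.quotChart q).symm (c.quotChart q).target :=
  c.quotCover.contMDiffOn_e (ContinuousLinearEquiv.refl ℝ _) q

theorem contMDiffOn_quotChart (q : c.Total) :
    ContMDiffOn (𝓡 c.totalDim) (𝓡 c.totalDim) ∞ (c.quotChart q) (c.quotChart q).source :=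
  c.quotCover.contMDiffOn_e_symm (ContinuousLinearEquiv.refl ℝ _) q

theorem isLocalDiffeomorph_quot :
    IsLocalDiffeomorph (𝓡 c.totalDim) (𝓡 c.totalDim) ∞ c.quot := fun q =>
  ⟨{ toPartialEquiv := (c.quotChart q).toPartialEquiv
     open_source := (c.quotChart q).open_source
     open_target := (c.quotChart q).open_target
     contMDiffOn_toFun := c.contMDiffOn_quotChart q
     contMDiffOn_invFun := c.contMDiffOn_quotChart_symm q }, c.mem_quotChart_source q,
    fun q' _ => (congrFun (c.quotChart_coe q) q').symm⟩

theorem contMDiff_quot : ContMDiff (𝓡 c.totalDim) (𝓡 c.totalDim) ∞ c.quot :=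
  c.isLocalDiffeomorph_quot.contMDiff

/-- The right action of the group on the quotient of the principal bundle. -/
def quotAction : LieRightAction (𝓡 c.totalDim) (𝓡 k) c.Quot K where
  act p l := Quotient.map (sa := c.actSetoid) (sb := c.actSetoid) (fun q => c.actR q l)
    (by
      rintro q _ ⟨g, hg, rfl⟩
      exact ⟨g, hg, (c.actL_actR g q l).symm⟩) p
  smooth_act := by
    rintro ⟨p, l⟩
    obtain ⟨q, rfl⟩ := c.quot_surjective p
    have hq := (c.quotChart q).map_source (c.mem_quotChart_source q)
    rw [quotChart_coe] at hq
    have hn := (c.quotChart q).open_target.mem_nhds hq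
    have h1 : ContMDiffAt ((𝓡 c.totalDim).prod (𝓡 k)) (𝓡 c.totalDim) ∞
        (fun a : c.Quot × K => (c.quotChart q).symm a.1) (c.quot q, l) :=
      ContMDiffAt.comp (c.quot q, l)
        ((c.contMDiffOn_quotChart_symm q).contMDiffAt hn) contMDiffAt_fst
    have h2 : ContMDiffAt ((𝓡 c.totalDim).prod (𝓡 k)) (𝓡 c.totalDim) ∞
        (fun a : c.Quot × K => c.quot (c.actR ((c.quotChart q).symm a.1) a.2)) (c.quot q, l) :=
      (c.contMDiff_quot.comp c.contMDiff_actR).contMDiffAt.comp (c.quot q, l)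
        (h1.prodMk contMDiffAt_snd)
    refine h2.congr_of_eventuallyEq ?_
    filter_upwards [continuous_fst.continuousAt.preimage_mem_nhds
      (x := (c.quot q, l)) (by exact hn)] with a ha
    have e : c.quot ((c.quotChart q).symm a.1) = a.1 := by
      rw [← c.quotChart_coe q]; exact (c.quotChart q).right_inv ha
    conv_lhs => rw [← e]
    rfl
  act_one p := by
    obtain ⟨q, rfl⟩ := c.quot_surjective p
    exact congrArg c.quot (c.actR_one q)
  act_mul p l l' := by
    obtain ⟨q, rfl⟩ := c.quot_surjective p
    exact congrArg c.quot (c.actR_mul q l l')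

theorem quotAction_quot (q : c.Total) (l : K) :
    c.quotAction.act (c.quot q) l = c.quot (c.actR q l) := rfl

/-- The charts of the total space are products of charts of `G₀` and `K` followed by `totalCoord`,
and there the projection is the first coordinate. -/
theorem isSubmersion_proj :
    Manifold.IsSubmersion (𝓡 c.totalDim) (𝓡 n) ∞ (fun q : c.Total => q.proj) := by
  refine Manifold.IsSubmersionOfComplement.isSubmersion (F := EuclideanSpace ℝ (Fin k)) fun q => ?_
  set ψ := chartAt (EuclideanSpace ℝ (Fin n)) q.proj with hψ
  set φ := chartAt (EuclideanSpace ℝ (Fin c.totalDim)) q with hφ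
  have hsrc : ∀ q' ∈ φ.source, q'.proj ∈ ψ.source := by
    intro q' hq'
    have h2 := hq'.2
    rw [c.totalCover.modelChart_source] at h2
    exact h2.1
  refine Manifold.IsSubmersionAtOfComplement.mk_of_charts c.totalCoord.symm φ ψ
    (mem_chart_source _ q) (mem_chart_source _ q.proj) (IsManifold.chart_mem_maximalAtlas _)
    (IsManifold.chart_mem_maximalAtlas _) hsrc ?_
  intro v hv
  have h1 : (φ.extend (𝓡 c.totalDim)).symm v ∈ φ.source := by
    have := (φ.extend (𝓡 c.totalDim)).map_target hv
    rwa [φ.extend_source] at this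
  have h2 : (φ.extend (𝓡 c.totalDim)) ((φ.extend (𝓡 c.totalDim)).symm v) = v :=
    (φ.extend (𝓡 c.totalDim)).right_inv hv
  set q' := (φ.extend (𝓡 c.totalDim)).symm v with hq'
  have h3 : c.totalCoord.symm v = (ψ q'.proj,
      chartAt (EuclideanSpace ℝ (Fin k)) (c.triv q.proj q) (c.triv q.proj q')) := by
    rw [← h2, ContinuousLinearEquiv.symm_apply_eq]
    rfl
  simp only [Function.comp_apply, h3]
  rfl

/-- The left action of the groupoid on the principal bundle. -/
def leftAction : LeftAction G.toSmoothGroupoid (𝓡 c.totalDim) (fun q : c.Total => q.proj) where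
  smooth_base := c.contMDiff_proj
  act g q _ := c.actL g q
  smooth_act := c.smooth_actL
  base_act _ _ _ := rfl
  unit_act := c.actL_unit
  comp_act g h q e e' := by rw [c.actL_actL e e', G.mul_eq e]

/-- The right action of the translation groupoid on the principal bundle. -/
def rightAction : RightAction c.quotAction.translationGroupoid (𝓡 c.totalDim) c.quot where
  smooth_base := c.contMDiff_quot
  act q a _ := c.actR q a.2
  smooth_act := fun _ => ⟨Set.univ, isOpen_univ, trivial, fun a => c.actR a.1 a.2.2,
    (c.contMDiff_actR.comp (contMDiff_fst.prodMk (contMDiff_snd.comp contMDiff_snd))).contMDiffOn,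
    fun _ _ => rfl⟩
  base_act q a e := by
    change c.quot (c.actR q a.2) = c.quotAction.act a.1 a.2
    rw [← c.quotAction_quot]
    exact congrArg (fun p => c.quotAction.act p a.2) e
  act_unit := c.actR_one
  act_comp q a b _ _ := (c.actR_mul q a.2 b.2).symm

theorem leftAction_isPrincipal : c.leftAction.IsPrincipal (𝓡 c.totalDim) c.quot where
  invariant g q e := c.quot_actL e
  surjective := c.quot_surjective
  submersion := isSubmersion_of_isLocalDiffeomorph c.isLocalDiffeomorph_quot
  diffeo := by
    refine ⟨?_, ?_⟩
    · intro b
      obtain ⟨U, hU, hbU, F, hF, hFe⟩ := c.smooth_actL b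
      exact ⟨U, hU, hbU, fun a => (F a, a.2), hF.prodMk contMDiffOn_snd,
        fun y hy => Prod.ext (hFe y hy) rfl⟩
    · have hex : ∀ a : {a : c.Total × c.Total | c.quot a.1 = c.quot a.2},
          ∃ g, G.s g = a.1.2.proj ∧ c.actL g a.1.2 = a.1.1 := fun a => c.quot_eq_iff.1 a.2.symm
      -- The chosen arrow is unique by freeness; near each pair it is given by one smooth section of
      -- `G.s`, which makes the inverse smooth.
      choose φ hφs hφa using hex
      refine ⟨fun a => ⟨(φ a, a.1.2), hφs a⟩, ?_, ?_, ?_⟩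
      · rintro ⟨⟨g, q⟩, e⟩
        refine Subtype.ext (Prod.ext ?_ rfl)
        exact c.actL_free (hφs _) e (hφa _)
      · rintro ⟨⟨q', q⟩, e⟩
        exact Subtype.ext (Prod.ext (hφa ⟨⟨q', q⟩, e⟩) rfl)
      · intro a
        have h1 := c.eventually_eq_sec_of_actL (hφs a)
        rw [hφa a] at h1
        have hp := c.contMDiff_proj.comp (contMDiff_snd (M := c.Total) (I := 𝓡 c.totalDim))
        have h2 : ∀ᶠ b in 𝓝 a.1, ContMDiffAt (𝓡 n) (𝓡 m) ∞ (G.sec (φ a)) b.2.proj :=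
          hp.continuous.continuousAt.eventually (by
            have := G.eventually_contMDiffAt_sec (φ a)
            rwa [hφs a] at this)
        obtain ⟨U, hU, ho, hm⟩ := mem_nhds_iff.1 (Filter.inter_mem h1 h2)
        have h3 : ContMDiffOn ((𝓡 c.totalDim).prod (𝓡 c.totalDim)) (𝓡 m) ∞
            (fun b : c.Total × c.Total => G.sec (φ a) b.2.proj) U := fun b hb =>
          (ContMDiffAt.comp (f := fun b : c.Total × c.Total => b.2.proj) b (hU hb).2
            hp.contMDiffAt).contMDiffWithinAt
        refine ⟨U, ho, hm, fun b => (G.sec (φ a) b.2.proj, b.2),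
          h3.prodMk contMDiffOn_snd, fun b hb => ?_⟩
        exact Prod.ext ((hU hb).1 (φ b) (hφs b) (hφa b)).symm rfl

theorem rightAction_isPrincipal :
    c.rightAction.IsPrincipal (𝓡 n) (fun q : c.Total => q.proj) where
  invariant _ _ _ := rfl
  surjective x := ⟨⟨x, (1 : K)⟩, rfl⟩
  submersion := c.isSubmersion_proj
  diffeo := by
    refine ⟨?_, ?_⟩
    · exact fun _ => ⟨Set.univ, isOpen_univ, trivial, fun a => (a.1, c.actR a.1 a.2.2),
        (contMDiff_fst.prodMk (c.contMDiff_actR.comp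
          (contMDiff_fst.prodMk (contMDiff_snd.comp contMDiff_snd)))).contMDiffOn, fun _ _ => rfl⟩
    -- The group element carrying `a` to `b` is read in any trivialization. By `actR_cancel` it does
    -- not depend on `i`, so near a given pair a fixed `i` gives a smooth formula.
    · have key : ∀ (i : G₀) (a b : c.Total), a.proj = b.proj → a.proj ∈ c.U i →
          c.actR a ((c.triv i a)⁻¹ * c.triv i b) = b := by
        intro i a b hab hi
        refine c.ext_triv (i := i) hab hi ?_
        rw [c.triv_actR, mul_inv_cancel_left]
      refine ⟨fun a => ⟨(a.1.1, c.quot a.1.1,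
        (c.triv a.1.1.proj a.1.1)⁻¹ * c.triv a.1.1.proj a.1.2), rfl⟩, ?_, ?_, ?_⟩
      · rintro ⟨⟨q, ⟨p, l⟩⟩, e⟩
        refine Subtype.ext (Prod.ext rfl (Prod.ext e ?_))
        change (c.triv q.proj q)⁻¹ * c.triv q.proj (c.actR q l) = l
        rw [c.triv_actR, inv_mul_cancel_left]
      · rintro ⟨⟨q, q'⟩, e⟩
        exact Subtype.ext (Prod.ext rfl (key q.proj q q' e (c.mem_U _)))
      · intro a
        set i := a.1.1.proj with hi
        have e : i = a.1.2.proj := a.2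
        have ho : IsOpen {b : c.Total × c.Total | b.1.proj ∈ c.U i ∧ b.2.proj ∈ c.U i} :=
          ((c.isOpen_proj_mem i).preimage continuous_fst).inter
            ((c.isOpen_proj_mem i).preimage continuous_snd)
        refine ⟨_, ho, ⟨c.mem_U _, by rw [← e]; exact c.mem_U _⟩, fun b => (b.1, c.quot b.1,
          (c.triv i b.1)⁻¹ * c.triv i b.2), ?_, fun b hb => ?_⟩
        · exact contMDiffOn_fst.prodMk ((c.contMDiff_quot.comp contMDiff_fst).contMDiffOn.prodMk
            (((c.contMDiffOn_triv i).comp contMDiffOn_fst fun b hb => hb.1).inv.mul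
              ((c.contMDiffOn_triv i).comp contMDiffOn_snd fun b hb => hb.2)))
        · refine Prod.ext rfl (Prod.ext rfl ?_)
          exact c.actR_cancel ((key i b.1.1 b.1.2 b.2 hb.1).trans
            (key b.1.1.proj b.1.1 b.1.2 b.2 (c.mem_U _)).symm)

theorem hsEquivalent : HSEquivalent G.toSmoothGroupoid c.quotAction.translationGroupoid :=
  ⟨c.totalDim, c.Total, inferInstance, inferInstance, inferInstance, inferInstance, inferInstance,
    { sQ := fun q => q.proj
      tQ := c.quot
      left := c.leftAction
      right := c.rightAction
      sQ_right := fun _ _ _ => rfl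
      tQ_left := fun _ _ e => c.quot_actL e
      compatible := fun g q a _ _ => c.actL_actR g q a.2
      right_principal := c.rightAction_isPrincipal }, c.leftAction_isPrincipal⟩

end FaithfulCocycle

end Quotient

/-- A germ of a finite order diffeomorphism with trivial derivative at a fixed point is trivial. -/
theorem eventually_eq_self_of_iterate {E : Type*} [NormedAddCommGroup E] [NormedSpace ℝ E]
    {f : E → E} {p : E} (hp : f p = p)
    (hf : HasStrictFDerivAt f (ContinuousLinearMap.id ℝ E) p) {r : ℕ} (hr : 0 < r)
    (hit : ∀ᶠ z in 𝓝 p, f^[r] z = z) : ∀ᶠ z in 𝓝 p, f z = z := by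
  have hiter : ∀ k : ℕ, HasStrictFDerivAt f^[k] (ContinuousLinearMap.id ℝ E) p := by
    intro k
    induction k with
    | zero => exact hasStrictFDerivAt_id p
    | succ k ih =>
      rw [Function.iterate_succ]
      have h1 : HasStrictFDerivAt f^[k] (ContinuousLinearMap.id ℝ E) (f p) := by rwa [hp]
      exact h1.comp p hf
  have hsum : HasStrictFDerivAt (fun z => ∑ k ∈ Finset.range r, f^[k] z)
      (∑ _k ∈ Finset.range r, ContinuousLinearMap.id ℝ E) p :=
    HasStrictFDerivAt.fun_sum fun k _ => hiter k
  -- The average over the iterates is invariant under `f` near `p` and has identity derivative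
  -- there. It is therefore injective near `p`, and an injective map invariant under `f` forces `f z
  -- = z`.
  set ψ : E → E := fun z => (r : ℝ)⁻¹ • ∑ k ∈ Finset.range r, f^[k] z with hψ
  have hr' : (r : ℝ) ≠ 0 := by positivity
  have hψd : HasStrictFDerivAt ψ (ContinuousLinearMap.id ℝ E) p := by
    have h1 := hsum.const_smul (r : ℝ)⁻¹
    have h2 : (r : ℝ)⁻¹ • ∑ _k ∈ Finset.range r, ContinuousLinearMap.id ℝ E =
        ContinuousLinearMap.id ℝ E := by
      ext v
      simp [Finset.sum_const, ← Nat.cast_smul_eq_nsmul ℝ, smul_smul, hr']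
    rwa [h2] at h1
  -- Any constant below one gives injectivity.
  obtain ⟨W, hW, hWl⟩ := hψd.approximates_deriv_on_nhds (c := 1 / 2) (Or.inr (by norm_num))
  have hinj : Set.InjOn ψ W := by
    intro a ha b hb hab
    have h1 := hWl a ha b hb
    rw [hab, sub_self, zero_sub, norm_neg, ContinuousLinearMap.id_apply] at h1
    have h2 : ‖a - b‖ = 0 := by
      have h3 : ‖a - b‖ ≤ 1 / 2 * ‖a - b‖ := by simpa using h1
      linarith [norm_nonneg (a - b)]
    exact sub_eq_zero.1 (norm_eq_zero.1 h2)
  have hcont : Filter.Tendsto f (𝓝 p) (𝓝 p) := by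
    have := hf.continuousAt.tendsto
    rwa [hp] at this
  filter_upwards [hW, hcont.eventually hW, hit] with z h1 h2 h3
  refine hinj h2 h1 ?_
  simp only [hψ]
  congr 1
  -- The sum over `r + 1` iterates is split off at either end; the end terms agree since the `r`-th
  -- iterate fixes `z`.
  have h4 := Finset.sum_range_succ (fun k => f^[k] z) r
  rw [Finset.sum_range_succ', h3] at h4
  simp only [Function.iterate_zero, id] at h4
  exact add_right_cancel h4

/-! ### Local diffeomorphisms induced by arrows and their derivatives. -/

section Germs

variable {n m : ℕ} {G₀ G₁ : Type u}
  [TopologicalSpace G₀] [ChartedSpace (EuclideanSpace ℝ (Fin n)) G₀] [IsManifold (𝓡 n) ∞ G₀]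
  [T2Space G₀] [SecondCountableTopology G₀]
  [TopologicalSpace G₁] [ChartedSpace (EuclideanSpace ℝ (Fin m)) G₁] [IsManifold (𝓡 m) ∞ G₁]
  [T2Space G₁] [SecondCountableTopology G₁]

namespace OrbifoldGroupoid

variable (G : OrbifoldGroupoid (𝓡 n) (𝓡 m) G₀ G₁)

section Fibres

/-- Fibres of an étale map are discrete, so their intersections with compact sets are finite. -/
theorem finite_fibre {C : Set G₁} (hC : IsCompact C) (x : G₀) : (C ∩ G.s ⁻¹' {x}).Finite := by
  have hT : IsCompact (C ∩ G.s ⁻¹' {x}) :=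
    hC.inter_right (isClosed_singleton.preimage G.smooth_s.continuous)
  obtain ⟨F, -, hFc⟩ := hT.elim_nhds_subcover (fun f => {g | G.sec f (G.s g) = g})
    fun f _ => G.sec_s f
  refine (F.finite_toSet.image fun f => G.sec f x).subset fun g hg => ?_
  obtain ⟨f, hf, hfg⟩ := Set.mem_iUnion₂.1 (hFc hg)
  refine ⟨f, hf, ?_⟩
  have h1 : G.sec f (G.s g) = g := hfg
  have h2 : G.s g = x := hg.2
  rwa [h2] at h1

/-- Over a neighbourhood of `x`, the arrows in a compact set are given by the local sections through
its finitely many arrows with source `x`. -/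
theorem eventually_mem_fibre {C : Set G₁} (hC : IsCompact C) (x : G₀) :
    ∀ᶠ y in 𝓝 x, ∀ g ∈ C, G.s g = y → ∃ f ∈ C ∩ G.s ⁻¹' {x}, G.sec f y = g := by
  set V : Set G₁ := {g | ∃ f ∈ C ∩ G.s ⁻¹' {x}, G.sec f (G.s g) = g} with hV
  have h1 : C ∩ G.s ⁻¹' {x} ⊆ interior V := fun f hf => by
    rw [mem_interior_iff_mem_nhds]
    filter_upwards [G.sec_s f] with g hg using ⟨f, hf, hg⟩
  have h2 : IsClosed (G.s '' (C \ interior V)) :=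
    ((hC.diff isOpen_interior).image G.smooth_s.continuous).isClosed
  have h3 : x ∉ G.s '' (C \ interior V) := by
    rintro ⟨g, ⟨hg, hgV⟩, hgx⟩
    exact hgV (h1 ⟨hg, hgx⟩)
  filter_upwards [h2.isOpen_compl.mem_nhds h3] with y hy g hg hgy
  have h4 : g ∈ V := by
    by_contra hn
    exact hy ⟨g, ⟨hg, fun h => hn (interior_subset h)⟩, hgy⟩
  obtain ⟨f, hf, hfg⟩ := h4
  exact ⟨f, hf, by rw [← hgy, hfg]⟩

theorem eventually_injOn_sec {F : Set G₁} (hF : F.Finite) {x : G₀} (hx : ∀ f ∈ F, G.s f = x) :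
    ∀ᶠ y in 𝓝 x, Set.InjOn (fun f => G.sec f y) F := by
  have h : ∀ᶠ y in 𝓝 x, ∀ f ∈ F, ∀ f' ∈ F, f ≠ f' → G.sec f y ≠ G.sec f' y := by
    refine (Filter.eventually_all_finite hF).2 fun f hf =>
      (Filter.eventually_all_finite hF).2 fun f' hf' => ?_
    by_cases hne : f = f'
    · exact Filter.Eventually.of_forall fun _ h => absurd hne h
    · have h1 := G.tendsto_sec f
      have h2 := G.tendsto_sec f'
      rw [hx f hf] at h1
      rw [hx f' hf'] at h2
      obtain ⟨A, B, hA, hB, hfA, hfB, hAB⟩ := t2_separation hne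
      filter_upwards [h1.eventually (hA.mem_nhds hfA), h2.eventually (hB.mem_nhds hfB)]
        with y hy hy' _ e
      exact Set.disjoint_left.1 hAB hy (e ▸ hy')
  filter_upwards [h] with y hy f hf f' hf' e
  by_contra hne
  exact hy f hf f' hf' hne e

theorem isCompact_preimage {A B : Set G₀} (hA : IsCompact A) (hB : IsCompact B) :
    IsCompact {g | G.s g ∈ A ∧ G.t g ∈ B} :=
  G.proper.isCompact_preimage (hA.prod hB)

/-- Sections are chosen separately for each arrow. This coherence of germs lets the section through
`g` replace those through all nearby arrows. -/
theorem sec_eventuallyEq (g : G₁) : ∀ᶠ h in 𝓝 g, G.sec h =ᶠ[𝓝 (G.s h)] G.sec g := by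
  filter_upwards [(G.sec_s g).eventually_nhds] with h hh
  filter_upwards [(G.tendsto_sec h).eventually hh, G.s_sec h] with y h1 h2
  rw [h2] at h1
  exact h1.symm

instance (x : G₀) : Finite (G.toSmoothGroupoid.Stabilizer x) := by
  have h1 := G.finite_fibre (G.isCompact_preimage (isCompact_singleton (x := x))
    (isCompact_singleton (x := x))) x
  have h2 : {g | G.s g = x ∧ G.t g = x}.Finite := h1.subset fun g hg => ⟨hg, hg.1⟩
  exact h2.to_subtype

end Fibres

section Holonomy

/-- The local diffeomorphism of the space of objects induced by an arrow. -/
def hol (g : G₁) (y : G₀) : G₀ := G.t (G.sec g y)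

theorem hol_self (g : G₁) : G.hol g (G.s g) = G.t g := by rw [hol, G.sec_self]

theorem contMDiffAt_hol (g : G₁) : ContMDiffAt (𝓡 n) (𝓡 n) ∞ (G.hol g) (G.s g) :=
  G.smooth_t.contMDiffAt.comp _ (G.contMDiffAt_sec g)

theorem tendsto_hol (g : G₁) : Filter.Tendsto (G.hol g) (𝓝 (G.s g)) (𝓝 (G.t g)) := by
  have := (G.contMDiffAt_hol g).continuousAt.tendsto
  rwa [G.hol_self] at this

theorem hol_eq_of_tendsto {x : G₀} {σ : G₀ → G₁} {g : G₁} (hg : G.s g = x)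
    (hσ : Filter.Tendsto σ (𝓝 x) (𝓝 g)) (hs : ∀ᶠ y in 𝓝 x, G.s (σ y) = y) :
    ∀ᶠ y in 𝓝 x, G.hol g y = G.t (σ y) := by
  subst hg
  have h1 : ∀ᶠ y in 𝓝 (G.s g), G.sec g y = σ y := by
    refine G.eventually_eq_of_tendsto (G.tendsto_sec g) hσ ?_
    filter_upwards [G.s_sec g, hs] with y h1 h2
    rw [h1, h2]
  filter_upwards [h1] with y hy
  rw [hol, hy]

theorem hol_unit (x : G₀) : ∀ᶠ y in 𝓝 x, G.hol (G.unit x) y = y := by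
  filter_upwards [G.hol_eq_of_tendsto (G.s_unit x) G.smooth_unit.continuous.continuousAt
    (Filter.Eventually.of_forall G.s_unit)] with y hy
  rw [hy, G.t_unit]

theorem hol_mul {g h : G₁} (e : G.s g = G.t h) :
    ∀ᶠ y in 𝓝 (G.s h), G.hol (G.mul g h) y = G.hol g (G.hol h y) := by
  have ht := G.tendsto_hol h
  rw [← e] at ht
  have h1 : ∀ᶠ y in 𝓝 (G.s h), G.s (G.sec g (G.hol h y)) = G.t (G.sec h y) :=
    ht.eventually (G.s_sec g)
  filter_upwards [G.hol_eq_of_tendsto (G.s_mul e)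
    (G.tendsto_mul e ((G.tendsto_sec g).comp ht) (G.tendsto_sec h) h1) (by
      filter_upwards [h1, G.s_sec h] with y h2 h3
      simp only [Function.comp_apply]
      rw [G.s_mul h2, h3]), h1] with y h2 h3
  simp only [Function.comp_apply] at h2
  rw [h2, G.t_mul h3]
  rfl

theorem isIneffective_iff {g : G₁} :
    G.IsIneffective g ↔ G.s g = G.t g ∧ ∀ᶠ y in 𝓝 (G.s g), G.hol g y = y :=
  and_congr_right fun _ => Filter.Germ.coe_eq

theorem hol_pow {x : G₀} (g : G.toSmoothGroupoid.Stabilizer x) (k : ℕ) :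
    ∀ᶠ y in 𝓝 x, (G.hol g.1)^[k] y = G.hol (g ^ k).1 y := by
  induction k with
  | zero =>
    filter_upwards [G.hol_unit x] with y hy
    exact hy.symm
  | succ k ih =>
    have e : G.s g.1 = G.t (g ^ k).1 := g.2.1.trans (g ^ k).2.2.symm
    have h1 := G.hol_mul e
    rw [(g ^ k).2.1] at h1
    filter_upwards [ih, h1] with y h2 h3
    have h4 : (g ^ (k + 1)).1 = G.mul g.1 (g ^ k).1 := by
      rw [pow_succ', G.mul_eq e]
      rfl
    rw [Function.iterate_succ_apply', h2, h4, h3]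

/-- A loop has finite order in its finite stabilizer, and holonomy turns powers into iterates. -/
theorem exists_iterate_hol {g : G₁} (hg : G.s g = G.t g) :
    ∃ r, 0 < r ∧ ∀ᶠ y in 𝓝 (G.s g), (G.hol g)^[r] y = y := by
  set a : G.toSmoothGroupoid.Stabilizer (G.s g) := ⟨g, rfl, hg.symm⟩ with ha
  refine ⟨orderOf a, orderOf_pos a, ?_⟩
  filter_upwards [G.hol_pow a (orderOf a), G.hol_unit (G.s g)] with y h1 h2
  rw [pow_orderOf_eq_one] at h1
  exact h1.trans h2

end Holonomy

section Jacobian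

/-- The local diffeomorphism induced by an arrow, read in the charts at `x` and `y`. -/
def holo (y x : G₀) (g : G₁) (v : EuclideanSpace ℝ (Fin n)) : EuclideanSpace ℝ (Fin n) :=
  chartAt (EuclideanSpace ℝ (Fin n)) y (G.hol g ((chartAt (EuclideanSpace ℝ (Fin n)) x).symm v))

/-- The derivative of the local diffeomorphism induced by an arrow, in the charts at `x` and `y`. -/
def jac (y x : G₀) (g : G₁) : EuclideanSpace ℝ (Fin n) →L[ℝ] EuclideanSpace ℝ (Fin n) :=
  fderiv ℝ (G.holo y x g) (chartAt (EuclideanSpace ℝ (Fin n)) x (G.s g))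

/-- The domain of the chart at `x`. -/
def dom (_ : OrbifoldGroupoid (𝓡 n) (𝓡 m) G₀ G₁) (x : G₀) : Set G₀ :=
  (chartAt (EuclideanSpace ℝ (Fin n)) x).source

theorem isOpen_dom (x : G₀) : IsOpen (G.dom x) := (chartAt _ x).open_source

theorem mem_dom (x : G₀) : x ∈ G.dom x := mem_chart_source _ x

theorem contDiffAt_holo {x y : G₀} {g : G₁} (hx : G.s g ∈ G.dom x) (hy : G.t g ∈ G.dom y) :
    ContDiffAt ℝ ∞ (G.holo y x g) (chartAt (EuclideanSpace ℝ (Fin n)) x (G.s g)) := by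
  rw [← contMDiffAt_iff_contDiffAt]
  set φ := chartAt (EuclideanSpace ℝ (Fin n)) x with hφ
  set ψ := chartAt (EuclideanSpace ℝ (Fin n)) y with hψ
  have e1 : φ.symm (φ (G.s g)) = G.s g := φ.left_inv hx
  have h1 : ContMDiffAt (𝓡 n) (𝓡 n) ∞ φ.symm (φ (G.s g)) :=
    contMDiffOn_chart_symm.contMDiffAt (φ.open_target.mem_nhds (φ.map_source hx))
  have h2 : ContMDiffAt (𝓡 n) (𝓡 n) ∞ (G.hol g) (φ.symm (φ (G.s g))) := by
    rw [e1]; exact G.contMDiffAt_hol g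
  have h3 : ContMDiffAt (𝓡 n) (𝓡 n) ∞ ψ (G.hol g (φ.symm (φ (G.s g)))) := by
    rw [e1, G.hol_self]
    exact contMDiffOn_chart.contMDiffAt (ψ.open_source.mem_nhds hy)
  exact h3.comp (φ (G.s g)) (h2.comp (φ (G.s g)) h1)

theorem tendsto_chart_symm {x y : G₀} (hy : y ∈ G.dom x) :
    Filter.Tendsto (chartAt (EuclideanSpace ℝ (Fin n)) x).symm
      (𝓝 (chartAt (EuclideanSpace ℝ (Fin n)) x y)) (𝓝 y) := by
  set φ := chartAt (EuclideanSpace ℝ (Fin n)) x with hφ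
  have := (φ.continuousAt_symm (φ.map_source hy)).tendsto
  rwa [φ.left_inv hy] at this

/-- Near `g`, by `sec_eventuallyEq`, the Jacobian is the derivative of the single map `G.holo y x
g`, evaluated at the moving source. -/
theorem contMDiffOn_jac (x y : G₀) :
    ContMDiffOn (𝓡 m) 𝓘(ℝ, EuclideanSpace ℝ (Fin n) →L[ℝ] EuclideanSpace ℝ (Fin n)) ∞
      (G.jac y x) {g | G.s g ∈ G.dom x ∧ G.t g ∈ G.dom y} := by
  rintro g ⟨hx, hy⟩
  set φ := chartAt (EuclideanSpace ℝ (Fin n)) x with hφ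
  have h1 : ContDiffAt ℝ ∞ (fderiv ℝ (G.holo y x g)) (φ (G.s g)) :=
    (G.contDiffAt_holo hx hy).fderiv_right (by simp)
  have h2 : ContMDiffAt (𝓡 m) (𝓡 n) ∞ (fun h => φ (G.s h)) g :=
    ContMDiffAt.comp g (contMDiffOn_chart.contMDiffAt (φ.open_source.mem_nhds hx))
      G.smooth_s.contMDiffAt
  refine ((ContMDiffAt.comp g h1.contMDiffAt h2).congr_of_eventuallyEq ?_).contMDiffWithinAt
  filter_upwards [G.sec_eventuallyEq g,
    ((G.isOpen_dom x).preimage G.smooth_s.continuous).mem_nhds hx] with h h3 h4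
  refine Filter.EventuallyEq.fderiv_eq ?_
  filter_upwards [(G.tendsto_chart_symm h4).eventually h3] with v hv
  simp only [holo, hol, hv]

theorem jac_mul {x y z : G₀} {g h : G₁} (e : G.s g = G.t h) (hx : G.s h ∈ G.dom x)
    (hy : G.s g ∈ G.dom y) (hz : G.t g ∈ G.dom z) :
    G.jac z y g * G.jac y x h = G.jac z x (G.mul g h) := by
  set φ := chartAt (EuclideanSpace ℝ (Fin n)) x with hφ
  have hy' : G.t h ∈ G.dom y := e ▸ hy
  have e1 : G.holo y x h (φ (G.s h)) = chartAt (EuclideanSpace ℝ (Fin n)) y (G.s g) := by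
    rw [holo, φ.left_inv hx, G.hol_self, e]
  have h1 : HasFDerivAt (G.holo z y g) (G.jac z y g) (G.holo y x h (φ (G.s h))) := by
    rw [e1]
    exact ((G.contDiffAt_holo hy hz).differentiableAt (by simp)).hasFDerivAt
  have h2 : HasFDerivAt (G.holo y x h) (G.jac y x h) (φ (G.s h)) :=
    ((G.contDiffAt_holo hx hy').differentiableAt (by simp)).hasFDerivAt
  have h3 := (h1.comp _ h2).fderiv
  rw [ContinuousLinearMap.mul_def, ← h3, jac, G.s_mul e]
  refine Filter.EventuallyEq.fderiv_eq (Filter.EventuallyEq.symm ?_)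
  have h4 := (G.tendsto_hol h).eventually ((G.isOpen_dom y).mem_nhds hy')
  filter_upwards [(G.tendsto_chart_symm hx).eventually (G.hol_mul e),
    (G.tendsto_chart_symm hx).eventually h4] with v h5 h6
  simp only [Function.comp_apply, holo]
  rw [(chartAt (EuclideanSpace ℝ (Fin n)) y).left_inv h6, ← h5]

theorem jac_eq_one_of_isIneffective {x : G₀} {g : G₁} (hx : G.s g ∈ G.dom x)
    (hg : G.IsIneffective g) : G.jac x x g = 1 := by
  obtain ⟨-, hg⟩ := G.isIneffective_iff.1 hg
  set φ := chartAt (EuclideanSpace ℝ (Fin n)) x with hφ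
  have h1 : G.holo x x g =ᶠ[𝓝 (φ (G.s g))] id := by
    filter_upwards [(G.tendsto_chart_symm hx).eventually hg,
      φ.open_target.mem_nhds (φ.map_source hx)] with v h2 h3
    simp only [holo, h2]
    exact φ.right_inv h3
  rw [jac, h1.fderiv_eq, fderiv_id]
  rfl

/-- The holonomy of a loop has finite order, so `eventually_eq_self_of_iterate` applies to it in a
chart. Hence the kernel of the tangent representation consists of ineffective arrows. -/
theorem isIneffective_of_jac_eq_one {x : G₀} {g : G₁} (hx : G.s g ∈ G.dom x)
    (hg : G.s g = G.t g) (hj : G.jac x x g = 1) : G.IsIneffective g := by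
  refine G.isIneffective_iff.2 ⟨hg, ?_⟩
  set φ := chartAt (EuclideanSpace ℝ (Fin n)) x with hφ
  have ht := G.tendsto_hol g
  rw [← hg] at ht
  have hdom := (G.isOpen_dom x).mem_nhds hx
  obtain ⟨r, hr, hit⟩ := G.exists_iterate_hol hg
  have hiter : ∀ k : ℕ, Filter.Tendsto (G.hol g)^[k] (𝓝 (G.s g)) (𝓝 (G.s g)) := fun k =>
    Filter.Tendsto.iterate ht k
  have hholo : ∀ k : ℕ, ∀ᶠ y in 𝓝 (G.s g), (G.holo x x g)^[k] (φ y) = φ ((G.hol g)^[k] y) := by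
    intro k
    induction k with
    | zero => exact Filter.Eventually.of_forall fun _ => rfl
    | succ k ih =>
      filter_upwards [ih, (hiter k).eventually hdom] with y h1 h2
      rw [Function.iterate_succ_apply', Function.iterate_succ_apply', h1, holo, φ.left_inv h2]
  have hc := (G.contDiffAt_holo hx (hg ▸ hx)).hasStrictFDerivAt (by simp)
  have hp : G.holo x x g (φ (G.s g)) = φ (G.s g) := by
    rw [holo, φ.left_inv hx, G.hol_self, hg]
  have hone : fderiv ℝ (G.holo x x g) (φ (G.s g)) = ContinuousLinearMap.id ℝ _ := hj
  rw [hone] at hc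
  have key := eventually_eq_self_of_iterate hp hc hr (by
    filter_upwards [(G.tendsto_chart_symm hx).eventually (hholo r),
      (G.tendsto_chart_symm hx).eventually hit,
      φ.open_target.mem_nhds (φ.map_source hx)] with v h1 h2 h3
    rwa [h2, φ.right_inv h3] at h1)
  have hφc : Filter.Tendsto φ (𝓝 (G.s g)) (𝓝 (φ (G.s g))) := φ.continuousAt hx
  filter_upwards [hφc.eventually key, hholo 1, hdom, ht.eventually hdom] with y h1 h2 h3 h4
  simp only [Function.iterate_one] at h2
  rw [h1] at h2
  exact φ.injOn h4 h3 h2.symm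

end Jacobian

end OrbifoldGroupoid

end Germs

/-! ### Conjugation on the finite covering of ineffective arrows. -/

section Permutations

variable {n m : ℕ} {G₀ G₁ : Type u}
  [TopologicalSpace G₀] [ChartedSpace (EuclideanSpace ℝ (Fin n)) G₀] [IsManifold (𝓡 n) ∞ G₀]
  [T2Space G₀] [SecondCountableTopology G₀]
  [TopologicalSpace G₁] [ChartedSpace (EuclideanSpace ℝ (Fin m)) G₁] [IsManifold (𝓡 m) ∞ G₁]
  [T2Space G₁] [SecondCountableTopology G₁]

namespace SmoothGroupoid

variable (G : SmoothGroupoid (𝓡 n) (𝓡 m) G₀ G₁)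

/-- Conjugation of a loop `a` by an arrow `g`. -/
def conj (g a : G₁) : G₁ := G.mul (G.mul g a) (G.inv g)

variable {g h a : G₁}

theorem s_conj (hs : G.s a = G.s g) (ht : G.t a = G.s g) : G.s (G.conj g a) = G.t g := by
  rw [conj, G.s_mul (by rw [G.s_mul ht.symm, G.t_inv, hs]), G.s_inv]

theorem t_conj (hs : G.s a = G.s g) (ht : G.t a = G.s g) : G.t (G.conj g a) = G.t g := by
  rw [conj, G.t_mul (by rw [G.s_mul ht.symm, G.t_inv, hs]), G.t_mul ht.symm]

theorem conj_mul_self (hs : G.s a = G.s g) (ht : G.t a = G.s g) :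
    G.mul (G.conj g a) g = G.mul g a :=
  G.mul_inv_mul ((G.s_mul ht.symm).trans hs)

theorem eq_conj_of_mul_eq {b : G₁} (hs : G.s a = G.s g) (ht : G.t a = G.s g) (hb : G.s b = G.t g)
    (e : G.mul b g = G.mul g a) : b = G.conj g a :=
  G.mul_right_cancel hb (G.s_conj hs ht) (e.trans (G.conj_mul_self hs ht).symm)

theorem conj_mul (e : G.s g = G.t h) (hs : G.s a = G.s h) (ht : G.t a = G.s h) :
    G.conj (G.mul g h) a = G.conj g (G.conj h a) := by
  have hs1 := G.s_conj hs ht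
  have ht1 := G.t_conj hs ht
  have hs2 : G.s (G.conj h a) = G.s g := hs1.trans e.symm
  have ht2 : G.t (G.conj h a) = G.s g := ht1.trans e.symm
  refine (G.eq_conj_of_mul_eq (hs.trans (G.s_mul e).symm) (ht.trans (G.s_mul e).symm)
    ((G.s_conj hs2 ht2).trans (G.t_mul e).symm) ?_).symm
  rw [← G.mul_assoc (G.s_conj hs2 ht2) e, G.conj_mul_self hs2 ht2, G.mul_assoc ht2.symm hs1,
    G.conj_mul_self hs ht, G.mul_assoc e ht.symm]

theorem conj_unit {x : G₀} (hs : G.s a = x) (ht : G.t a = x) : G.conj (G.unit x) a = a := by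
  subst hs
  refine (G.eq_conj_of_mul_eq (G.s_unit _).symm (ht.trans (G.s_unit _).symm) (G.t_unit _).symm
    ?_).symm
  rw [G.mul_unit]
  conv_lhs => rw [← G.unit_mul a, ht]

theorem conj_inv_conj (hs : G.s a = G.s g) (ht : G.t a = G.s g) :
    G.conj (G.inv g) (G.conj g a) = a := by
  rw [← G.conj_mul (G.s_inv g) hs ht, G.inv_mul, G.conj_unit hs ht]

theorem tendsto_conj {ι : Type*} {l : Filter ι} {b c : ι → G₁}
    (hs : G.s a = G.s g) (ht : G.t a = G.s g) (hb : Filter.Tendsto b l (𝓝 g))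
    (hc : Filter.Tendsto c l (𝓝 a)) (hbs : ∀ᶠ i in l, G.s (c i) = G.s (b i))
    (hbt : ∀ᶠ i in l, G.t (c i) = G.s (b i)) :
    Filter.Tendsto (fun i => G.conj (b i) (c i)) l (𝓝 (G.conj g a)) := by
  refine G.tendsto_mul (by rw [G.s_mul ht.symm, G.t_inv, hs])
    (G.tendsto_mul ht.symm hb hc (hbt.mono fun _ h => h.symm))
    ((G.smooth_inv.continuous.tendsto g).comp hb) ?_
  filter_upwards [hbs, hbt] with i h1 h2
  rw [G.s_mul h2.symm, h1]
  exact (G.t_inv _).symm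

end SmoothGroupoid

namespace OrbifoldGroupoid

variable (G : OrbifoldGroupoid (𝓡 n) (𝓡 m) G₀ G₁)

theorem isOpen_isIneffective : IsOpen {g | G.IsIneffective g} := by
  refine isOpen_iff_mem_nhds.2 fun g hg => ?_
  have hg' := (G.isIneffective_iff.1 hg).2
  filter_upwards [G.sec_eventuallyEq g,
    G.smooth_s.continuous.continuousAt.eventually hg'.eventually_nhds] with h h1 h2
  have h3 : ∀ᶠ y in 𝓝 (G.s h), G.hol h y = y := by
    filter_upwards [h1, h2] with y h4 h5
    rw [hol, h4]
    exact h5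
  refine G.isIneffective_iff.2 ⟨?_, h3⟩
  rw [← G.hol_self h, h3.self_of_nhds]

/-- Being a loop with identity derivative is a closed condition, and for loops it characterizes
ineffectiveness. -/
theorem isClosed_isIneffective : IsClosed {g | G.IsIneffective g} := by
  refine isClosed_iff_frequently.2 fun g hg => ?_
  have hst : G.s g = G.t g :=
    (isClosed_eq G.smooth_s.continuous G.smooth_t.continuous).mem_of_frequently_of_tendsto
      (hg.mono fun h hh => hh.1) Filter.tendsto_id
  have hopen : IsOpen {h | G.s h ∈ G.dom (G.s g) ∧ G.t h ∈ G.dom (G.s g)} :=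
    ((G.isOpen_dom _).preimage G.smooth_s.continuous).inter
      ((G.isOpen_dom _).preimage G.smooth_t.continuous)
  have hmem : g ∈ {h | G.s h ∈ G.dom (G.s g) ∧ G.t h ∈ G.dom (G.s g)} :=
    ⟨G.mem_dom _, hst ▸ G.mem_dom _⟩
  refine G.isIneffective_of_jac_eq_one (G.mem_dom _) hst ?_
  refine Set.mem_singleton_iff.1 (isClosed_singleton.mem_of_frequently_of_tendsto ?_
    ((G.contMDiffOn_jac _ _).continuousOn.continuousAt (hopen.mem_nhds hmem)).tendsto)
  refine (hg.and_eventually (hopen.mem_nhds hmem)).mono fun h hh => ?_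
  exact G.jac_eq_one_of_isIneffective hh.2.1 hh.1

/-- The ineffective arrows at `x`. -/
def ineff (x : G₀) : Set G₁ := {g | G.s g = x ∧ G.IsIneffective g}

variable {G} in
theorem t_of_mem_ineff {x : G₀} {g : G₁} (h : g ∈ G.ineff x) : G.t g = x :=
  h.2.1.symm.trans h.1

theorem finite_ineff (x : G₀) : (G.ineff x).Finite := by
  have h1 := G.finite_fibre (G.isCompact_preimage (isCompact_singleton (x := x))
    (isCompact_singleton (x := x))) x
  exact h1.subset fun g hg => ⟨⟨hg.1, t_of_mem_ineff hg⟩, hg.1⟩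

/-- Openness keeps the sections through ineffective arrows ineffective. Closedness and properness
make the ineffective arrows over a compact neighbourhood compact, so no others appear nearby. -/
theorem eventually_bijOn_ineff (x : G₀) :
    ∀ᶠ y in 𝓝 x, Set.BijOn (fun f => G.sec f y) (G.ineff x) (G.ineff y) := by
  have : LocallyCompactSpace G₀ := Manifold.locallyCompact_of_finiteDimensional (𝓡 n)
  obtain ⟨C₀, hC₀, hxC₀⟩ := exists_compact_mem_nhds x
  have hC : IsCompact ({g | G.s g ∈ C₀ ∧ G.t g ∈ C₀} ∩ {g | G.IsIneffective g}) :=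
    (G.isCompact_preimage hC₀ hC₀).inter_right G.isClosed_isIneffective
  have h1 : ∀ᶠ y in 𝓝 x, ∀ f ∈ G.ineff x, G.sec f y ∈ G.ineff y := by
    refine (Filter.eventually_all_finite (G.finite_ineff x)).2 fun f hf => ?_
    have h2 := G.tendsto_sec f
    have h3 := G.s_sec f
    rw [hf.1] at h2 h3
    filter_upwards [h2.eventually (G.isOpen_isIneffective.mem_nhds hf.2), h3] with y h4 h5
      using ⟨h5, h4⟩
  filter_upwards [h1, G.eventually_mem_fibre hC x, hxC₀,
    G.eventually_injOn_sec (G.finite_ineff x) fun f hf => hf.1] with y h2 h3 h4 h5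
  refine ⟨h2, h5, fun g hg => ?_⟩
  have hg1 : G.s g ∈ C₀ := by rw [hg.1]; exact h4
  have hg2 : G.t g ∈ C₀ := by rw [t_of_mem_ineff hg]; exact h4
  obtain ⟨f, hf, hfg⟩ := h3 g ⟨⟨hg1, hg2⟩, hg.2⟩ hg.1
  exact ⟨f, ⟨hf.2, hf.1.2⟩, hfg⟩

theorem conj_mem_ineff {g a : G₁} (ha : a ∈ G.ineff (G.s g)) : G.conj g a ∈ G.ineff (G.t g) := by
  have hs := ha.1
  have ht := t_of_mem_ineff ha
  have hsc := G.s_conj hs ht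
  refine ⟨hsc, G.isIneffective_iff.2 ⟨hsc.trans (G.t_conj hs ht).symm, ?_⟩⟩
  rw [hsc]
  have e1 : G.s (G.mul g a) = G.t (G.inv g) := by rw [G.s_mul ht.symm, G.t_inv, hs]
  have h1 := G.hol_mul e1
  have h2 := G.tendsto_hol (G.inv g)
  have h3 := G.hol_mul ht.symm
  have h4 := (G.isIneffective_iff.1 ha.2).2
  have h5 := G.hol_mul (g := g) (h := G.inv g) (G.t_inv g).symm
  rw [G.s_inv] at h1 h2 h5
  rw [G.t_inv] at h2
  rw [hs] at h3 h4
  rw [G.mul_inv] at h5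
  filter_upwards [h1, h2.eventually h3, h2.eventually h4, h5, G.hol_unit (G.t g)]
    with y k1 k2 k3 k4 k5
  rw [SmoothGroupoid.conj, k1, k2, k3, ← k4, k5]

theorem bijOn_conj (g : G₁) : Set.BijOn (G.conj g) (G.ineff (G.s g)) (G.ineff (G.t g)) := by
  refine ⟨fun a ha => G.conj_mem_ineff ha, fun a ha b hb e => ?_, fun b hb => ?_⟩
  · rw [← G.conj_inv_conj ha.1 (t_of_mem_ineff ha), e, G.conj_inv_conj hb.1 (t_of_mem_ineff hb)]
  · have hb' : b ∈ G.ineff (G.s (G.inv g)) := by rwa [G.s_inv]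
    refine ⟨G.conj (G.inv g) b, ?_, ?_⟩
    · have := G.conj_mem_ineff hb'
      rwa [G.t_inv] at this
    · rw [← G.conj_mul (G.t_inv g).symm hb'.1 (t_of_mem_ineff hb'), G.mul_inv,
        G.conj_unit hb.1 (t_of_mem_ineff hb)]

/-- The number is locally constant and, by conjugation, invariant along arrows, so it descends to a
continuous function on the connected orbit space. This is where connectedness enters. -/
theorem exists_ncard_ineff (hconn : G.toSmoothGroupoid.IsConnected) :
    ∃ N, ∀ x, (G.ineff x).ncard = N := by
  have : ConnectedSpace G.TopQuotient := hconn
  have hinv : ∀ x y : G₀, G.orbitSetoid.r x y → (G.ineff x).ncard = (G.ineff y).ncard := by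
    rintro _ _ ⟨g, rfl, rfl⟩
    rw [← (G.bijOn_conj g).image_eq]
    exact (Set.InjOn.ncard_image (G.bijOn_conj g).injOn).symm
  set F : G.TopQuotient → ℕ := Quotient.lift (fun x => (G.ineff x).ncard) hinv with hF
  have hcont : Continuous F := by
    refine Continuous.quotient_lift ?_ hinv
    refine continuous_iff_continuousAt.2 fun x => ?_
    refine (continuousAt_const (y := (G.ineff x).ncard)).congr ?_
    filter_upwards [G.eventually_bijOn_ineff x] with y hy
    rw [← hy.image_eq]
    exact (Set.InjOn.ncard_image hy.injOn).symm
  obtain ⟨p⟩ := (inferInstance : Nonempty G.TopQuotient)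
  refine ⟨F p, fun x => ?_⟩
  exact PreconnectedSpace.constant (inferInstance : PreconnectedSpace G.TopQuotient) hcont
    (x := Quotient.mk _ x) (y := p)

/-- Local enumerations of the ineffective arrows by continuous sections. -/
theorem exists_enumeration {N : ℕ} (hN : ∀ x, (G.ineff x).ncard = N) :
    ∃ (V : G₀ → Set G₀) (τ : G₀ → Fin N → G₀ → G₁), (∀ x, IsOpen (V x)) ∧ (∀ x, x ∈ V x) ∧
      ∀ x, ∀ y ∈ V x, (∀ i, ContinuousAt (τ x i) y) ∧ Function.Injective (fun i => τ x i y) ∧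
        Set.range (fun i => τ x i y) = G.ineff y := by
  have key : ∀ x, ∃ (V : Set G₀) (τ : Fin N → G₀ → G₁), IsOpen V ∧ x ∈ V ∧
      ∀ y ∈ V, (∀ i, ContinuousAt (τ i) y) ∧ Function.Injective (fun i => τ i y) ∧
        Set.range (fun i => τ i y) = G.ineff y := by
    intro x
    have : Fintype (G.ineff x) := (G.finite_ineff x).fintype
    have hc : Fintype.card (G.ineff x) = N := by
      rw [← hN x, Set.ncard_eq_toFinset_card', Set.toFinset_card]
    set e : Fin N ≃ G.ineff x := (Fintype.equivFinOfCardEq hc).symm with he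
    have h1 : ∀ᶠ y in 𝓝 x, ∀ i, ContinuousAt (G.sec (e i).1) y := by
      refine Filter.eventually_all.2 fun i => ?_
      have := G.eventually_contMDiffAt_sec (e i).1
      rw [(e i).2.1] at this
      exact this.mono fun y hy => hy.continuousAt
    obtain ⟨V, hV, ho, hx⟩ := mem_nhds_iff.1 (Filter.inter_mem h1 (G.eventually_bijOn_ineff x))
    refine ⟨V, fun i => G.sec (e i).1, ho, hx, fun y hy => ⟨(hV hy).1, ?_, ?_⟩⟩
    · intro i j hij
      exact e.injective (Subtype.ext ((hV hy).2.injOn (e i).2 (e j).2 hij))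
    · rw [← (hV hy).2.image_eq]
      ext g
      constructor
      · rintro ⟨i, rfl⟩
        exact ⟨e i, (e i).2, rfl⟩
      · rintro ⟨f, hf, rfl⟩
        exact ⟨e.symm ⟨f, hf⟩, by simp⟩
  choose V τ h1 h2 h3 using key
  exact ⟨V, τ, h1, h2, h3⟩

/-- The action of the groupoid on its ineffective arrows, as a cocycle of permutations. -/
theorem exists_permCocycle {N : ℕ} (hN : ∀ x, (G.ineff x).ncard = N) :
    ∃ (V : G₀ → Set G₀) (ρ : G₀ → G₀ → G₁ → Equiv.Perm (Fin N)),
      (∀ x, IsOpen (V x)) ∧ (∀ x, x ∈ V x) ∧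
      (∀ x y g, G.s g ∈ V x → G.t g ∈ V y → ∀ᶠ h in 𝓝 g, ρ y x h = ρ y x g) ∧
      (∀ x y z g h, G.s g = G.t h → G.s h ∈ V x → G.s g ∈ V y → G.t g ∈ V z →
        ρ z y g * ρ y x h = ρ z x (G.mul g h)) ∧
      (∀ x g, G.s g = G.t g → G.s g ∈ V x → ρ x x g = 1 → ∀ a ∈ G.ineff (G.s g),
        G.conj g a = a) := by
  obtain ⟨V, τ, hVo, hVm, hτ⟩ := G.exists_enumeration hN
  have hmem : ∀ {x y}, y ∈ V x → ∀ i, τ x i y ∈ G.ineff y := fun {x y} hy i => by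
    rw [← (hτ x y hy).2.2]; exact ⟨i, rfl⟩
  -- The permutation is conjugation read in the two local enumerations; it is the identity by
  -- default when an end point leaves its chart.
  have hex : ∀ x y g, ∃ p : Equiv.Perm (Fin N), G.s g ∈ V x → G.t g ∈ V y →
      ∀ i, τ y (p i) (G.t g) = G.conj g (τ x i (G.s g)) := by
    intro x y g
    by_cases hx : G.s g ∈ V x
    swap
    · exact ⟨1, fun h => absurd h hx⟩
    by_cases hy : G.t g ∈ V y
    swap
    · exact ⟨1, fun _ h => absurd h hy⟩
    have h1 : ∀ i, ∃ j, τ y j (G.t g) = G.conj g (τ x i (G.s g)) := fun i => by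
      have := G.conj_mem_ineff (hmem hx i)
      rw [← (hτ y _ hy).2.2] at this
      exact this
    choose p hp using h1
    have hinj : Function.Injective p := fun i j hij => by
      have h2 : G.conj g (τ x i (G.s g)) = G.conj g (τ x j (G.s g)) := by rw [← hp, ← hp, hij]
      exact (hτ x _ hx).2.1 ((G.bijOn_conj g).injOn (hmem hx i) (hmem hx j) h2)
    exact ⟨Equiv.ofBijective p (Finite.injective_iff_bijective.1 hinj), fun _ _ i => hp i⟩
  choose ρ' hρ' using hex
  refine ⟨V, fun y x g => ρ' x y g, hVo, hVm, ?_, ?_, ?_⟩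
  · intro x y g hx hy
    have hx' := (G.smooth_s.continuous.tendsto g).eventually ((hVo x).mem_nhds hx)
    have hy' := (G.smooth_t.continuous.tendsto g).eventually ((hVo y).mem_nhds hy)
    -- Both sides are continuous families of arrows with the same sources and the same limit at `g`,
    -- so they agree near `g` because the source map is étale.
    have h1 : ∀ᶠ h in 𝓝 g, ∀ i, τ y (ρ' x y g i) (G.t h) = G.conj h (τ x i (G.s h)) := by
      refine Filter.eventually_all.2 fun i => ?_
      have ha := hmem hx i
      have t1 : Filter.Tendsto (fun h => τ y (ρ' x y g i) (G.t h)) (𝓝 g)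
          (𝓝 (G.conj g (τ x i (G.s g)))) := by
        rw [← hρ' x y g hx hy i]
        exact ((hτ y _ hy).1 _).tendsto.comp (G.smooth_t.continuous.tendsto g)
      have t2 : Filter.Tendsto (fun h => G.conj h (τ x i (G.s h))) (𝓝 g)
          (𝓝 (G.conj g (τ x i (G.s g)))) := by
        refine G.tendsto_conj ha.1 (t_of_mem_ineff ha) Filter.tendsto_id
          (((hτ x _ hx).1 i).tendsto.comp (G.smooth_s.continuous.tendsto g)) ?_ ?_
        · filter_upwards [hx'] with h hh using (hmem hh i).1
        · filter_upwards [hx'] with h hh using t_of_mem_ineff (hmem hh i)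
      refine G.eventually_eq_of_tendsto t1 t2 ?_
      filter_upwards [hx', hy'] with h hh hh'
      rw [(hmem hh' _).1, G.s_conj (hmem hh i).1 (t_of_mem_ineff (hmem hh i))]
    filter_upwards [h1, hx', hy'] with h h2 h3 h4
    ext i : 1
    refine (hτ y _ h4).2.1 ?_
    change τ y (ρ' x y h i) (G.t h) = τ y (ρ' x y g i) (G.t h)
    rw [h2, hρ' x y h h3 h4]
  · intro x y z g h e hx hy hz
    have hy' : G.t h ∈ V y := e ▸ hy
    ext i : 1
    refine (hτ z _ hz).2.1 ?_
    change τ z (ρ' y z g (ρ' x y h i)) (G.t g) = τ z (ρ' x z (G.mul g h) i) (G.t g)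
    have h1 := hρ' x z (G.mul g h) (by rwa [G.s_mul e]) (by rwa [G.t_mul e]) i
    rw [G.t_mul e, G.s_mul e] at h1
    have ha := hmem hx i
    rw [h1, hρ' y z g hy hz, G.conj_mul e ha.1 (t_of_mem_ineff ha), e, hρ' x y h hx hy']
  · intro x g hg hx h1 a ha
    rw [← (hτ x _ hx).2.2] at ha
    obtain ⟨i, rfl⟩ := ha
    have h2 := hρ' x x g hx (hg ▸ hx) i
    have h3 : ρ' x x g = 1 := h1
    rw [h3, ← hg] at h2
    exact h2.symm

/-- If the ineffective stabilizers have trivial centre, an ineffective arrow that commutes with all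
ineffective arrows is a unit. -/
theorem eq_unit_of_conj_eq (hcenter : ∀ x : G₀, Subgroup.center (G.ineffectiveStabilizer x) = ⊥)
    {g : G₁} (hg : G.IsIneffective g) (hc : ∀ a ∈ G.ineff (G.s g), G.conj g a = a) :
    g = G.unit (G.s g) := by
  set γ : G.ineffectiveStabilizer (G.s g) := ⟨⟨g, rfl, hg.1.symm⟩, hg⟩ with hγ
  have h1 : γ ∈ Subgroup.center (G.ineffectiveStabilizer (G.s g)) := by
    refine Subgroup.mem_center_iff.2 fun b => ?_
    have hb : b.1.1 ∈ G.ineff (G.s g) := ⟨b.1.2.1, b.2⟩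
    have h2 := G.conj_mul_self hb.1 (t_of_mem_ineff hb)
    rw [hc _ hb] at h2
    rw [G.mul_eq (hb.1.trans hg.1),
      G.mul_eq (t_of_mem_ineff hb).symm] at h2
    exact Subtype.ext (Subtype.ext h2)
  rw [hcenter, Subgroup.mem_bot] at h1
  exact congrArg (fun γ : G.ineffectiveStabilizer (G.s g) => γ.1.1) h1

end OrbifoldGroupoid

end Permutations

/-! ### An invariant metric, by averaging over arrows. -/

section Cutoff

variable {A : Type*} [NormedRing A] [NormedAlgebra ℝ A] [StarRing A]

/-- The square of `T`, scaled by `c`. -/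
def cutoff (c : ℝ) (T : A) : A := c • (star T * T)

theorem cutoff_zero (T : A) : cutoff 0 T = 0 := zero_smul _ _

theorem cutoff_mul (c : ℝ) (S T : A) : cutoff c (S * T) = star T * cutoff c S * T := by
  simp [cutoff, mul_assoc]

theorem star_cutoff [StarModule ℝ A] (c : ℝ) (T : A) : star (cutoff c T) = cutoff c T := by
  simp [cutoff]

theorem contDiff_cutoff [StarModule ℝ A] [ContinuousStar A] :
    ContDiff ℝ ∞ (fun p : ℝ × A => cutoff p.1 p.2) :=
  contDiff_fst.smul (((starL' ℝ : A ≃L[ℝ] A).contDiff.comp contDiff_snd).mul contDiff_snd)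

end Cutoff

theorem star_sum_sum {R ι κ : Type*} [Ring R] [StarRing R] (A : Finset ι) (F : ι → Finset κ)
    {w : ι → κ → R} (hw : ∀ a f, star (w a f) = w a f) :
    star (∑ a ∈ A, ∑ f ∈ F a, w a f) = ∑ a ∈ A, ∑ f ∈ F a, w a f := by
  simp [star_sum, hw]

theorem contMDiffAt_finsetSum_normed {V E' H' M ι : Type*} [NormedAddCommGroup V] [NormedSpace ℝ V]
    [NormedAddCommGroup E'] [NormedSpace ℝ E'] [TopologicalSpace H'] {I' : ModelWithCorners ℝ E' H'}
    [TopologicalSpace M] [ChartedSpace H' M] {f : ι → M → V} {s : Finset ι} {x : M}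
    (h : ∀ i ∈ s, ContMDiffAt I' 𝓘(ℝ, V) ∞ (f i) x) :
    ContMDiffAt I' 𝓘(ℝ, V) ∞ (fun y => ∑ i ∈ s, f i y) x :=
  contMDiffAt_finsetSum h

section Metric

variable {n m : ℕ} {G₀ G₁ : Type u}
  [TopologicalSpace G₀] [ChartedSpace (EuclideanSpace ℝ (Fin n)) G₀] [IsManifold (𝓡 n) ∞ G₀]
  [T2Space G₀] [SecondCountableTopology G₀]
  [TopologicalSpace G₁] [ChartedSpace (EuclideanSpace ℝ (Fin m)) G₁] [IsManifold (𝓡 m) ∞ G₁]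
  [T2Space G₁] [SecondCountableTopology G₁]

namespace OrbifoldGroupoid

variable (G : OrbifoldGroupoid (𝓡 n) (𝓡 m) G₀ G₁)

/-- The projection to the space of orbits. -/
def orbit (x : G₀) : G.TopQuotient := Quotient.mk G.orbitSetoid x

theorem orbit_eq_iff {x y : G₀} : G.orbit x = G.orbit y ↔ ∃ g, G.s g = x ∧ G.t g = y :=
  Quotient.eq

theorem isOpenQuotientMap_orbit : IsOpenQuotientMap G.orbit := by
  refine ⟨Quotient.mk_surjective, continuous_quotient_mk', fun W hW => ?_⟩
  refine (isQuotientMap_quotient_mk' (s := G.orbitSetoid)).isOpen_preimage.1 ?_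
  convert G.isOpenMap_s _ (hW.preimage G.smooth_t.continuous) using 1
  ext x
  constructor
  · rintro ⟨y, hy, hyx⟩
    obtain ⟨g, rfl, rfl⟩ := G.orbit_eq_iff.1 hyx.symm
    exact ⟨g, hy, rfl⟩
  · rintro ⟨g, hg, rfl⟩
    exact ⟨G.t g, hg, (G.orbit_eq_iff.2 ⟨g, rfl, rfl⟩).symm⟩

/-- The orbit relation is the range of the proper map given by source and target, hence closed. -/
theorem t2Space_topQuotient : T2Space G.TopQuotient := by
  rw [t2Space_iff_of_isOpenQuotientMap G.isOpenQuotientMap_orbit]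
  convert G.proper.isClosedMap.isClosed_range using 1
  ext ⟨x, y⟩
  rw [Set.mem_ofPred, G.orbit_eq_iff]
  simp [Prod.ext_iff]

/-- Bump functions on the objects, whose supports are locally finite modulo the groupoid and meet
every orbit. -/
theorem exists_bumps : ∃ (α : Type u) (pt : α → G₀) (b : ∀ a, SmoothBumpFunction (𝓡 n) (pt a)),
    LocallyFinite (fun a => G.orbit '' Function.support (b a)) ∧
      ∀ x, ∃ a, G.orbit x ∈ G.orbit '' Function.support (b a) := by
  have : LocallyCompactSpace G₀ := Manifold.locallyCompact_of_finiteDimensional (𝓡 n)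
  have hq := G.isOpenQuotientMap_orbit
  have := hq.locallyCompactSpace
  have := hq.isQuotientMap.secondCountableTopology hq.isOpenMap
  have := G.t2Space_topQuotient
  -- As the orbit map is open, images of bump supports form a neighbourhood basis in the orbit
  -- space, where paracompactness yields a locally finite refinement of the cover.
  have hB : ∀ p : G.TopQuotient, (𝓝 p).HasBasis
      (fun f : SmoothBumpFunction (𝓡 n) (Quotient.out p) => tsupport f ⊆ Set.univ)
      (fun f => G.orbit '' Function.support f) := fun p => by
    have h1 := (SmoothBumpFunction.nhds_basis_support (I := 𝓡 n) (c := Quotient.out p)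
      Filter.univ_mem).map G.orbit
    rw [hq.map_nhds_eq] at h1
    have e : G.orbit (Quotient.out p) = p := Quotient.out_eq p
    rwa [e] at h1
  obtain ⟨α, c, b, -, hU, hfin⟩ := refinement_of_locallyCompact_sigmaCompact_of_nhds_basis hB
  refine ⟨α, fun a => Quotient.out (c a), b, hfin, fun x => ?_⟩
  have : G.orbit x ∈ ⋃ a, G.orbit '' Function.support (b a) := by rw [hU]; trivial
  exact Set.mem_iUnion.1 this

section FibreSum

variable {G} {α : Type u} {pt : α → G₀} (b : ∀ a, SmoothBumpFunction (𝓡 n) (pt a))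
  {V : Type*} [AddCommMonoid V]

variable (G) in
/-- The sum of a family of functions over the arrows with source `y`. -/
def fibreSum (W : α → G₁ → V) (y : G₀) : V := ∑ᶠ a, ∑ᶠ g ∈ G.s ⁻¹' {y}, W a g

/-- Local finiteness modulo `G` leaves finitely many indices near `y₀`. For each of them, properness
leaves finitely many arrows, which extend by sections to nearby `y`. The neighbourhood does not
depend on `W`, so different weights can be compared at one point. -/
theorem exists_fibreSum_eq (hfin : LocallyFinite (fun a => G.orbit '' Function.support (b a)))
    (y₀ : G₀) : ∃ (A : Finset α) (F : α → Finset G₁),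
      (∀ a, ∀ f ∈ F a, G.s f = y₀ ∧ G.t f ∈ tsupport (b a)) ∧
      (∀ a g, G.s g = y₀ → b a (G.t g) ≠ 0 → a ∈ A ∧ g ∈ F a) ∧
      ∀ᶠ y in 𝓝 y₀, ∀ W : α → G₁ → V, (∀ a g, b a (G.t g) = 0 → W a g = 0) →
        G.fibreSum W y = ∑ a ∈ A, ∑ f ∈ F a, W a (G.sec f y) := by
  have : LocallyCompactSpace G₀ := Manifold.locallyCompact_of_finiteDimensional (𝓡 n)
  obtain ⟨C₀, hC₀, hyC₀⟩ := exists_compact_mem_nhds y₀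
  obtain ⟨O, hO, hOfin⟩ := hfin (G.orbit y₀)
  set A := hOfin.toFinset with hA
  have hOn : ∀ᶠ y in 𝓝 y₀, G.orbit y ∈ O :=
    G.isOpenQuotientMap_orbit.continuous.continuousAt.eventually hO
  have hC : ∀ a, IsCompact {g | G.s g ∈ C₀ ∧ G.t g ∈ tsupport (b a)} := fun a =>
    G.isCompact_preimage hC₀ (b a).hasCompactSupport
  have hmemA : ∀ y, G.orbit y ∈ O → ∀ a g, G.s g = y → b a (G.t g) ≠ 0 → a ∈ A := by
    rintro _ hy a g rfl hne
    rw [hA, Set.Finite.mem_toFinset]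
    exact ⟨G.orbit (G.s g), ⟨G.t g, hne, (G.orbit_eq_iff.2 ⟨g, rfl, rfl⟩).symm⟩, hy⟩
  have hy₀ : y₀ ∈ C₀ := mem_of_mem_nhds hyC₀
  refine ⟨A, fun a => (G.finite_fibre (hC a) y₀).toFinset, ?_, ?_, ?_⟩
  · intro a f hf
    rw [Set.Finite.mem_toFinset] at hf
    exact ⟨hf.2, hf.1.2⟩
  · intro a g hg hne
    refine ⟨hmemA y₀ hOn.self_of_nhds a g hg hne, ?_⟩
    rw [Set.Finite.mem_toFinset]
    have hs : G.s g ∈ C₀ := by rw [hg]; exact hy₀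
    exact ⟨⟨hs, subset_tsupport _ hne⟩, hg⟩
  · have h1 : ∀ᶠ y in 𝓝 y₀, ∀ a ∈ A,
        (∀ g ∈ {g | G.s g ∈ C₀ ∧ G.t g ∈ tsupport (b a)}, G.s g = y →
          ∃ f ∈ {g | G.s g ∈ C₀ ∧ G.t g ∈ tsupport (b a)} ∩ G.s ⁻¹' {y₀}, G.sec f y = g) ∧
        Set.InjOn (fun f => G.sec f y)
          ({g | G.s g ∈ C₀ ∧ G.t g ∈ tsupport (b a)} ∩ G.s ⁻¹' {y₀}) ∧
        ∀ f ∈ {g | G.s g ∈ C₀ ∧ G.t g ∈ tsupport (b a)} ∩ G.s ⁻¹' {y₀}, G.s (G.sec f y) = y := by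
      refine (Filter.eventually_all_finset A).2 fun a _ => ?_
      refine (G.eventually_mem_fibre (hC a) y₀).and
        ((G.eventually_injOn_sec (G.finite_fibre (hC a) y₀) fun f hf => hf.2).and ?_)
      refine (Filter.eventually_all_finite (G.finite_fibre (hC a) y₀)).2 fun f hf => ?_
      have h2 := G.s_sec f
      have h3 : G.s f = y₀ := hf.2
      rwa [h3] at h2
    filter_upwards [hyC₀, hOn, h1] with y h2 h3 h4 W hW
    have h5 : ∀ a ∉ A, ∑ᶠ g ∈ G.s ⁻¹' {y}, W a g = 0 := fun a ha =>
      finsum_mem_eq_zero_of_forall_eq_zero fun g hg => hW a g (by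
        by_contra hne
        exact ha (hmemA y h3 a g hg hne))
    rw [fibreSum, finsum_eq_sum_of_support_subset (s := A) _ fun a ha => by
      by_contra hn
      exact ha (h5 a hn)]
    refine Finset.sum_congr rfl fun a ha => ?_
    obtain ⟨k1, k2, k3⟩ := h4 a ha
    rw [← finsum_mem_finset_eq_sum]
    have hco : ∀ f, f ∈ (G.finite_fibre (hC a) y₀).toFinset ↔
        f ∈ {g | G.s g ∈ C₀ ∧ G.t g ∈ tsupport (b a)} ∩ G.s ⁻¹' {y₀} := fun f =>
      Set.Finite.mem_toFinset _
    simp only [hco]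
    rw [← finsum_mem_image (f := W a) k2]
    -- The arrows over `y` and the values of the sections need only agree where `W a` is nonzero.
    refine finsum_mem_inter_support_eq _ _ _ ?_
    ext g
    constructor
    · rintro ⟨hg, hne⟩
      have hg' : G.s g = y := hg
      have hsg : G.s g ∈ C₀ := by rw [hg']; exact h2
      have hb : b a (G.t g) ≠ 0 := fun h0 => hne (hW a g h0)
      obtain ⟨f, hf, hfg⟩ := k1 g ⟨hsg, subset_tsupport _ hb⟩ hg'
      exact ⟨⟨f, hf, hfg⟩, hne⟩
    · rintro ⟨⟨f, hf, rfl⟩, hne⟩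
      exact ⟨k3 f hf, hne⟩

end FibreSum

section InvariantMetric

variable {G} {α : Type u} {pt : α → G₀} (b : ∀ a, SmoothBumpFunction (𝓡 n) (pt a))

local notation "𝔼" => EuclideanSpace ℝ (Fin n)

/-- The metric of the chart at the centre of a bump function, cut off and pulled back by an arrow,
in the chart at `x`. -/
def weight (x : G₀) (a : α) (g : G₁) : 𝔼 →L[ℝ] 𝔼 :=
  cutoff (b a (G.t g)) (G.jac (pt a) x g)

/-- The average of the cut off chart metrics, in the chart at `x`. -/
def metric (x y : G₀) : 𝔼 →L[ℝ] 𝔼 := G.fibreSum (weight (G := G) b x) y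

theorem weight_eq_zero {x : G₀} {a : α} {g : G₁} (h : b a (G.t g) = 0) :
    weight (G := G) b x a g = 0 := by
  rw [weight, h, cutoff_zero]

theorem contMDiffAt_weight {x : G₀} {a : α} {g : G₁} (hx : G.s g ∈ G.dom x)
    (hg : G.t g ∈ tsupport (b a)) :
    ContMDiffAt (𝓡 m) 𝓘(ℝ, 𝔼 →L[ℝ] 𝔼) ∞ (weight (G := G) b x a) g := by
  have hopen : IsOpen {h | G.s h ∈ G.dom x ∧ G.t h ∈ G.dom (pt a)} :=
    ((G.isOpen_dom _).preimage G.smooth_s.continuous).inter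
      ((G.isOpen_dom _).preimage G.smooth_t.continuous)
  have hmem : g ∈ {h | G.s h ∈ G.dom x ∧ G.t h ∈ G.dom (pt a)} :=
    ⟨hx, (b a).tsupport_subset_chartAt_source hg⟩
  have h1 := (G.contMDiffOn_jac x (pt a)).contMDiffAt (hopen.mem_nhds hmem)
  have h2 : ContMDiffAt (𝓡 m) 𝓘(ℝ, ℝ) ∞ (fun g => b a (G.t g)) g :=
    ((b a).contMDiff.comp G.smooth_t).contMDiffAt
  exact (contDiff_cutoff (A := 𝔼 →L[ℝ] 𝔼)).contMDiff.contMDiffAt.comp g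
    (h2.prodMk_space h1)

theorem contMDiffOn_metric (hfin : LocallyFinite (fun a => G.orbit '' Function.support (b a)))
    (x : G₀) : ContMDiffOn (𝓡 n) 𝓘(ℝ, 𝔼 →L[ℝ] 𝔼) ∞ (metric (G := G) b x) (G.dom x) := by
  intro y hy
  obtain ⟨A, F, hF, -, hsum⟩ := exists_fibreSum_eq (V := 𝔼 →L[ℝ] 𝔼) b hfin y
  have h1 : ContMDiffAt (𝓡 n) 𝓘(ℝ, 𝔼 →L[ℝ] 𝔼) ∞
      (fun z => ∑ a ∈ A, ∑ f ∈ F a, weight (G := G) b x a (G.sec f z)) y := by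
    refine contMDiffAt_finsetSum_normed (V := 𝔼 →L[ℝ] 𝔼) (I' := 𝓡 n)
      (f := fun a z => ∑ f ∈ F a, weight (G := G) b x a (G.sec f z)) fun a _ => ?_
    refine contMDiffAt_finsetSum_normed (V := 𝔼 →L[ℝ] 𝔼) (I' := 𝓡 n)
      (f := fun f z => weight (G := G) b x a (G.sec f z)) fun f hf => ?_
    obtain ⟨hs, ht⟩ := hF a f hf
    subst hs
    have h2 := contMDiffAt_weight b hy ht
    exact ContMDiffAt.comp_of_eq h2 (G.contMDiffAt_sec f) (G.sec_self f)
  refine (h1.congr_of_eventuallyEq ?_).contMDiffWithinAt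
  filter_upwards [hsum] with z hz using hz _ fun a g h => weight_eq_zero b h

/-- The chain rule needs the target in the chart of the bump function; elsewhere both sides vanish
through the cutoff. -/
theorem weight_mul {x y : G₀} {a : α} {g h : G₁} (e : G.s g = G.t h) (hx : G.s h ∈ G.dom x)
    (hy : G.s g ∈ G.dom y) : weight (G := G) b x a (G.mul g h) =
      star (G.jac y x h) * weight (G := G) b y a g * G.jac y x h := by
  by_cases h0 : b a (G.t g) = 0
  · rw [weight_eq_zero b h0, weight_eq_zero b (by rwa [G.t_mul e]), mul_zero, zero_mul]
  · have hz : G.t g ∈ G.dom (pt a) := (b a).tsupport_subset_chartAt_source (subset_tsupport _ h0)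
    rw [weight, weight, G.t_mul e, ← G.jac_mul e hx hy hz, cutoff_mul]

/-- Right multiplication by `h` is a bijection from the arrows with source `G.t h` to those with
source `G.s h`, and it transforms weights by the additive map `Φ`. Both sums are finite, so `Φ`
passes through them. -/
theorem metric_invariant (hfin : LocallyFinite (fun a => G.orbit '' Function.support (b a)))
    {x y : G₀} {h : G₁} (hx : G.s h ∈ G.dom x) (hy : G.t h ∈ G.dom y) :
    metric (G := G) b x (G.s h) =
      star (G.jac y x h) * metric (G := G) b y (G.t h) * G.jac y x h := by
  set Φ : (𝔼 →L[ℝ] 𝔼) →+ (𝔼 →L[ℝ] 𝔼) :=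
    (AddMonoidHom.mulRight (G.jac y x h)).comp (AddMonoidHom.mulLeft (star (G.jac y x h))) with hΦ
  have hΦa : ∀ T, Φ T = star (G.jac y x h) * T * G.jac y x h := fun T => rfl
  obtain ⟨A, F, hF, -, hsum⟩ := exists_fibreSum_eq (V := 𝔼 →L[ℝ] 𝔼) b hfin (G.t h)
  have hs := hsum.self_of_nhds
  have h1 : metric (G := G) b x (G.s h) =
      G.fibreSum (fun a g => Φ (weight (G := G) b y a g)) (G.t h) := by
    refine finsum_congr fun a => ?_
    refine (finsum_mem_eq_of_bijOn (fun g => G.mul g h) ⟨?_, ?_, ?_⟩ ?_).symm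
    · intro g (hg : G.s g = G.t h)
      exact G.s_mul hg
    · intro g (hg : G.s g = G.t h) g' (hg' : G.s g' = G.t h) e
      exact G.mul_right_cancel hg hg' e
    · intro g (hg : G.s g = G.s h)
      exact ⟨G.mul g (G.inv h), (G.s_mul (hg.trans (G.t_inv h).symm)).trans (G.s_inv h),
        G.mul_inv_mul hg⟩
    · intro g (hg : G.s g = G.t h)
      exact (weight_mul b hg hx (hg ▸ hy)).symm
  have h2 := hs (fun a g => Φ (weight (G := G) b y a g)) fun a g h => by
    rw [weight_eq_zero b h, map_zero]
  have h3 := hs (weight (G := G) b y) fun a g h => weight_eq_zero b h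
  rw [h1, h2]
  change _ = Φ (G.fibreSum (weight (G := G) b y) (G.t h))
  rw [h3]
  simp only [map_sum]

theorem star_metric (hfin : LocallyFinite (fun a => G.orbit '' Function.support (b a)))
    (x y : G₀) : star (metric (G := G) b x y) = metric (G := G) b x y := by
  obtain ⟨A, F, hF, -, hsum⟩ := exists_fibreSum_eq (V := 𝔼 →L[ℝ] 𝔼) b hfin y
  rw [metric, hsum.self_of_nhds _ fun a g h => weight_eq_zero b h]
  exact star_sum_sum (R := 𝔼 →L[ℝ] 𝔼) A F fun a f => star_cutoff _ _

theorem isUnit_jac {x y : G₀} {g : G₁} (hx : G.s g ∈ G.dom x) (hy : G.t g ∈ G.dom y) :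
    IsUnit (G.jac y x g) := by
  have h1 := G.jac_mul (g := G.inv g) (h := g) (G.s_inv g) hx (by rwa [G.s_inv])
    (by rwa [G.t_inv] : G.t (G.inv g) ∈ G.dom x)
  have h2 := G.jac_mul (g := g) (h := G.inv g) (G.t_inv g).symm (by rwa [G.s_inv]) hx
    (hy : G.t g ∈ G.dom y)
  rw [G.inv_mul, G.jac_eq_one_of_isIneffective (by rwa [G.s_unit]) (G.isIneffective_unit _)] at h1
  rw [G.mul_inv, G.jac_eq_one_of_isIneffective (by rwa [G.s_unit]) (G.isIneffective_unit _)] at h2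
  exact ⟨⟨_, _, h2, h1⟩, rfl⟩

/-- All summands are nonnegative. The orbit of `y` meets the support of some bump function, and an
arrow into that support contributes a positive term because its Jacobian is invertible. -/
theorem metric_pos (hfin : LocallyFinite (fun a => G.orbit '' Function.support (b a)))
    (hcov : ∀ x, ∃ a, G.orbit x ∈ G.orbit '' Function.support (b a)) {x y : G₀}
    (hy : y ∈ G.dom x) {v : 𝔼} (hv : v ≠ 0) : 0 < inner ℝ (metric (G := G) b x y v) v := by
  obtain ⟨A, F, hF, hF', hsum⟩ := exists_fibreSum_eq (V := 𝔼 →L[ℝ] 𝔼) b hfin y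
  have hw : ∀ a g, inner ℝ (weight (G := G) b x a g v) v =
      b a (G.t g) * ‖G.jac (pt a) x g v‖ ^ 2 := fun a g => by
    change inner ℝ (b a (G.t g) • (star (G.jac (pt a) x g) (G.jac (pt a) x g v))) v = _
    rw [real_inner_smul_left, ContinuousLinearMap.star_eq_adjoint,
      ContinuousLinearMap.adjoint_inner_left, real_inner_self_eq_norm_sq]
  rw [metric, hsum.self_of_nhds _ fun a g h => weight_eq_zero b h]
  simp only [sum_apply, sum_inner, hw]
  have hnn : ∀ a g, 0 ≤ b a (G.t g) * ‖G.jac (pt a) x g v‖ ^ 2 := fun a g =>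
    mul_nonneg (b a).nonneg (sq_nonneg _)
  obtain ⟨a, z, hz, hzy⟩ := hcov y
  obtain ⟨g, rfl, rfl⟩ := G.orbit_eq_iff.1 hzy.symm
  obtain ⟨ha, hg⟩ := hF' a g rfl hz
  refine Finset.sum_pos' (fun a _ => Finset.sum_nonneg fun f _ => hnn a _) ⟨a, ha, ?_⟩
  refine Finset.sum_pos' (fun f _ => hnn a _) ⟨g, hg, ?_⟩
  rw [G.sec_self]
  have hbt : G.t g ∈ G.dom (pt a) := (b a).tsupport_subset_chartAt_source (subset_tsupport _ hz)
  obtain ⟨T, hT⟩ := isUnit_jac (G := G) hy hbt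
  have hne : G.jac (pt a) x g v ≠ 0 := fun h0 => hv (by
    have h1 : ((T⁻¹ : (𝔼 →L[ℝ] 𝔼)ˣ) : 𝔼 →L[ℝ] 𝔼) ((T : 𝔼 →L[ℝ] 𝔼) v) = v := by
      change ((T⁻¹ : (𝔼 →L[ℝ] 𝔼)ˣ) * (T : 𝔼 →L[ℝ] 𝔼)) v = v
      rw [Units.inv_mul]
      rfl
    rw [← h1, hT, h0, map_zero])
  exact mul_pos (lt_of_le_of_ne (b a).nonneg (Ne.symm hz)) (by positivity)

end InvariantMetric

end OrbifoldGroupoid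

end Metric

/-! ### Smooth square roots of positive definite operators. -/

section SquareRoot

variable {A : Type*} [NormedRing A] [NormedAlgebra ℝ A] [CompleteSpace A] [StarRing A]
  [ContinuousStar A]

/-- Near `1` there is a smooth square root which preserves self-adjointness. -/
theorem exists_sqrt_near_one : ∃ r : A → A, ∀ᶠ a in 𝓝 (1 : A), ContDiffAt ℝ ∞ r a ∧
    r a * r a = a ∧ (star a = a → star (r a) = r a) ∧ IsUnit (r a) := by
  have hd : HasStrictFDerivAt (fun a : A => a * a)
      (((ContinuousLinearEquiv.smulLeft (Units.mk0 (2 : ℝ) two_ne_zero) : A ≃L[ℝ] A)) : A →L[ℝ] A)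
      1 := by
    refine ((hasStrictFDerivAt_id (𝕜 := ℝ) (1 : A)).mul' (hasStrictFDerivAt_id (1 : A))).congr_fderiv
      ?_
    ext a
    change (1 : A) * a + a * 1 = (2 : ℝ) • a
    rw [one_mul, mul_one, two_smul]
  -- Analyticity, unlike smoothness of order `∞` at a point, passes to a neighbourhood of the point;
  -- this is used for the inverse.
  have hc : ContDiffAt ℝ ω (fun a : A => a * a) 1 := contDiffAt_id.mul contDiffAt_id
  have hl := hc.to_localInverse hd.hasFDerivAt (by simp)
  set r := hc.localInverse hd.hasFDerivAt (by simp) with hr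
  have hr1 : r 1 = 1 := by
    have := hc.localInverse_apply_image hd.hasFDerivAt (by simp)
    simpa using this
  simp only [mul_one] at hl
  have hright : ∀ᶠ a in 𝓝 (1 : A), r a * r a = a := by
    have := (hc.hasStrictFDerivAt' hd.hasFDerivAt (by simp)).eventually_right_inverse
    simp only [mul_one] at this
    exact this
  have hleft : ∀ᶠ a in 𝓝 (1 : A), r (a * a) = a :=
    (hc.hasStrictFDerivAt' hd.hasFDerivAt (by simp)).eventually_left_inverse
  have hrc : Filter.Tendsto r (𝓝 1) (𝓝 1) := by
    have := hl.continuousAt.tendsto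
    rwa [hr1] at this
  have hsc : Filter.Tendsto (fun a => star (r a)) (𝓝 1) (𝓝 1) := by
    have := hrc.star
    rwa [star_one] at this
  have hu : ∀ᶠ a in 𝓝 (1 : A), IsUnit a := Units.isOpen.mem_nhds isUnit_one
  refine ⟨r, ?_⟩
  filter_upwards [hl.eventually (by simp), hright, hrc.eventually hleft, hsc.eventually hleft,
    hrc.eventually hu] with a h1 h2 h3 h4 h5
  refine ⟨h1.of_le (by simp), h2, fun hs => ?_, h5⟩
  -- For self-adjoint `a`, the element `star (r a)` is also a root of `a` near `1`, and such a root
  -- is unique.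
  rw [← star_mul, h2, hs] at h4
  exact h4.symm

/-- A smooth square root near a square. -/
theorem exists_sqrt_near [StarModule ℝ A] {S : A} (hS : IsUnit S) : ∃ R : A → A,
    ∀ᶠ T in 𝓝 (star S * S), ContDiffAt ℝ ∞ R T ∧ (star T = T → star (R T) * R T = T) ∧
      IsUnit (R T) := by
  obtain ⟨S, rfl⟩ := hS
  obtain ⟨r, hr⟩ := exists_sqrt_near_one (A := A)
  -- This congruence carries `star S * S` to `1` and preserves self-adjointness.
  set φ : A → A := fun T => star (↑S⁻¹ : A) * T * (↑S⁻¹ : A) with hφ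
  have hφc : ContDiff ℝ ∞ φ := (contDiff_const.mul contDiff_id).mul contDiff_const
  have hi : star (↑S⁻¹ : A) * star (S : A) = 1 := by rw [← star_mul, S.mul_inv, star_one]
  have hi' : star (S : A) * star (↑S⁻¹ : A) = 1 := by rw [← star_mul, S.inv_mul, star_one]
  have hφ1 : φ (star (S : A) * S) = 1 := by
    rw [hφ]
    dsimp only
    rw [← mul_assoc, hi, one_mul, S.mul_inv]
  have ht : Filter.Tendsto φ (𝓝 (star (S : A) * S)) (𝓝 1) := by
    have := hφc.continuous.tendsto (star (S : A) * S)
    rwa [hφ1] at this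
  refine ⟨fun T => r (φ T) * S, ?_⟩
  filter_upwards [ht.eventually hr] with T ⟨h1, h2, h3, h4⟩
  refine ⟨(h1.comp T hφc.contDiffAt).mul contDiffAt_const, fun hs => ?_, h4.mul S.isUnit⟩
  have h5 : star (φ T) = φ T := by simp [hφ, hs, mul_assoc]
  rw [star_mul, h3 h5, mul_assoc, ← mul_assoc (r _) (r _), h2, hφ]
  dsimp only
  rw [← mul_assoc, ← mul_assoc, ← mul_assoc, hi', one_mul, mul_assoc, S.inv_mul, mul_one]

end SquareRoot

section PositiveDefinite

variable {E : Type*} [NormedAddCommGroup E] [InnerProductSpace ℝ E] [FiniteDimensional ℝ E]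
  [CompleteSpace E]

/-- In an orthonormal eigenbasis, `S` multiplies by the square roots of the eigenvalues. It supplies
the frame at the centre of a chart, from which the smooth root extends it. -/
theorem exists_star_mul_self_eq {T : E →L[ℝ] E} (hT : star T = T)
    (hpos : ∀ v, v ≠ 0 → 0 < inner ℝ (T v) v) : ∃ S : E →L[ℝ] E, IsUnit S ∧ star S * S = T := by
  have hsym : (T : E →ₗ[ℝ] E).IsSymmetric := fun x y => by
    have := ContinuousLinearMap.adjoint_inner_left T y x
    rw [← ContinuousLinearMap.star_eq_adjoint, hT] at this
    exact this
  set e := hsym.eigenvectorBasis rfl with he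
  set l := hsym.eigenvalues rfl with hl
  have hTe : ∀ i, T (e i) = l i • e i := fun i => hsym.apply_eigenvectorBasis rfl i
  have hl0 : ∀ i, 0 ≤ l i := fun i => by
    have := hpos (e i) (e.orthonormal.ne_zero i)
    rw [hTe, real_inner_smul_left, real_inner_self_eq_norm_sq, e.orthonormal.norm_eq_one] at this
    linarith
  set S : E →L[ℝ] E := LinearMap.toContinuousLinearMap
    (e.toBasis.constr ℝ fun i => Real.sqrt (l i) • e i) with hS
  have hSe : ∀ i, S (e i) = Real.sqrt (l i) • e i := fun i => by
    have := e.toBasis.constr_basis ℝ (fun i => Real.sqrt (l i) • e i) i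
    rwa [e.coe_toBasis] at this
  have hST : star S * S = T := by
    have : ∀ i, (star S * S) (e i) = T (e i) := fun i => by
      refine InnerProductSpace.ext_inner_right_basis e.toBasis fun j => ?_
      change inner ℝ ((star S) (S (e i))) _ = _
      rw [ContinuousLinearMap.star_eq_adjoint, ContinuousLinearMap.adjoint_inner_left,
        e.coe_toBasis, hSe, hSe, hTe, real_inner_smul_left, real_inner_smul_right,
        real_inner_smul_left]
      by_cases hij : i = j
      · subst hij
        rw [← _root_.mul_assoc, Real.mul_self_sqrt (hl0 i)]
      · rw [e.orthonormal.inner_eq_zero hij]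
        simp
    exact ContinuousLinearMap.coe_injective (e.toBasis.ext fun i => by
      rw [e.coe_toBasis]
      exact this i)
  have hinj : Function.Injective S := (injective_iff_map_eq_zero S).2 fun v hv => by
    by_contra hne
    have h1 := hpos v hne
    rw [← hST] at h1
    change 0 < inner ℝ ((star S) (S v)) v at h1
    rw [hv] at h1
    simp at h1
  refine ⟨S, ContinuousLinearMap.isUnit_iff_bijective.2 ⟨hinj, ?_⟩, hST⟩
  exact (LinearMap.injective_iff_surjective (f := (S : E →ₗ[ℝ] E))).1 hinj

end PositiveDefinite

/-! ### Local frames orthonormal for the invariant metric. -/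

section Frames

variable {n m : ℕ} {G₀ G₁ : Type u}
  [TopologicalSpace G₀] [ChartedSpace (EuclideanSpace ℝ (Fin n)) G₀] [IsManifold (𝓡 n) ∞ G₀]
  [T2Space G₀] [SecondCountableTopology G₀]
  [TopologicalSpace G₁] [ChartedSpace (EuclideanSpace ℝ (Fin m)) G₁] [IsManifold (𝓡 m) ∞ G₁]
  [T2Space G₁] [SecondCountableTopology G₁]

local notation "𝔼" => EuclideanSpace ℝ (Fin n)

/-- Local frames, orthonormal for an invariant metric. -/
theorem OrbifoldGroupoid.exists_frames (G : OrbifoldGroupoid (𝓡 n) (𝓡 m) G₀ G₁) :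
    ∃ (U : G₀ → Set G₀) (B : G₀ → G₀ → (𝔼 →L[ℝ] 𝔼)),
      (∀ x, IsOpen (U x)) ∧ (∀ x, x ∈ U x) ∧ (∀ x, U x ⊆ G.dom x) ∧
      (∀ x, ContMDiffOn (𝓡 n) 𝓘(ℝ, 𝔼 →L[ℝ] 𝔼) ∞ (B x) (U x)) ∧
      (∀ x, ∀ y ∈ U x, IsUnit (B x y)) ∧
      ∀ x y g, G.s g ∈ U x → G.t g ∈ U y → star (B x (G.s g)) * B x (G.s g) =
        star (G.jac y x g) * (star (B y (G.t g)) * B y (G.t g)) * G.jac y x g := by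
  obtain ⟨α, pt, b, hfin, hcov⟩ := G.exists_bumps
  have key : ∀ x, ∃ (U : Set G₀) (B : G₀ → (𝔼 →L[ℝ] 𝔼)), IsOpen U ∧ x ∈ U ∧ U ⊆ G.dom x ∧
      ContMDiffOn (𝓡 n) 𝓘(ℝ, 𝔼 →L[ℝ] 𝔼) ∞ B U ∧ (∀ y ∈ U, IsUnit (B y)) ∧
      ∀ y ∈ U, star (B y) * B y = metric (G := G) b x y := fun x => by
    obtain ⟨S, hS, hSx⟩ := exists_star_mul_self_eq (star_metric (G := G) b hfin x x)
      fun v hv => metric_pos (G := G) b hfin hcov (G.mem_dom x) hv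
    obtain ⟨R, hR⟩ := exists_sqrt_near hS
    rw [hSx] at hR
    have hm := (contMDiffOn_metric (G := G) b hfin x)
    have hmx := hm.contMDiffAt ((G.isOpen_dom x).mem_nhds (G.mem_dom x))
    obtain ⟨U, hU, hUo, hxU⟩ := eventually_nhds_iff.1
      ((hmx.continuousAt.eventually hR).and ((G.isOpen_dom x).mem_nhds (G.mem_dom x)))
    refine ⟨U, fun y => R (metric (G := G) b x y), hUo, hxU, fun y hy => (hU y hy).2,
      fun y hy => ?_, fun y hy => (hU y hy).1.2.2, fun y hy => (hU y hy).1.2.1 ?_⟩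
    · exact ((hU y hy).1.1.contMDiffAt.comp y
        (hm.contMDiffAt ((G.isOpen_dom x).mem_nhds (hU y hy).2))).contMDiffWithinAt
    · exact star_metric (G := G) b hfin x y
  choose U B h1 h2 h3 h4 h5 h6 using key
  refine ⟨U, B, h1, h2, h3, h4, h5, fun x y g hx hy => ?_⟩
  rw [h6 x _ hx, h6 y _ hy, metric_invariant (G := G) b hfin (h3 x hx) (h3 y hy)]

end Frames

/-! ### Products of unitary groups and permutation matrices. -/

section UnitaryProducts

/-- A pair of unitary elements is unitary in the product. -/
def prodUnitary (A₁ A₂ : Type*) [Ring A₁] [StarRing A₁] [Ring A₂] [StarRing A₂] :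
    unitary A₁ × unitary A₂ →* unitary (A₁ × A₂) where
  toFun p := ⟨(p.1, p.2), Unitary.mem_iff.2
    ⟨Prod.ext (Unitary.coe_star_mul_self p.1) (Unitary.coe_star_mul_self p.2),
      Prod.ext (Unitary.coe_mul_star_self p.1) (Unitary.coe_mul_star_self p.2)⟩⟩
  map_one' := rfl
  map_mul' _ _ := rfl

theorem prodUnitary_injective {A₁ A₂ : Type*} [Ring A₁] [StarRing A₁] [Ring A₂] [StarRing A₂] :
    Function.Injective (prodUnitary A₁ A₂) := fun p q h => by
  have h1 : ((p.1 : A₁), (p.2 : A₂)) = ((q.1 : A₁), (q.2 : A₂)) := congrArg Subtype.val h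
  exact Prod.ext (Subtype.ext (congrArg Prod.fst h1)) (Subtype.ext (congrArg Prod.snd h1))

theorem compactSpace_unitary_prod {A₁ A₂ : Type*}
    [NormedRing A₁] [NormedAlgebra ℝ A₁] [StarRing A₁] [CStarRing A₁] [StarModule ℝ A₁]
    [FiniteDimensional ℝ A₁]
    [NormedRing A₂] [NormedAlgebra ℝ A₂] [StarRing A₂] [CStarRing A₂] [StarModule ℝ A₂]
    [FiniteDimensional ℝ A₂] : CompactSpace (unitary (A₁ × A₂)) := inferInstance

/-- Permutations of the coordinates, as isometries. -/
def permIsometry (N : ℕ) :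
    Equiv.Perm (Fin N) →* (EuclideanSpace ℝ (Fin N) ≃ₗᵢ[ℝ] EuclideanSpace ℝ (Fin N)) where
  toFun σ := LinearIsometryEquiv.piLpCongrLeft 2 ℝ ℝ σ
  map_one' := rfl
  map_mul' _ _ := LinearIsometryEquiv.ext fun _ => rfl

theorem permIsometry_injective (N : ℕ) : Function.Injective (permIsometry N) := fun σ τ h => by
  ext i
  have h1 : EuclideanSpace.single (σ i) (1 : ℝ) = EuclideanSpace.single (τ i) 1 := by
    rw [← EuclideanSpace.piLpCongrLeft_single σ i 1, ← EuclideanSpace.piLpCongrLeft_single τ i 1]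
    exact congrArg (fun f : EuclideanSpace ℝ (Fin N) ≃ₗᵢ[ℝ] EuclideanSpace ℝ (Fin N) =>
      f (EuclideanSpace.single i (1 : ℝ))) h
  have h2 := congrArg (fun v : EuclideanSpace ℝ (Fin N) => v (σ i)) h1
  by_contra hne
  have : σ i ≠ τ i := fun h => hne (congrArg _ h)
  simp [this] at h2

/-- The unitary operator permuting the coordinates. -/
def permUnitary (N : ℕ) :
    Equiv.Perm (Fin N) →* unitary (EuclideanSpace ℝ (Fin N) →L[ℝ] EuclideanSpace ℝ (Fin N)) :=
  (Unitary.linearIsometryEquiv (𝕜 := ℝ)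
    (H := EuclideanSpace ℝ (Fin N))).symm.toMonoidHom.comp (permIsometry N)

theorem permUnitary_injective (N : ℕ) : Function.Injective (permUnitary N) :=
  (Unitary.linearIsometryEquiv (𝕜 := ℝ) (H := EuclideanSpace ℝ (Fin N))).symm.injective.comp
    (permIsometry_injective N)

end UnitaryProducts

/-! ### Matrices of derivatives in moving frames. -/

section FrameChange

variable {A : Type*} [NormedRing A]

/-- The matrix of `J` in the frames `b` and `b'`. -/
def frameChange (b' J b : A) : A := b' * J * Ring.inverse b

theorem frameChange_mul {b₁ b₂ b₃ J J' : A} (h : IsUnit b₂) :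
    frameChange b₃ J' b₂ * frameChange b₂ J b₁ = frameChange b₃ (J' * J) b₁ := by
  simp only [frameChange]
  rw [mul_assoc b₂, mul_assoc (b₃ * J'), ← mul_assoc (Ring.inverse b₂), Ring.inverse_mul_cancel _ h,
    one_mul]
  simp only [mul_assoc]

theorem eq_one_of_frameChange_eq_one {b J : A} (hb : IsUnit b) (h : frameChange b J b = 1) :
    J = 1 := by
  have h1 : b * J = b := by
    have := congrArg (· * b) h
    simpa [frameChange, mul_assoc, Ring.inverse_mul_cancel _ hb] using this
  exact hb.mul_left_cancel (h1.trans (mul_one b).symm)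

/-- The hypothesis says that `J` is isometric for the metrics defined by the frames, which gives a
left inverse; it is two-sided since all factors are units. -/
theorem frameChange_mem_unitary [StarRing A] {b' J b : A} (hb' : IsUnit b') (hJ : IsUnit J) (hb : IsUnit b)
    (h : star b * b = star J * (star b' * b') * J) : frameChange b' J b ∈ unitary A := by
  obtain ⟨b, rfl⟩ := hb
  have hu : IsUnit (frameChange b' J b) := by
    rw [frameChange, Ring.inverse_unit]
    exact (hb'.mul hJ).mul b⁻¹.isUnit
  have h1 : star (frameChange b' J b) * frameChange b' J b = 1 := by
    have h2 : star (↑b⁻¹ : A) * star (b : A) = 1 := by rw [← star_mul, b.mul_inv, star_one]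
    calc star (frameChange b' J b) * frameChange b' J b
        = star (↑b⁻¹ : A) * (star J * (star b' * b') * J) * (↑b⁻¹ : A) := by
          simp only [frameChange, Ring.inverse_unit, star_mul, mul_assoc]
      _ = 1 := by rw [← h, ← mul_assoc, h2, one_mul, b.mul_inv]
  refine Unitary.mem_iff.2 ⟨h1, ?_⟩
  obtain ⟨w, hw⟩ := hu
  rw [← hw] at h1 ⊢
  rw [Units.eq_inv_of_mul_eq_one_right h1, Units.mul_inv]

theorem contMDiffWithinAt_frameChange [NormedAlgebra ℝ A] [CompleteSpace A]
    {E' H' M : Type*} [NormedAddCommGroup E'] [NormedSpace ℝ E'] [TopologicalSpace H']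
    {I' : ModelWithCorners ℝ E' H'} [TopologicalSpace M] [ChartedSpace H' M] {b' J b : M → A}
    {S : Set M} {x : M} (hb' : ContMDiffWithinAt I' 𝓘(ℝ, A) ∞ b' S x)
    (hJ : ContMDiffWithinAt I' 𝓘(ℝ, A) ∞ J S x) (hb : ContMDiffWithinAt I' 𝓘(ℝ, A) ∞ b S x)
    (hu : IsUnit (b x)) :
    ContMDiffWithinAt I' 𝓘(ℝ, A) ∞ (fun y => frameChange (b' y) (J y) (b y)) S x := by
  obtain ⟨w, hw⟩ := hu
  have h1 : ContDiffAt ℝ ∞ (Ring.inverse : A → A) (b x) := hw ▸ contDiffAt_ringInverse ℝ w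
  have h2 : ContDiff ℝ ∞ (fun p : (A × A) × A => p.1.1 * p.1.2 * p.2) :=
    ((contDiff_fst.comp contDiff_fst).mul (contDiff_snd.comp contDiff_fst)).mul contDiff_snd
  exact h2.contMDiff.contMDiffAt.comp_contMDiffWithinAt x
    ((hb'.prodMk_space hJ).prodMk_space (h1.contMDiffAt.comp_contMDiffWithinAt x hb))

end FrameChange

/-! ### The faithful orthogonal cocycle. -/

section Representation

variable {n m : ℕ} {G₀ G₁ : Type u}
  [TopologicalSpace G₀] [ChartedSpace (EuclideanSpace ℝ (Fin n)) G₀] [IsManifold (𝓡 n) ∞ G₀]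
  [T2Space G₀] [SecondCountableTopology G₀]
  [TopologicalSpace G₁] [ChartedSpace (EuclideanSpace ℝ (Fin m)) G₁] [IsManifold (𝓡 m) ∞ G₁]
  [T2Space G₁] [SecondCountableTopology G₁]

open scoped Classical in
/-- A cocycle with values in a product of unitary groups, with a smooth and a locally constant
component. -/
theorem OrbifoldGroupoid.nonempty_faithfulCocycle_prod (G : OrbifoldGroupoid (𝓡 n) (𝓡 m) G₀ G₁)
    {A₁ A₂ : Type}
    [NormedRing A₁] [NormedAlgebra ℝ A₁] [StarRing A₁] [CStarRing A₁] [StarModule ℝ A₁]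
    [FiniteDimensional ℝ A₁]
    [NormedRing A₂] [NormedAlgebra ℝ A₂] [StarRing A₂] [CStarRing A₂] [StarModule ℝ A₂]
    [FiniteDimensional ℝ A₂]
    (U : G₀ → Set G₀) (hUo : ∀ x, IsOpen (U x)) (hxU : ∀ x, x ∈ U x)
    (W : G₀ → G₀ → G₁ → A₁) (ρ : G₀ → G₀ → G₁ → unitary A₂)
    (hWu : ∀ x y g, G.s g ∈ U x → G.t g ∈ U y → W y x g ∈ unitary A₁)
    (hWs : ∀ x y, ContMDiffOn (𝓡 m) 𝓘(ℝ, A₁) ∞ (W y x) {g | G.s g ∈ U x ∧ G.t g ∈ U y})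
    (hW : ∀ x y z g h, G.s g = G.t h → G.s h ∈ U x → G.s g ∈ U y → G.t g ∈ U z →
      W z y g * W y x h = W z x (G.mul g h))
    (hloc : ∀ x y g, G.s g ∈ U x → G.t g ∈ U y → ∀ᶠ h in 𝓝 g, ρ y x h = ρ y x g)
    (hρ : ∀ x y z g h, G.s g = G.t h → G.s h ∈ U x → G.s g ∈ U y → G.t g ∈ U z →
      ρ z y g * ρ y x h = ρ z x (G.mul g h))
    (hfaith : ∀ x g, G.s g = G.t g → G.s g ∈ U x → W x x g = 1 → ρ x x g = 1 →
      g = G.unit (G.s g)) :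
    Nonempty (FaithfulCocycle G (Module.finrank ℝ (Skew (A₁ × A₂))) (unitary (A₁ × A₂))) := by
  -- The value `1` is a default for arrows outside the charts, where `W` need not be unitary.
  set w : G₀ → G₀ → G₁ → unitary A₁ := fun y x g =>
    if h : W y x g ∈ unitary A₁ then ⟨W y x g, h⟩ else 1 with hw
  have hwW : ∀ {x y g}, G.s g ∈ U x → G.t g ∈ U y → (w y x g : A₁) = W y x g :=
    fun {x y g} hx hy => by rw [hw]; dsimp only; rw [dif_pos (hWu x y g hx hy)]
  refine ⟨{
    U := U
    isOpen_U := hUo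
    mem_U := hxU
    val := fun y x g => prodUnitary _ _ (w y x g, ρ y x g)
    smooth := fun x y g hg => ?_
    cocycle := fun x y z g h e hx hy hz => ?_
    faithful := fun x g e hx h1 => ?_ }⟩
  · refine contMDiffWithinAt_unitary (ContMDiffWithinAt.congr_of_eventuallyEq
      ((hWs x y g hg).prodMk_space (contMDiffWithinAt_const (c := (ρ y x g : A₂)))) ?_ ?_)
    · filter_upwards [self_mem_nhdsWithin, mem_nhdsWithin_of_mem_nhds (hloc x y g hg.1 hg.2)]
        with h hh hρh
      exact Prod.ext (hwW hh.1 hh.2) (congrArg Subtype.val hρh)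
    · exact Prod.ext (hwW hg.1 hg.2) rfl
  · have h1 : w z y g * w y x h = w z x (G.mul g h) := Subtype.ext (by
      rw [hwW (by rwa [G.s_mul e]) (by rwa [G.t_mul e]), ← hW x y z g h e hx hy hz,
        Submonoid.coe_mul, hwW hy hz, hwW hx (e ▸ hy)])
    rw [← map_mul, Prod.mk_mul_mk, h1, hρ x y z g h e hx hy hz]
  · have h2 := prodUnitary_injective (h1.trans (map_one (prodUnitary _ _)).symm)
    have h3 : w x x g = 1 := congrArg Prod.fst h2
    refine hfaith x g e hx ?_ (congrArg Prod.snd h2)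
    rw [← hwW hx (e ▸ hx), h3]
    rfl

/-- The representations on the tangent spaces, in frames orthonormal for an invariant metric, and on
the functions on the ineffective stabilizers form a faithful cocycle. -/
theorem OrbifoldGroupoid.exists_faithfulCocycle (G : OrbifoldGroupoid (𝓡 n) (𝓡 m) G₀ G₁)
    (hconn : G.toSmoothGroupoid.IsConnected)
    (hcenter : ∀ x : G₀, Subgroup.center (G.ineffectiveStabilizer x) = ⊥) :
    ∃ N : ℕ, Nonempty (FaithfulCocycle G
      (Module.finrank ℝ (Skew ((EuclideanSpace ℝ (Fin n) →L[ℝ] EuclideanSpace ℝ (Fin n)) ×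
        (EuclideanSpace ℝ (Fin N) →L[ℝ] EuclideanSpace ℝ (Fin N)))))
      (unitary ((EuclideanSpace ℝ (Fin n) →L[ℝ] EuclideanSpace ℝ (Fin n)) ×
        (EuclideanSpace ℝ (Fin N) →L[ℝ] EuclideanSpace ℝ (Fin N))))) := by
  obtain ⟨N, hN⟩ := G.exists_ncard_ineff hconn
  obtain ⟨V, ρ, hVo, hxV, hloc, hmul, hfaith⟩ := G.exists_permCocycle hN
  obtain ⟨U, B, hUo, hxU, hUd, hB, hBu, hinv⟩ := G.exists_frames
  refine ⟨N, G.nonempty_faithfulCocycle_prod (fun x => U x ∩ V x)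
    (fun x => (hUo x).inter (hVo x)) (fun x => ⟨hxU x, hxV x⟩)
    (fun y x g => frameChange (B y (G.t g)) (G.jac y x g) (B x (G.s g)))
    (fun y x g => permUnitary N (ρ y x g)) ?_ ?_ ?_ ?_ ?_ ?_⟩
  · exact fun x y g hx hy => frameChange_mem_unitary (hBu _ _ hy.1)
      (isUnit_jac (hUd x hx.1) (hUd y hy.1)) (hBu _ _ hx.1) (hinv x y g hx.1 hy.1)
  · intro x y g hg
    refine contMDiffWithinAt_frameChange ?_ ?_ ?_ (hBu _ _ hg.1.1)
    · exact (((hB y).contMDiffAt ((hUo y).mem_nhds hg.2.1)).comp g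
        G.smooth_t.contMDiffAt).contMDiffWithinAt
    · exact (G.contMDiffOn_jac x y).mono (fun h hh => ⟨hUd x hh.1.1, hUd y hh.2.1⟩) g hg
    · exact (((hB x).contMDiffAt ((hUo x).mem_nhds hg.1.1)).comp g
        G.smooth_s.contMDiffAt).contMDiffWithinAt
  · intro x y z g h e hx hy hz
    rw [G.s_mul e, G.t_mul e, ← G.jac_mul e (hUd x hx.1) (hUd y hy.1) (hUd z hz.1),
      ← frameChange_mul (hBu y _ hy.1), e]
  · exact fun x y g hx hy => (hloc x y g hx.2 hy.2).mono fun h hh => congrArg _ hh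
  · intro x y z g h e hx hy hz
    exact (map_mul (permUnitary N) _ _).symm.trans
      (congrArg _ (hmul x y z g h e hx.2 hy.2 hz.2))
  -- A trivial first component means identity derivative, so `g` is ineffective. A trivial second
  -- component means that `g` commutes with all ineffective loops, and the trivial centre makes it a
  -- unit.
  · intro x g e hx h1 h2
    rw [← e] at h1
    exact G.eq_unit_of_conj_eq hcenter
      (G.isIneffective_of_jac_eq_one (hUd x hx.1) e (eq_one_of_frameChange_eq_one (hBu x _ hx.1) h1))
      (hfaith x g e hx.2 (permUnitary_injective N (h2.trans (map_one _).symm)))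

end Representation

end OrbifoldPresentation

end

theorem mainTheorem2 {n m : ℕ} {G₀ G₁ : Type u}
    [TopologicalSpace G₀] [ChartedSpace (EuclideanSpace ℝ (Fin n)) G₀] [IsManifold (𝓡 n) ∞ G₀]
    [T2Space G₀] [SecondCountableTopology G₀]
    [TopologicalSpace G₁] [ChartedSpace (EuclideanSpace ℝ (Fin m)) G₁] [IsManifold (𝓡 m) ∞ G₁]
    [T2Space G₁] [SecondCountableTopology G₁]
    (G : OrbifoldPresentation.OrbifoldGroupoid (𝓡 n) (𝓡 m) G₀ G₁)
    (hconn : G.toSmoothGroupoid.IsConnected)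
    (hcenter : ∀ x : G₀, Subgroup.center (G.ineffectiveStabilizer x) = ⊥) :
    ∃ (p : ℕ) (P : Type u) (_ : TopologicalSpace P)
      (_ : ChartedSpace (EuclideanSpace ℝ (Fin p)) P) (_ : IsManifold (𝓡 p) ∞ P)
      (_ : T2Space P) (_ : SecondCountableTopology P)
      (k : ℕ) (K : Type) (_ : Group K) (_ : TopologicalSpace K)
      (_ : ChartedSpace (EuclideanSpace ℝ (Fin k)) K) (_ : LieGroup (𝓡 k) ∞ K)
      (_ : T2Space K) (_ : SecondCountableTopology K) (_ : CompactSpace K)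
      (α : OrbifoldPresentation.LieRightAction (𝓡 p) (𝓡 k) P K),
      OrbifoldPresentation.HSEquivalent G.toSmoothGroupoid α.translationGroupoid := by
  obtain ⟨N, ⟨c⟩⟩ := G.exists_faithfulCocycle hconn hcenter
  exact ⟨c.totalDim, c.Quot, inferInstance, inferInstance, inferInstance, inferInstance,
    inferInstance, _, _, inferInstance, inferInstance, inferInstance, inferInstance, inferInstance,
    inferInstance, OrbifoldPresentation.compactSpace_unitary_prod, c.quotAction, c.hsEquivalent⟩
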